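/- Let $\mathbb H^2_+(\mathbb R)\subset L^2(\mathbb R)$ be the Hardy space of the upper half-plane: the boundary values (as limits in $L^2(\mathbb R)$ of $F(\cdot+iy)$ as $y\downarrow 0$) of functions $F$ holomorphic in $\{\operatorname{Im} z>0\}$ with $\sup_{y>0}\int_{\mathbb R}|F(x+iy)|^2\,dx<\infty$. A bounded operator $\mathbf H$ in $\mathbb H^2_+(\mathbb R)$ is called the Hankel operator with symbol $\sigma\in L^\infty(\mathbb R)$ if $$(\mathbf H w,w)=\int_{\mathbb R}\sigma(\lambda)\,w(-\lambda)\,\overline{w(\lambda)}\,d\lambda\qquad\text{for all } w\in\mathbb H^2_+(\mathbb R).$$ Let $M\ge 0$, let $\alpha_1,\dots,\alpha_M\in\mathbb C$ be distinct with $\operatorname{Re}\alpha_m>0$, let $K_m\in\{0,1,2,\dots\}$, and let $Q_m$ be complex polynomials with $\deg Q_m\le K_m$ and $Q_m(-i\alpha_m)\ne 0$. Put $$\varphi(\lambda)=\sum_{m=1}^M Q_m(\lambda)\,(\alpha_m-i\lambda)^{-K_m-1}.$$ Then the Hankel operator $\mathbf H$ in $\mathbb H^2_+(\mathbb R)$ with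 symbol $\pi i\operatorname{sgn}\lambda+\varphi(\lambda)$ exists as a bounded operator. Suppose that $\mathbf H$ is self-adjoint. Then its strictly negative spectrum consists of eigenvalues, and the total number $N_-(\mathbf H)$ of its strictly negative eigenvalues, counted with multiplicity, is finite and equals $$N_-(\mathbf H)=\sum_{m:\ \operatorname{Im}\alpha_m=0}\mathcal N_-^{(m)}\;+\sum_{m:\ \operatorname{Im}\alpha_m>0}K_m\;+\;M_1,\qquad M_1=\#\{m:\operatorname{Im}\alpha_m>0\},$$ where, for $\operatorname{Im}\alpha_m=0$ (in which case $\mathsf p_m:=Q_m(-i\alpha_m)$ is real by self-adjointness of $\mathbf H$), $$\mathcal N_-^{(m)}=\begin{cases}(K_m+1)/2 & \text{if } K_m \text{ is odd},\\ K_m/2 & \text{if } K_m \text{ is even and } \mathsf p_m>0,\\ K_m/2+1 & \text{if } K_m \text{ is even and } \mathsf p_m<0.\end{cases}$$ -/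

import Mathlib

open MeasureTheory Filter Topology Complex
open scoped NNReal ENNReal Polynomial ComplexConjugate

noncomputable section

/-- The space `L²(ℝ)` of complex valued functions, with Lebesgue measure. -/
abbrev L2R : Type := Lp ℂ 2 (volume : Measure ℝ)

/-- `F` is holomorphic in the upper half-plane, has uniformly bounded `L²` norms on the horizontal
lines `Im z = y`, `y > 0`, and `f` is its boundary value on the real line, in the sense that
`F(· + i y) → f` in `L²(ℝ)` as `y ↓ 0`. -/
structure IsHardyExtension (F : ℂ → ℂ) (f : ℝ → ℂ) : Prop where
  holomorphic : DifferentiableOn ℂ F {z : ℂ | 0 < z.im}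
  bounded : ∃ C : ℝ≥0, ∀ y : ℝ, 0 < y →
    eLpNorm (fun x : ℝ => F ((x : ℂ) + (y : ℂ) * I)) 2 volume ≤ (C : ℝ≥0∞)
  boundary : Tendsto (fun y : ℝ => eLpNorm (fun x : ℝ => F ((x : ℂ) + (y : ℂ) * I) - f x) 2 volume)
    (𝓝[>] 0) (𝓝 0)

lemma IsHardyExtension.continuous_line {F : ℂ → ℂ} {f : ℝ → ℂ} (h : IsHardyExtension F f)
    {y : ℝ} (hy : 0 < y) : Continuous (fun x : ℝ => F ((x : ℂ) + (y : ℂ) * I)) := by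
  refine h.holomorphic.continuousOn.comp_continuous (by fun_prop) ?_
  intro x
  simpa using hy

lemma IsHardyExtension.congr {F : ℂ → ℂ} {f g : ℝ → ℂ} (h : IsHardyExtension F f)
    (hfg : f =ᵐ[volume] g) : IsHardyExtension F g := by
  refine ⟨h.holomorphic, h.bounded, ?_⟩
  refine h.boundary.congr fun y => eLpNorm_congr_ae ?_
  filter_upwards [hfg] with x hx
  rw [hx]

lemma IsHardyExtension.add {F G : ℂ → ℂ} {f g : ℝ → ℂ} (hF : IsHardyExtension F f)
    (hG : IsHardyExtension G g) (hf : AEStronglyMeasurable f volume)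
    (hg : AEStronglyMeasurable g volume) :
    IsHardyExtension (fun z => F z + G z) (fun x => f x + g x) := by
  refine ⟨hF.holomorphic.add hG.holomorphic, ?_, ?_⟩
  · obtain ⟨C, hC⟩ := hF.bounded
    obtain ⟨D, hD⟩ := hG.bounded
    refine ⟨C + D, fun y hy => ?_⟩
    have h := eLpNorm_add_le (p := 2) (μ := (volume : Measure ℝ))
      (hF.continuous_line hy).aestronglyMeasurable
      (hG.continuous_line hy).aestronglyMeasurable (by norm_num)
    refine h.trans ?_
    push_cast
    exact add_le_add (hC y hy) (hD y hy)
  · have h0 := hF.boundary.add hG.boundary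
    rw [add_zero] at h0
    refine tendsto_of_tendsto_of_tendsto_of_le_of_le' tendsto_const_nhds h0
      (Eventually.of_forall fun _ => zero_le) ?_
    filter_upwards [self_mem_nhdsWithin] with y hy
    have h := eLpNorm_add_le (p := 2) (μ := (volume : Measure ℝ))
      ((hF.continuous_line hy).aestronglyMeasurable.sub hf)
      ((hG.continuous_line hy).aestronglyMeasurable.sub hg) (by norm_num)
    refine le_trans (le_of_eq ?_) h
    congr 1
    funext x
    simp only [Pi.add_apply, Pi.sub_apply]
    ring

lemma IsHardyExtension.const_smul {F : ℂ → ℂ} {f : ℝ → ℂ} (hF : IsHardyExtension F f) (c : ℂ) :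
    IsHardyExtension (fun z => c * F z) (fun x => c * f x) := by
  refine ⟨hF.holomorphic.const_mul c, ?_, ?_⟩
  · obtain ⟨C, hC⟩ := hF.bounded
    refine ⟨‖c‖₊ * C, fun y hy => ?_⟩
    have h := eLpNorm_const_smul (p := 2) (μ := (volume : Measure ℝ)) c
      (fun x : ℝ => F ((x : ℂ) + (y : ℂ) * I))
    refine (le_of_eq h).trans ?_
    push_cast
    exact mul_le_mul' le_rfl (hC y hy)
  · have h0 : Tendsto (fun y : ℝ => ‖c‖ₑ *
        eLpNorm (fun x : ℝ => F ((x : ℂ) + (y : ℂ) * I) - f x) 2 volume) (𝓝[>] 0) (𝓝 (‖c‖ₑ * 0)) :=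
      ENNReal.Tendsto.const_mul hF.boundary (Or.inr enorm_ne_top)
    rw [mul_zero] at h0
    refine h0.congr fun y => ?_
    rw [← eLpNorm_const_smul (p := 2) (μ := (volume : Measure ℝ)) c
      (fun x : ℝ => F ((x : ℂ) + (y : ℂ) * I) - f x)]
    congr 1
    funext x
    simp only [Pi.smul_apply, smul_eq_mul]
    ring

lemma isHardyExtension_zero : IsHardyExtension (fun _ => 0) (fun _ => 0) :=
  ⟨differentiableOn_const _, ⟨0, fun _ _ => by simp⟩, by simp⟩

/-- The Hardy space `ℍ²₊(ℝ)` of the upper half-plane, realized as the subspace of `L²(ℝ)` formed by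
the boundary values. The norm and the inner product are those of `L²(ℝ)`. -/
def hardySpace : Submodule ℂ L2R where
  carrier := {f | ∃ F : ℂ → ℂ, IsHardyExtension F f}
  zero_mem' := ⟨_, isHardyExtension_zero.congr (Lp.coeFn_zero ℂ 2 volume).symm⟩
  add_mem' := by
    rintro f g ⟨F, hF⟩ ⟨G, hG⟩
    exact ⟨_, (hF.add hG (Lp.aestronglyMeasurable f) (Lp.aestronglyMeasurable g)).congr
      (Lp.coeFn_add f g).symm⟩
  smul_mem' := by
    rintro c f ⟨F, hF⟩
    exact ⟨_, (hF.const_smul c).congr (Lp.coeFn_smul c f).symm⟩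

/-- The bounded operator `H` in `ℍ²₊(ℝ)` is the Hankel operator with symbol `σ ∈ L^∞(ℝ)`:
`(H w, w) = ∫ σ(x) w(-x) \overline{w(x)} dx` for all `w ∈ ℍ²₊(ℝ)`.
(Mathlib's inner product is linear in the second argument.) -/
structure IsHankelOperator (σ : ℝ → ℂ) (H : hardySpace →L[ℂ] hardySpace) : Prop where
  memLp_symbol : MemLp σ ⊤ volume
  form_eq : ∀ w : hardySpace,
    inner ℂ w (H w) = ∫ x : ℝ, σ x * (w : L2R) (-x) * conj ((w : L2R) x)

/-- The symbol `π i sgn x` (of the Carleman operator). -/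
def carlemanSymbol (x : ℝ) : ℂ := (Real.pi : ℂ) * I * (Real.sign x : ℂ)

/-- The rational function `∑ₘ Qₘ(x) (αₘ - i x)^{-Kₘ-1}`. -/
def rationalSymbol {M : ℕ} (α : Fin M → ℂ) (K : Fin M → ℕ) (Q : Fin M → ℂ[X]) (x : ℝ) : ℂ :=
  ∑ m, (Q m).eval (x : ℂ) / (α m - I * (x : ℂ)) ^ (K m + 1)

/-- The contribution to the number of negative eigenvalues of a term with real `α`, where `K + 1` is
the order of the pole and `p` is the (real, nonzero) leading coefficient. -/
def negIndex (K : ℕ) (p : ℝ) : ℕ :=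
  if Odd K then (K + 1) / 2 else if 0 < p then K / 2 else K / 2 + 1

/-- The number of strictly negative eigenvalues of an operator, counted with (geometric)
multiplicity, as a cardinal. -/
def negEigenvalueCount {E : Type} [NormedAddCommGroup E] [InnerProductSpace ℂ E]
    (A : E →L[ℂ] E) : Cardinal.{0} :=
  Cardinal.sum fun μ : Set.Iio (0 : ℝ) =>
    Module.rank ℂ (Module.End.eigenspace (A : E →ₗ[ℂ] E) ((μ : ℝ) : ℂ))

end

/-! The functions 1/(b - ix), b > 0, span a dense subspace of the Hardy space
(`hardySpace_eq_closure`). For w = ∑ c_b/(b - ix) put f(s) = ∑ c_b/(s + b), the value at is of the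
holomorphic extension of w. Explicit integration on pairs of kernels gives
(`inner_kernelComb_hankelLp`) (Hw, w) = 2π (∫₀^∞ |f(s)|² ds + q(f)). The first term comes from the
Carleman symbol and is nonnegative; q is a form in finitely many derivatives of f at the points α_m
and their conjugates.

The number of negative eigenvalues of H is the negative index of q. It is at most that, because the
form of H is at least 2πq (`jetForm_le_hankelLp`). It is at least that, because f can have any
prescribed jets and an arbitrarily small norm in L²(0, ∞) (`exists_comb_jet`), so that a negative
subspace of q lifts to a negative subspace for H (`exists_negative_subspace`). Small f are built by
multiplication with powers of a rational factor that is 1 at α and less than 1 on the half-axis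
except at |α|. `negEigenvalueCount_eq` passes from the form to eigenvalues.

Self-adjointness makes q Hermitian, so the α_m are closed under conjugation with matching
coefficients (`exists_conjSymmetric`), and q is a block matrix of triangular Hankel blocks coupling
α_m with its conjugate. It is nondegenerate. The form becomes nonnegative once n_m low-order
coordinates vanish at each α_m: all K_m + 1 of them if Im α_m > 0, none if Im α_m < 0, about half if
α_m is real. The same holds for -q with numbers n'_m, and n_m + n'_m = K_m + 1; hence the negative
index of q is exactly ∑ n_m. -/

noncomputable section

/-! ### Negative eigenvalues and negative subspaces of the quadratic form -/

section OperatorTheory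

variable {E : Type} [NormedAddCommGroup E] [InnerProductSpace ℂ E]
  {F : Type*} [NormedAddCommGroup F] [NormedSpace ℂ F] [FiniteDimensional ℂ F]

lemma inner_self_eq_ofReal_norm_sq (x : E) : inner ℂ x x = ((‖x‖ ^ 2 : ℝ) : ℂ) := by
  rw [inner_self_eq_norm_sq_to_K]
  norm_cast

/-- If the form of a symmetric operator is nonnegative on a subspace of finite codimension, then the
negative spectrum consists of eigenvalues. -/
lemma hasEigenvalue_of_mem_spectrum_of_neg [CompleteSpace E] {A : E →L[ℂ] E}
    (hA : (A : E →ₗ[ℂ] E).IsSymmetric) (L : E →L[ℂ] F)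
    (hL : ∀ w, L w = 0 → 0 ≤ (inner ℂ w (A w)).re) {μ : ℝ} (hμ : μ < 0)
    (hs : (μ : ℂ) ∈ spectrum ℂ A) :
    Module.End.HasEigenvalue (A : E →ₗ[ℂ] E) (μ : ℂ) := by
  by_contra hne
  rw [spectrum.mem_iff] at hs
  apply hs
  -- If μ is not an eigenvalue, B = μ - A is injective. It is bounded below on ker L, where -Re (x,
  -- Bx) ≥ -μ‖x‖², so finite codimension of ker L makes the whole range closed. A symmetric
  -- injective operator with closed range is onto.
  set B : E →L[ℂ] E := algebraMap ℂ (E →L[ℂ] E) μ - A with hB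
  have hBapp : ∀ x, B x = (μ : ℂ) • x - A x := fun x => by
    simp [hB, Algebra.algebraMap_eq_smul_one]
  have hBsym : ∀ x y, inner ℂ (B x) y = inner ℂ x (B y) := fun x y => by
    have := hA x y
    simp only [ContinuousLinearMap.coe_coe] at this
    rw [hBapp, hBapp, inner_sub_left, inner_sub_right, inner_smul_left, inner_smul_right, this,
      conj_ofReal]
  have hinj : Function.Injective B := by
    rw [injective_iff_map_eq_zero]
    intro x hx
    by_contra hx0
    apply hne
    apply Module.End.hasEigenvalue_of_hasEigenvector (x := x)
    rw [Module.End.hasEigenvector_iff, Module.End.mem_eigenspace_iff]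
    refine ⟨?_, hx0⟩
    rw [hBapp, sub_eq_zero] at hx
    exact hx.symm
  set V : Submodule ℂ E := LinearMap.ker (L : E →ₗ[ℂ] F) with hV
  have hVc : IsClosed (V : Set E) := L.isClosed_ker
  have : CompleteSpace V := hVc.completeSpace_coe
  -- coercivity on `V`
  have hco : ∀ x : V, -μ * ‖x‖ ≤ ‖B x‖ := by
    intro x
    have h1 : -μ * ‖(x : E)‖ ^ 2 ≤ ‖(x : E)‖ * ‖B x‖ := by
      calc -μ * ‖(x : E)‖ ^ 2 ≤ -(inner ℂ (x : E) (B x)).re := by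
            have h0 := hL x x.2
            rw [hBapp, inner_sub_right, inner_smul_right, inner_self_eq_ofReal_norm_sq, sub_re,
              re_ofReal_mul, ofReal_re]
            linarith
        _ ≤ ‖inner ℂ (x : E) (B x)‖ := (neg_le_abs _).trans (Complex.abs_re_le_norm _)
        _ ≤ _ := norm_inner_le_norm _ _
    rcases (norm_nonneg (x : E)).eq_or_lt with h | h
    · simp [← h]
    · simp only [Submodule.coe_norm]
      nlinarith
  have hanti : AntilipschitzWith (Real.toNNReal (-μ)⁻¹) (B ∘L V.subtypeL) := by
    apply ContinuousLinearMap.antilipschitz_of_bound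
    intro x
    rw [Real.coe_toNNReal _ (by simpa using hμ.le), ← div_eq_inv_mul, le_div_iff₀ (by linarith)]
    have := hco x
    simp only [ContinuousLinearMap.coe_comp, Function.comp_apply, Submodule.subtypeL_apply]
    linarith
  have hclV : IsClosed ((LinearMap.range ((B ∘L V.subtypeL : V →L[ℂ] E) : V →ₗ[ℂ] E) : Submodule ℂ E) : Set E) := by
    have := hanti.isClosed_range (B ∘L V.subtypeL).uniformContinuous
    rwa [LinearMap.coe_range]
  -- L is injective on the orthogonal complement of its kernel.
  have hVfin : FiniteDimensional ℂ Vᗮ := by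
    refine FiniteDimensional.of_injective ((L : E →ₗ[ℂ] F) ∘ₗ Vᗮ.subtype) ?_
    rw [← LinearMap.ker_eq_bot, LinearMap.ker_eq_bot']
    intro x hx
    have h1 : (x : E) ∈ V := by simpa [hV] using hx
    have h2 := V.inner_right_of_mem_orthogonal h1 x.2
    simpa using h2
  have hcl : IsClosed ((LinearMap.range (B : E →ₗ[ℂ] E) : Submodule ℂ E) : Set E) := by
    have := Submodule.isClosed_sup_finiteDimensional
      (LinearMap.range ((B ∘L V.subtypeL : V →L[ℂ] E) : V →ₗ[ℂ] E)) (Submodule.map (B : E →ₗ[ℂ] E) Vᗮ) hclV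
    convert this using 2
    have h3 : LinearMap.range ((B ∘L V.subtypeL : V →L[ℂ] E) : V →ₗ[ℂ] E) = Submodule.map (B : E →ₗ[ℂ] E) V := by
      ext y
      simp
    rw [h3, ← Submodule.map_sup, Submodule.sup_orthogonal_of_hasOrthogonalProjection,
      Submodule.map_top]
  rw [ContinuousLinearMap.isUnit_iff_bijective]
  refine ⟨hinj, ?_⟩
  have : CompleteSpace (LinearMap.range (B : E →ₗ[ℂ] E)) := hcl.completeSpace_coe
  -- By symmetry of B, a vector orthogonal to the range lies in the kernel of B, which is zero.
  have hr : LinearMap.range (B : E →ₗ[ℂ] E) = ⊤ := by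
    rw [← Submodule.orthogonal_eq_bot_iff, Submodule.eq_bot_iff]
    intro y hy
    rw [Submodule.mem_orthogonal] at hy
    apply hinj
    rw [map_zero, ← inner_self_eq_zero (𝕜 := ℂ), ← hBsym]
    exact hy _ ⟨B y, rfl⟩
  intro y
  have : y ∈ LinearMap.range (B : E →ₗ[ℂ] E) := hr ▸ Submodule.mem_top
  exact this

/-- A self-adjoint operator whose spectrum is nonnegative is nonnegative. -/
lemma re_inner_nonneg_of_spectrum [CompleteSpace E] {A : E →L[ℂ] E}
    (hA : (A : E →ₗ[ℂ] E).IsSymmetric)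
    (h : ∀ μ : ℝ, μ < 0 → (μ : ℂ) ∉ spectrum ℂ A) (x : E) : 0 ≤ (inner ℂ x (A x)).re := by
  have hsa : IsSelfAdjoint A := by
    rw [ContinuousLinearMap.isSelfAdjoint_iff_isSymmetric]
    exact hA
  have h0 : 0 ≤ A := by
    rw [nonneg_iff_isSelfAdjoint_and_quasispectrumRestricts]
    refine ⟨hsa, ?_⟩
    rw [quasispectrumRestricts_iff_spectrumRestricts, SpectrumRestricts.nnreal_iff]
    intro μ hμ
    by_contra! hneg
    refine h μ hneg ?_
    rw [← spectrum.preimage_algebraMap ℂ] at hμ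
    simpa using hμ
  have := (ContinuousLinearMap.nonneg_iff_isPositive A).1 h0
  exact this.re_inner_nonneg_right x

/-- The linear map from the direct sum of the negative eigenspaces. -/
def negEigenspaceSum (A : E →L[ℂ] E) :
    (DirectSum (Set.Iio (0 : ℝ)) fun μ => Module.End.eigenspace (A : E →ₗ[ℂ] E) ((μ : ℝ) : ℂ))
      →ₗ[ℂ] E :=
  DirectSum.coeLinearMap fun μ : Set.Iio (0 : ℝ) =>
    Module.End.eigenspace (A : E →ₗ[ℂ] E) ((μ : ℝ) : ℂ)

lemma orthogonalFamily_negEigenspaces {A : E →L[ℂ] E} (hA : (A : E →ₗ[ℂ] E).IsSymmetric) :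
    OrthogonalFamily ℂ
      (fun μ : Set.Iio (0 : ℝ) => Module.End.eigenspace (A : E →ₗ[ℂ] E) ((μ : ℝ) : ℂ))
      (fun μ => (Module.End.eigenspace (A : E →ₗ[ℂ] E) ((μ : ℝ) : ℂ)).subtypeₗᵢ) :=
  hA.orthogonalFamily_eigenspaces.comp (γ := Set.Iio (0 : ℝ)) (f := fun μ => ((μ : ℝ) : ℂ))
    (fun _ _ hab => Subtype.ext (Complex.ofReal_injective hab))

/-- Distinct eigenspaces are orthogonal, so the form equals ∑ μ‖x_μ‖² over the nonzero components.
-/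
lemma negEigenspaceSum_form_neg {A : E →L[ℂ] E} (hA : (A : E →ₗ[ℂ] E).IsSymmetric)
    {x : DirectSum (Set.Iio (0 : ℝ)) fun μ =>
      Module.End.eigenspace (A : E →ₗ[ℂ] E) ((μ : ℝ) : ℂ)} (hx : x ≠ 0) :
    (inner ℂ (negEigenspaceSum A x) (A (negEigenspaceSum A x))).re < 0 := by
  classical
  have h1 : negEigenspaceSum A x = ∑ i ∈ x.support, ((x i : E)) := by
    rw [negEigenspaceSum, DirectSum.coeLinearMap_eq_dfinsuppSum, DFinsupp.sum]
  have h2 : A (negEigenspaceSum A x) =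
      ∑ i ∈ x.support, ((((i : ℝ) : ℂ) • x i :
        Module.End.eigenspace (A : E →ₗ[ℂ] E) ((i : ℝ) : ℂ)) : E) := by
    rw [h1, map_sum]
    refine Finset.sum_congr rfl fun i _ => ?_
    have := Module.End.mem_eigenspace_iff.1 (x i).2
    simpa using this
  rw [h2, h1]
  have h3 := (orthogonalFamily_negEigenspaces hA).inner_sum (fun i => x i)
    (fun i => (((i : ℝ) : ℂ) • x i)) x.support
  simp only [Submodule.coe_subtypeₗᵢ, Submodule.subtype_apply] at h3
  rw [h3, Complex.re_sum]
  refine Finset.sum_neg (fun i hi => ?_) ?_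
  · rw [inner_smul_right, inner_self_eq_ofReal_norm_sq, re_ofReal_mul, ofReal_re]
    have hi' : x i ≠ 0 := by simpa using hi
    have : 0 < ‖x i‖ ^ 2 := by positivity
    exact mul_neg_of_neg_of_pos i.2 this
  · rw [Finset.nonempty_iff_ne_empty]
    simpa using hx

lemma negEigenspaceSum_injective {A : E →L[ℂ] E} (hA : (A : E →ₗ[ℂ] E).IsSymmetric) :
    Function.Injective (negEigenspaceSum A) := by
  rw [injective_iff_map_eq_zero]
  intro x hx
  by_contra h0
  have := negEigenspaceSum_form_neg hA h0
  simp [hx] at this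

lemma rank_range_negEigenspaceSum {A : E →L[ℂ] E} (hA : (A : E →ₗ[ℂ] E).IsSymmetric) :
    Module.rank ℂ (LinearMap.range (negEigenspaceSum A)) = negEigenvalueCount A := by
  classical
  rw [rank_range_of_injective _ (negEigenspaceSum_injective hA), negEigenvalueCount,
    rank_directSum]

/-- The form is negative on the sum of the negative eigenspaces and nonnegative on ker L; hence L is
injective on that sum. -/
lemma negEigenvalueCount_le {F : Type} [NormedAddCommGroup F] [NormedSpace ℂ F]
    [FiniteDimensional ℂ F] {A : E →L[ℂ] E}
    (hA : (A : E →ₗ[ℂ] E).IsSymmetric) (L : E →L[ℂ] F)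
    (hL : ∀ w, L w = 0 → 0 ≤ (inner ℂ w (A w)).re) :
    negEigenvalueCount A ≤ Module.finrank ℂ F := by
  classical
  rw [Module.finrank_eq_rank, negEigenvalueCount, ← rank_directSum]
  refine LinearMap.rank_le_of_injective ((L : E →ₗ[ℂ] F) ∘ₗ negEigenspaceSum A) ?_
  rw [injective_iff_map_eq_zero]
  intro x hx
  by_contra h0
  exact absurd (hL _ hx) (not_le.2 (negEigenspaceSum_form_neg hA h0))

lemma mem_orthogonal_range_negEigenspaceSum {A : E →L[ℂ] E} {x : E} :
    x ∈ (LinearMap.range (negEigenspaceSum A))ᗮ ↔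
      ∀ μ : ℝ, μ < 0 → ∀ v, A v = (μ : ℂ) • v → inner ℂ v x = 0 := by
  classical
  have : LinearMap.range (negEigenspaceSum A) = ⨆ μ : Set.Iio (0 : ℝ),
      Module.End.eigenspace (A : E →ₗ[ℂ] E) ((μ : ℝ) : ℂ) :=
    DirectSum.range_coeLinearMap
  rw [this, ← Submodule.iInf_orthogonal]
  simp only [Submodule.mem_iInf, Submodule.mem_orthogonal, Module.End.mem_eigenspace_iff,
    Subtype.forall, Set.mem_Iio, ContinuousLinearMap.coe_coe]

/-- If the form of a self-adjoint operator is nonnegative on a subspace of codimension at most `N`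
and negative on a subspace of dimension at least `N`, then the operator has exactly `N` negative
eigenvalues. -/
theorem negEigenvalueCount_eq [CompleteSpace E] {F : Type} [NormedAddCommGroup F]
    [NormedSpace ℂ F] [FiniteDimensional ℂ F] {A : E →L[ℂ] E}
    (hA : (A : E →ₗ[ℂ] E).IsSymmetric) (L : E →L[ℂ] F)
    (hL : ∀ w, L w = 0 → 0 ≤ (inner ℂ w (A w)).re)
    {W : Type*} [AddCommGroup W] [Module ℂ W] [FiniteDimensional ℂ W] (J : W →ₗ[ℂ] E)
    (hW : ∀ x, x ≠ 0 → (inner ℂ (J x) (A (J x))).re < 0)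
    (hdim : Module.finrank ℂ F ≤ Module.finrank ℂ W) :
    negEigenvalueCount A = Module.finrank ℂ F := by
  refine le_antisymm (negEigenvalueCount_le hA L hL) ?_
  by_contra! hlt
  set G := LinearMap.range (negEigenspaceSum A) with hG
  have hrank : Module.rank ℂ G = negEigenvalueCount A := rank_range_negEigenspaceSum hA
  have hGfin : FiniteDimensional ℂ G := by
    refine Module.rank_lt_aleph0_iff.1 ?_
    rw [hrank]
    exact hlt.trans (Cardinal.natCast_lt_aleph0)
  have hGW : Module.finrank ℂ G < Module.finrank ℂ W := by
    rw [← hrank, ← Module.finrank_eq_rank ℂ G, Nat.cast_lt] at hlt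
    exact hlt.trans_le hdim
  -- With too few negative eigenvectors, dimension count yields a nonzero x with J x orthogonal to
  -- all of them, while the form at J x is negative.
  obtain ⟨x, hx, hx0⟩ : ∃ x, x ∈ LinearMap.ker ((G.orthogonalProjectionOnto : E →ₗ[ℂ] G) ∘ₗ J) ∧
      x ≠ 0 :=
    Submodule.exists_mem_ne_zero_of_ne_bot (LinearMap.ker_ne_bot_of_finrank_lt hGW)
  have hxG : J x ∈ Gᗮ := by simpa using hx
  have hinv : ∀ v ∈ Gᗮ, A v ∈ Gᗮ := by
    intro v hv
    rw [mem_orthogonal_range_negEigenspaceSum] at hv ⊢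
    intro μ hμ u hu
    have h1 : inner ℂ (A u) v = inner ℂ u (A v) := hA u v
    rw [← h1, hu, inner_smul_left, hv μ hμ u hu, mul_zero]
  set A' : Gᗮ →L[ℂ] Gᗮ := (A ∘L Gᗮ.subtypeL).codRestrict Gᗮ (fun v => hinv v v.2) with hA'
  have hA'app : ∀ v : Gᗮ, ((A' v : Gᗮ) : E) = A v := fun v => rfl
  have hA's : (A' : Gᗮ →ₗ[ℂ] Gᗮ).IsSymmetric := fun u v => hA u v
  -- A negative spectral point of the restriction to Gᗮ would be an eigenvalue, and its eigenvector
  -- would lie both in G and in Gᗮ. So the restriction is nonnegative, contrary to the choice of x.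
  have hpos := re_inner_nonneg_of_spectrum hA's (fun μ hμ hsp => by
    obtain ⟨v, hv⟩ := (hasEigenvalue_of_mem_spectrum_of_neg hA's (L ∘L Gᗮ.subtypeL)
      (fun w hw => hL w hw) hμ hsp).exists_hasEigenvector
    rw [Module.End.hasEigenvector_iff, Module.End.mem_eigenspace_iff] at hv
    obtain ⟨hv1, hv0⟩ := hv
    have hv2 : A (v : E) = (μ : ℂ) • (v : E) := by
      rw [← hA'app]
      exact congrArg Subtype.val hv1
    have := mem_orthogonal_range_negEigenspaceSum.1 v.2 μ hμ v hv2
    rw [inner_self_eq_zero] at this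
    exact hv0 (Subtype.ext this)) ⟨J x, hxG⟩
  exact absurd hpos (not_le.2 (hW x hx0))

end OperatorTheory

/-! ### Explicit integrals of rational functions -/

section Integrals

/-- The function `(a - i x)^{-k-1}`. -/
def cauchyKernel (a : ℂ) (k : ℕ) (x : ℝ) : ℂ := 1 / (a - I * x) ^ (k + 1)

lemma sub_I_mul_ne_zero {a : ℂ} (ha : 0 < a.re) (x : ℝ) : a - I * x ≠ 0 := by
  intro h
  have := congrArg Complex.re h
  simp at this
  linarith

lemma add_I_mul_ne_zero {a : ℂ} (ha : 0 < a.re) (x : ℝ) : a + I * x ≠ 0 := by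
  have := sub_I_mul_ne_zero ha (-x)
  push_cast at this
  simpa using this

lemma re_le_norm_sub_I_mul (a : ℂ) (x : ℝ) : a.re ≤ ‖a - I * x‖ := by
  have := Complex.re_le_norm (a - I * x)
  simpa using this

lemma cauchyKernel_neg (a : ℂ) (k : ℕ) (x : ℝ) :
    cauchyKernel a k (-x) = 1 / (a + I * x) ^ (k + 1) := by
  simp [cauchyKernel]

lemma conj_cauchyKernel (a : ℂ) (k : ℕ) (x : ℝ) :
    conj (cauchyKernel a k x) = 1 / (conj a + I * x) ^ (k + 1) := by
  simp [cauchyKernel]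

lemma continuous_cauchyKernel {a : ℂ} (ha : 0 < a.re) (k : ℕ) : Continuous (cauchyKernel a k) := by
  unfold cauchyKernel
  exact continuous_const.div (by fun_prop) fun x => pow_ne_zero _ (sub_I_mul_ne_zero ha x)

lemma norm_cauchyKernel_le {a : ℂ} (ha : 0 < a.re) (k : ℕ) (x : ℝ) :
    ‖cauchyKernel a k x‖ ≤ (1 / a.re) ^ (k + 1) := by
  rw [cauchyKernel, norm_div, norm_one, norm_pow, ← one_div_pow]
  have := re_le_norm_sub_I_mul a x
  gcongr

lemma sq_norm_cauchyKernel_zero (a : ℂ) (x : ℝ) :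
    ‖cauchyKernel a 0 x‖ ^ 2 = 1 / (a.re ^ 2 + (x - a.im) ^ 2) := by
  rw [cauchyKernel, norm_div, norm_one, zero_add, pow_one, div_pow, one_pow, ← normSq_eq_norm_sq,
    normSq_apply]
  congr 1
  simp
  ring

lemma integrable_sq_norm_cauchyKernel_zero {a : ℂ} (ha : 0 < a.re) :
    Integrable (fun x => ‖cauchyKernel a 0 x‖ ^ 2) := by
  have h := (((integrable_inv_one_add_sq).comp_div ha.ne').comp_sub_right a.im).const_mul
    (1 / a.re ^ 2)
  refine h.congr (Eventually.of_forall fun x => ?_)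
  simp only [sq_norm_cauchyKernel_zero]
  field_simp

lemma memLp_cauchyKernel {a : ℂ} (ha : 0 < a.re) (k : ℕ) :
    MemLp (cauchyKernel a k) 2 (volume : Measure ℝ) := by
  have h0 : MemLp (cauchyKernel a 0) 2 (volume : Measure ℝ) :=
    (memLp_two_iff_integrable_sq_norm (continuous_cauchyKernel ha 0).aestronglyMeasurable).2
      (integrable_sq_norm_cauchyKernel_zero ha)
  refine h0.of_le_mul (c := (1 / a.re) ^ k) (continuous_cauchyKernel ha k).aestronglyMeasurable
    (Eventually.of_forall fun x => ?_)
  have h1 : cauchyKernel a k x = (1 / (a - I * x)) ^ k * cauchyKernel a 0 x := by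
    simp [cauchyKernel, pow_succ]
    ring
  rw [h1, norm_mul, norm_pow, norm_div, norm_one]
  have := re_le_norm_sub_I_mul a x
  gcongr

lemma memLp_cauchyKernel_neg {a : ℂ} (ha : 0 < a.re) (k : ℕ) :
    MemLp (fun x : ℝ => 1 / (a + I * x) ^ (k + 1)) 2 (volume : Measure ℝ) := by
  have := (memLp_cauchyKernel ha k).comp_measurePreserving (Measure.measurePreserving_neg volume)
  refine this.ae_eq (Eventually.of_forall fun x => ?_)
  simp [cauchyKernel]

lemma integrable_mul_of_memLp {f g : ℝ → ℂ} (hf : MemLp f 2 (volume : Measure ℝ))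
    (hg : MemLp g 2 (volume : Measure ℝ)) : Integrable (fun x => f x * g x) :=
  hf.integrable_mul hg

/-- For x > 0, log(b + ux) = log x + log(u + b/x). This supplies the values at infinity of the
logarithmic antiderivatives that replace residue calculus below. -/
lemma tendsto_log_add_mul_sub_log (b : ℂ) {u : ℂ} (hu : u ∈ slitPlane) :
    Tendsto (fun x : ℝ => log (b + u * x) - (Real.log x : ℂ)) atTop (𝓝 (log u)) := by
  have h1 : Tendsto (fun x : ℝ => b * ((x⁻¹ : ℝ) : ℂ) + u) atTop (𝓝 u) := by
    have : Tendsto (fun x : ℝ => ((x⁻¹ : ℝ) : ℂ)) atTop (𝓝 ((0 : ℝ) : ℂ)) :=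
      (continuous_ofReal.tendsto 0).comp tendsto_inv_atTop_zero
    simpa using (this.const_mul b).add_const u
  have h2 := h1.clog hu
  refine h2.congr' ?_
  filter_upwards [eventually_gt_atTop 0, h1.eventually_ne (slitPlane_ne_zero hu)] with x hx hne
  have hx' : (x : ℂ) ≠ 0 := by exact_mod_cast hx.ne'
  have : b + u * x = (x : ℂ) * (b * ((x⁻¹ : ℝ) : ℂ) + u) := by
    push_cast
    field_simp
  rw [this, log_ofReal_mul hx hne]
  ring

lemma I_mem_slitPlane' : I ∈ slitPlane := by simp [mem_slitPlane_iff]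

lemma neg_I_mem_slitPlane : -I ∈ slitPlane := by simp [mem_slitPlane_iff]

lemma hasDerivAt_log_add_mul {a u : ℂ} {x : ℝ} (h : a + u * x ∈ slitPlane) :
    HasDerivAt (fun x : ℝ => log (a + u * x)) (u / (a + u * x)) x := by
  have h1 : HasDerivAt (fun x : ℝ => a + u * (x : ℂ)) u x := by
    simpa using ((hasDerivAt_id x).ofReal_comp.const_mul u).const_add a
  exact h1.clog_real h

lemma tendsto_log_add_sub_log_add (a b : ℂ) {u v : ℂ} (hu : u ∈ slitPlane) (hv : v ∈ slitPlane) :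
    Tendsto (fun x : ℝ => log (a + u * x) - log (b + v * x)) atTop (𝓝 (log u - log v)) := by
  refine ((tendsto_log_add_mul_sub_log a hu).sub (tendsto_log_add_mul_sub_log b hv)).congr
    fun x => ?_
  ring

lemma tendsto_log_add_sub_log_add_atBot (a b : ℂ) {u v : ℂ} (hu : -u ∈ slitPlane)
    (hv : -v ∈ slitPlane) :
    Tendsto (fun x : ℝ => log (a + u * x) - log (b + v * x)) atBot
      (𝓝 (log (-u) - log (-v))) := by
  refine ((tendsto_log_add_sub_log_add a b hu hv).comp tendsto_neg_atBot_atTop).congr fun x => ?_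
  simp

lemma add_I_mul_mem_slitPlane {a : ℂ} (ha : 0 < a.re) (x : ℝ) : a + I * x ∈ slitPlane := by
  left; simpa using ha

lemma add_neg_I_mul_mem_slitPlane {a : ℂ} (ha : 0 < a.re) (x : ℝ) : a + -I * x ∈ slitPlane := by
  left; simpa using ha

lemma add_ne_zero_of_re_pos {a b : ℂ} (ha : 0 < a.re) (hb : 0 < b.re) : a + b ≠ 0 := by
  intro h
  have := congrArg Complex.re h
  simp at this
  linarith

/-- The antiderivative is i/(a + b) times log(b - ix) - log(a + ix). Both arguments stay in the
right half-plane, so the principal branch applies, and the difference of logarithms goes from πi at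
-∞ to -πi at +∞. -/
lemma integral_inv_mul_inv {a b : ℂ} (ha : 0 < a.re) (hb : 0 < b.re) :
    ∫ x : ℝ, 1 / (a + I * x) ^ 1 * (1 / (b - I * x) ^ 1) = 2 * Real.pi / (a + b) := by
  have hab := add_ne_zero_of_re_pos ha hb
  have hint : Integrable (fun x : ℝ => 1 / (a + I * x) ^ 1 * (1 / (b - I * x) ^ 1)) :=
    integrable_mul_of_memLp (memLp_cauchyKernel_neg ha 0) (memLp_cauchyKernel hb 0)
  have hder : ∀ x : ℝ, HasDerivAt
      (fun x : ℝ => I / (a + b) * (log (b + -I * x) - log (a + I * x)))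
      (1 / (a + I * x) ^ 1 * (1 / (b - I * x) ^ 1)) x := by
    intro x
    have := ((hasDerivAt_log_add_mul (add_neg_I_mul_mem_slitPlane hb x)).sub
      (hasDerivAt_log_add_mul (add_I_mul_mem_slitPlane ha x))).const_mul (I / (a + b))
    refine this.congr_deriv ?_
    have h1 := add_I_mul_ne_zero ha x
    have h2 := sub_I_mul_ne_zero hb x
    have h3 : b + -I * x = b - I * x := by ring
    rw [h3]
    field_simp
    ring_nf
    simp
  have h1 := (tendsto_log_add_sub_log_add b a neg_I_mem_slitPlane I_mem_slitPlane').const_mul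
    (I / (a + b))
  have h2 := (tendsto_log_add_sub_log_add_atBot b a (u := -I) (v := I) (by
    simpa using I_mem_slitPlane') neg_I_mem_slitPlane).const_mul (I / (a + b))
  rw [integral_of_hasDerivAt_of_tendsto hder hint h2 h1, neg_neg, log_I, log_neg_I]
  field_simp
  ring_nf
  simp

lemma tendsto_inv_add_I_mul_pow (a : ℂ) (k : ℕ) {l : Filter ℝ}
    (hl : Tendsto (fun x : ℝ => |x|) l atTop) :
    Tendsto (fun x : ℝ => 1 / (a + I * x) ^ (k + 1)) l (𝓝 0) := by
  have h1 : Tendsto (fun x : ℝ => ‖a + I * x‖) l atTop := by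
    refine tendsto_atTop_mono (fun x => ?_) (tendsto_atTop_add_const_right _ (-‖a‖) hl)
    have := norm_sub_norm_le (I * (x : ℂ)) (-a)
    simp only [norm_mul, norm_I, one_mul, norm_real, Real.norm_eq_abs, norm_neg,
      sub_neg_eq_add] at this
    rw [add_comm a]
    linarith
  have h2 := ((tendsto_inv₀_cobounded (α := ℂ)).comp
    (tendsto_norm_atTop_iff_cobounded.1 h1)).pow (k + 1)
  simpa using h2

lemma integral_inv_pow_eq_zero {a : ℂ} (ha : 0 < a.re) (k : ℕ) :
    ∫ x : ℝ, 1 / (a + I * x) ^ (k + 2) = 0 := by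
  have hint : Integrable (fun x : ℝ => 1 / (a + I * x) ^ (k + 2)) := by
    refine (integrable_mul_of_memLp (memLp_cauchyKernel_neg ha 0)
      (memLp_cauchyKernel_neg ha k)).congr (Eventually.of_forall fun x => ?_)
    simp only [zero_add, pow_one]
    field_simp
    ring
  have hder : ∀ x : ℝ, HasDerivAt
      (fun x : ℝ => I / (k + 1) * (1 / (a + I * x) ^ (k + 1))) (1 / (a + I * x) ^ (k + 2)) x := by
    intro x
    have h0 := add_I_mul_ne_zero ha x
    have h1 : HasDerivAt (fun x : ℝ => a + I * (x : ℂ)) I x := by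
      simpa using ((hasDerivAt_id x).ofReal_comp.const_mul I).const_add a
    have h2 := ((h1.pow (k + 1)).inv (pow_ne_zero _ h0)).const_mul (I / (k + 1))
    simp only [one_div]
    refine h2.congr_deriv ?_
    have h3 : ((k : ℂ) + 1) ≠ 0 := by exact_mod_cast k.succ_ne_zero
    simp only [Pi.pow_apply, add_tsub_cancel_right]
    push_cast
    generalize a + I * (x : ℂ) = z at h0
    have h4 : I / ((k : ℂ) + 1) * (-((k + 1) * z ^ k * I) / (z ^ (k + 1)) ^ 2) =
        -(I * I) * (z ^ k / (z ^ (k + 1)) ^ 2) := by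
      field_simp
    rw [h4, I_mul_I]
    field_simp
    ring
  have h1 := (tendsto_inv_add_I_mul_pow a k tendsto_abs_atBot_atTop).const_mul (I / ((k : ℂ) + 1))
  have h2 := (tendsto_inv_add_I_mul_pow a k tendsto_abs_atTop_atTop).const_mul (I / ((k : ℂ) + 1))
  rw [integral_of_hasDerivAt_of_tendsto hder hint h1 h2, sub_self]

/-- The inner products of a kernel of order `k` with kernels of order zero. -/
lemma integral_inv_pow_mul_inv {a b : ℂ} (ha : 0 < a.re) (hb : 0 < b.re) (k : ℕ) :
    ∫ x : ℝ, 1 / (a + I * x) ^ (k + 1) * (1 / (b - I * x) ^ 1) =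
      2 * Real.pi / (a + b) ^ (k + 1) := by
  have hab := add_ne_zero_of_re_pos ha hb
  induction k with
  | zero => simpa using integral_inv_mul_inv ha hb
  | succ k ih =>
    have h1 : Integrable (fun x : ℝ => 1 / (a + I * x) ^ (k + 1) * (1 / (b - I * x) ^ 1)) :=
      integrable_mul_of_memLp (memLp_cauchyKernel_neg ha k) (memLp_cauchyKernel hb 0)
    have h2 : Integrable (fun x : ℝ => 1 / (a + I * x) ^ (k + 2)) := by
      refine (integrable_mul_of_memLp (memLp_cauchyKernel_neg ha 0)
        (memLp_cauchyKernel_neg ha k)).congr (Eventually.of_forall fun x => ?_)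
      simp only [zero_add, pow_one]
      field_simp
      ring
    -- Insert a + b = (a + ix) + (b - ix): one term loses a power of a + ix, the other is a pure
    -- power with integral zero.
    have h3 : ∀ x : ℝ, 1 / (a + I * x) ^ (k + 1 + 1) * (1 / (b - I * x) ^ 1) =
        (1 / (a + b)) * (1 / (a + I * x) ^ (k + 2) +
          1 / (a + I * x) ^ (k + 1) * (1 / (b - I * x) ^ 1)) := by
      intro x
      have h4 := add_I_mul_ne_zero ha x
      have h5 := sub_I_mul_ne_zero hb x
      field_simp
      ring
    simp only [h3]
    rw [integral_const_mul, integral_add h2 h1, integral_inv_pow_eq_zero ha, ih]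
    field_simp
    ring

/-- Both poles lie on the same side of the real line. The difference of logarithms in the
antiderivative tends to 0 at both ends; b = c needs a separate antiderivative. -/
lemma integral_inv_mul_inv_eq_zero {b c : ℂ} (hb : 0 < b.re) (hc : 0 < c.re) :
    ∫ x : ℝ, 1 / (b + I * x) ^ 1 * (1 / (c + I * x) ^ 1) = 0 := by
  by_cases hbc : b = c
  · subst hbc
    rw [← integral_inv_pow_eq_zero hb 0]
    refine integral_congr_ae (Eventually.of_forall fun x => ?_)
    simp only [pow_one]
    field_simp
  have hbc' : c - b ≠ 0 := sub_ne_zero.2 (Ne.symm hbc)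
  have hint : Integrable (fun x : ℝ => 1 / (b + I * x) ^ 1 * (1 / (c + I * x) ^ 1)) :=
    integrable_mul_of_memLp (memLp_cauchyKernel_neg hb 0) (memLp_cauchyKernel_neg hc 0)
  have hder : ∀ x : ℝ, HasDerivAt
      (fun x : ℝ => -I / (c - b) * (log (b + I * x) - log (c + I * x)))
      (1 / (b + I * x) ^ 1 * (1 / (c + I * x) ^ 1)) x := by
    intro x
    have := ((hasDerivAt_log_add_mul (add_I_mul_mem_slitPlane hb x)).sub
      (hasDerivAt_log_add_mul (add_I_mul_mem_slitPlane hc x))).const_mul (-I / (c - b))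
    refine this.congr_deriv ?_
    have h1 := add_I_mul_ne_zero hb x
    have h2 := add_I_mul_ne_zero hc x
    field_simp
    ring_nf
    simp
    ring
  have h1 := (tendsto_log_add_sub_log_add b c I_mem_slitPlane' I_mem_slitPlane').const_mul
    (-I / (c - b))
  have h2 := (tendsto_log_add_sub_log_add_atBot b c (u := I) (v := I) neg_I_mem_slitPlane
    neg_I_mem_slitPlane).const_mul (-I / (c - b))
  rw [integral_of_hasDerivAt_of_tendsto hder hint h2 h1]
  simp

lemma integrable_cauchyKernel_mul {a b c : ℂ} (ha : 0 < a.re) (hb : 0 < b.re) (hc : 0 < c.re)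
    (k : ℕ) : Integrable (fun x : ℝ => cauchyKernel a k x *
      (1 / (b + I * x) ^ 1 * (1 / (c + I * x) ^ 1))) :=
  (integrable_mul_of_memLp (memLp_cauchyKernel_neg hb 0) (memLp_cauchyKernel_neg hc 0)).bdd_mul
    (continuous_cauchyKernel ha k).aestronglyMeasurable
    (Eventually.of_forall fun x => norm_cauchyKernel_le ha k x)

/-- The Hankel form with symbol `(a - i x)^{-k-1}` on kernels of order zero. -/
lemma integral_cauchyKernel_mul {a b c : ℂ} (ha : 0 < a.re) (hb : 0 < b.re) (hc : 0 < c.re)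
    (k : ℕ) :
    ∫ x : ℝ, cauchyKernel a k x * (1 / (b + I * x) ^ 1 * (1 / (c + I * x) ^ 1)) =
      2 * Real.pi * ∑ p ∈ Finset.HasAntidiagonal.antidiagonal k,
        1 / (a + b) ^ (p.1 + 1) * (1 / (a + c) ^ (p.2 + 1)) := by
  have hab := add_ne_zero_of_re_pos ha hb
  have hac := add_ne_zero_of_re_pos ha hc
  have hJ : ∀ k : ℕ, Integrable (fun x : ℝ => 1 / (c + I * x) ^ 1 * cauchyKernel a k x) := fun k =>
    integrable_mul_of_memLp (memLp_cauchyKernel_neg hc 0) (memLp_cauchyKernel ha k)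
  have hJi : ∀ k : ℕ, ∫ x : ℝ, 1 / (c + I * x) ^ 1 * cauchyKernel a k x =
      2 * Real.pi / (a + c) ^ (k + 1) := by
    intro k
    rw [← integral_inv_pow_mul_inv ha hc k, ← integral_neg_eq_self]
    refine integral_congr_ae (Eventually.of_forall fun x => ?_)
    simp [cauchyKernel, mul_comm, sub_eq_add_neg]
  -- The identity a + b = (a - ix) + (b + ix) removes one power of a - ix and splits off one term of
  -- the antidiagonal sum. At k = 0 the remaining product has both poles on one side and integrates
  -- to zero.
  have hstep : ∀ k : ℕ, ∀ x : ℝ, cauchyKernel a k x *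
      (1 / (b + I * x) ^ 1 * (1 / (c + I * x) ^ 1)) = (1 / (a + b)) *
        (1 / (c + I * x) ^ 1 * cauchyKernel a k x +
          1 / (a - I * x) ^ k * (1 / (b + I * x) ^ 1 * (1 / (c + I * x) ^ 1))) := by
    intro k x
    have h1 := sub_I_mul_ne_zero ha x
    have h2 := add_I_mul_ne_zero hb x
    have h3 := add_I_mul_ne_zero hc x
    unfold cauchyKernel
    field_simp
    ring
  induction k with
  | zero =>
    simp only [hstep 0, pow_zero, div_one, one_mul]
    rw [integral_const_mul, integral_add (hJ 0) (integrable_mul_of_memLp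
      (memLp_cauchyKernel_neg hb 0) (memLp_cauchyKernel_neg hc 0)), hJi,
      integral_inv_mul_inv_eq_zero hb hc]
    simp
    field_simp
  | succ k ih =>
    simp only [hstep (k + 1)]
    have := integrable_cauchyKernel_mul ha hb hc k
    unfold cauchyKernel at this ih
    rw [integral_const_mul, integral_add (hJ _) this, hJi, ih,
      Finset.Nat.sum_antidiagonal_succ, mul_add, mul_add,
      Finset.mul_sum, Finset.mul_sum, Finset.mul_sum]
    congr 1
    · simp
      field_simp
    · refine Finset.sum_congr rfl fun p _ => ?_
      simp
      field_simp
      ring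

lemma tendsto_log_add_sub_log_add_zero (p q : ℝ) :
    Tendsto (fun x : ℝ => Real.log (x + p) - Real.log (x + q)) atTop (𝓝 0) := by
  have := (Real.tendsto_log_comp_add_sub_log p).sub (Real.tendsto_log_comp_add_sub_log q)
  rw [sub_zero] at this
  refine this.congr fun x => ?_
  ring

/-- The first integrand is, up to a constant, what the Carleman form becomes after folding the line
at 0. Both integrands are nonnegative and have antiderivatives that tend to 0 at infinity and agree
at 0, logarithmic if b ≠ c and rational if b = c. -/
lemma integral_Ioi_stieltjes {b c : ℝ} (hb : 0 < b) (hc : 0 < c) :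
    IntegrableOn (fun x : ℝ => (b + c) * x / ((x ^ 2 + b ^ 2) * (x ^ 2 + c ^ 2))) (Set.Ioi 0) ∧
    IntegrableOn (fun s : ℝ => 1 / (s + b) * (1 / (s + c))) (Set.Ioi 0) ∧
    ∫ x in Set.Ioi (0 : ℝ), (b + c) * x / ((x ^ 2 + b ^ 2) * (x ^ 2 + c ^ 2)) =
      ∫ s in Set.Ioi (0 : ℝ), 1 / (s + b) * (1 / (s + c)) := by
  obtain ⟨F, G, hF, hG, hF', hG', h0⟩ : ∃ F G : ℝ → ℝ,
      (∀ x ∈ Set.Ici (0 : ℝ), HasDerivAt F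
        ((b + c) * x / ((x ^ 2 + b ^ 2) * (x ^ 2 + c ^ 2))) x) ∧
      (∀ x ∈ Set.Ici (0 : ℝ), HasDerivAt G (1 / (x + b) * (1 / (x + c))) x) ∧
      Tendsto F atTop (𝓝 0) ∧ Tendsto G atTop (𝓝 0) ∧ F 0 = G 0 := by
    by_cases hbc : b = c
    · subst hbc
      refine ⟨fun x => -b * (x ^ 2 + b ^ 2)⁻¹, fun x => -(x + b)⁻¹, ?_, ?_, ?_, ?_, ?_⟩
      · intro x _
        have h1 : HasDerivAt (fun x : ℝ => x ^ 2 + b ^ 2) (2 * x) x := by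
          simpa using (hasDerivAt_pow 2 x).add_const (b ^ 2)
        have h2 : x ^ 2 + b ^ 2 ≠ 0 := by positivity
        refine ((h1.inv h2).const_mul (-b)).congr_deriv ?_
        field_simp
        ring
      · intro x hx
        have hx : 0 ≤ x := hx
        have h2 : x + b ≠ 0 := by positivity
        refine (((hasDerivAt_id x).add_const b).inv h2).neg.congr_deriv ?_
        simp only [id]
        field_simp
      · have h1 : Tendsto (fun x : ℝ => x ^ 2 + b ^ 2) atTop atTop :=
          tendsto_atTop_add_const_right _ _ (tendsto_pow_atTop two_ne_zero)
        simpa using h1.inv_tendsto_atTop.const_mul (-b)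
      · have h1 : Tendsto (fun x : ℝ => x + b) atTop atTop :=
          tendsto_atTop_add_const_right _ _ tendsto_id
        simpa using h1.inv_tendsto_atTop.neg
      · field_simp
        simp [sq]
    have hbc' : c - b ≠ 0 := sub_ne_zero.2 (Ne.symm hbc)
    refine ⟨fun x => 1 / (2 * (c - b)) * (Real.log (x ^ 2 + b ^ 2) - Real.log (x ^ 2 + c ^ 2)),
      fun x => 1 / (c - b) * (Real.log (x + b) - Real.log (x + c)), ?_, ?_, ?_, ?_, ?_⟩
    · intro x _
      have h1 : ∀ b : ℝ, HasDerivAt (fun x : ℝ => x ^ 2 + b ^ 2) (2 * x) x := fun b => by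
        simpa using (hasDerivAt_pow 2 x).add_const (b ^ 2)
      have h2 : x ^ 2 + b ^ 2 ≠ 0 := by positivity
      have h3 : x ^ 2 + c ^ 2 ≠ 0 := by positivity
      refine ((((h1 b).log h2).sub ((h1 c).log h3)).const_mul (1 / (2 * (c - b)))).congr_deriv ?_
      field_simp
      ring
    · intro x hx
      have hx : 0 ≤ x := hx
      have h2 : x + b ≠ 0 := by positivity
      have h3 : x + c ≠ 0 := by positivity
      refine (((((hasDerivAt_id x).add_const b).log h2).sub
        (((hasDerivAt_id x).add_const c).log h3)).const_mul (1 / (c - b))).congr_deriv ?_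
      simp only [id]
      field_simp
      ring
    · have := ((tendsto_log_add_sub_log_add_zero (b ^ 2) (c ^ 2)).comp
        (tendsto_pow_atTop (α := ℝ) two_ne_zero)).const_mul (1 / (2 * (c - b)))
      rw [mul_zero] at this
      exact this
    · have := (tendsto_log_add_sub_log_add_zero b c).const_mul (1 / (c - b))
      rw [mul_zero] at this
      exact this
    · simp only [ne_eq, OfNat.ofNat_ne_zero, not_false_eq_true, zero_pow, zero_add, Real.log_pow]
      field_simp
      push_cast
      ring
  have hFn : ∀ x ∈ Set.Ioi (0 : ℝ), 0 ≤ (b + c) * x / ((x ^ 2 + b ^ 2) * (x ^ 2 + c ^ 2)) := by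
    intro x hx
    have hx : 0 < x := hx
    positivity
  have hGn : ∀ x ∈ Set.Ioi (0 : ℝ), 0 ≤ 1 / (x + b) * (1 / (x + c)) := by
    intro x hx
    have hx : 0 < x := hx
    positivity
  refine ⟨integrableOn_Ioi_deriv_of_nonneg' hF hFn hF', integrableOn_Ioi_deriv_of_nonneg' hG hGn hG',
    ?_⟩
  rw [integral_Ioi_of_hasDerivAt_of_nonneg' hF hFn hF',
    integral_Ioi_of_hasDerivAt_of_nonneg' hG hGn hG', h0]

lemma measurable_carlemanSymbol : Measurable carlemanSymbol := by
  have h : Measurable Real.sign := by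
    have : Real.sign = fun r : ℝ => if r < 0 then -1 else if 0 < r then 1 else 0 := rfl
    rw [this]
    exact Measurable.ite measurableSet_Iio measurable_const
      (Measurable.ite measurableSet_Ioi measurable_const measurable_const)
  unfold carlemanSymbol
  exact (measurable_ofReal.comp h).const_mul _

lemma norm_carlemanSymbol_le (x : ℝ) : ‖carlemanSymbol x‖ ≤ Real.pi := by
  have h : |Real.sign x| ≤ 1 := by
    rcases Real.sign_apply_eq x with h | h | h <;> simp [h]
  rw [carlemanSymbol, norm_mul, norm_mul, norm_I, mul_one, norm_real, norm_real,
    Real.norm_of_nonneg Real.pi_pos.le, Real.norm_eq_abs]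
  exact mul_le_of_le_one_right Real.pi_pos.le h

/-- The Carleman form on kernels of order zero, as an integral over the imaginary half-axis. -/
lemma integral_carlemanSymbol_mul {b c : ℝ} (hb : 0 < b) (hc : 0 < c) :
    ∫ x : ℝ, carlemanSymbol x * (1 / ((b : ℂ) + I * x) ^ 1 * (1 / ((c : ℂ) + I * x) ^ 1)) =
      2 * Real.pi * ∫ s in Set.Ioi (0 : ℝ), 1 / ((s : ℂ) + b) * (1 / ((s : ℂ) + c)) := by
  set k : ℝ → ℂ := fun x => 1 / ((b : ℂ) + I * x) ^ 1 * (1 / ((c : ℂ) + I * x) ^ 1) with hk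
  have hki : Integrable k := integrable_mul_of_memLp (memLp_cauchyKernel_neg (by simpa) 0)
    (memLp_cauchyKernel_neg (by simpa) 0)
  have hint : Integrable (fun x => carlemanSymbol x * k x) :=
    hki.bdd_mul measurable_carlemanSymbol.aestronglyMeasurable
      (Eventually.of_forall norm_carlemanSymbol_le)
  obtain ⟨-, -, h3⟩ := integral_Ioi_stieltjes hb hc
  have h4 : ∫ s in Set.Ioi (0 : ℝ), 1 / ((s : ℂ) + b) * (1 / ((s : ℂ) + c)) =
      ((∫ s in Set.Ioi (0 : ℝ), 1 / (s + b) * (1 / (s + c)) : ℝ) : ℂ) := by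
    rw [← integral_complex_ofReal]
    refine integral_congr_ae (Eventually.of_forall fun x => ?_)
    push_cast
    rfl
  rw [h4, ← h3, ← integral_complex_ofReal, ← intervalIntegral.integral_Iic_add_Ioi (b := 0)
    hint.integrableOn hint.integrableOn, ← neg_zero, ← integral_comp_neg_Ioi, neg_zero,
    ← integral_add, ← integral_const_mul]
  · refine setIntegral_congr_fun measurableSet_Ioi fun x hx => ?_
    have hx : 0 < x := hx
    have e1 : carlemanSymbol x = Real.pi * I := by
      simp [carlemanSymbol, Real.sign_of_pos hx]
    have e2 : carlemanSymbol (-x) = -(Real.pi * I) := by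
      simp [carlemanSymbol, Real.sign_of_neg (neg_neg_of_pos hx)]
    have n1 := add_I_mul_ne_zero (a := b) (by simpa) x
    have n2 := add_I_mul_ne_zero (a := c) (by simpa) x
    have n3 := sub_I_mul_ne_zero (a := b) (by simpa) x
    have n4 := sub_I_mul_ne_zero (a := c) (by simpa) x
    have m1 : (x : ℂ) ^ 2 + b ^ 2 = (b + I * x) * (b - I * x) := by
      ring_nf; simp
    have m2 : (x : ℂ) ^ 2 + c ^ 2 = (c + I * x) * (c - I * x) := by
      ring_nf; simp
    simp only [e1, e2, hk]
    push_cast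
    rw [m1, m2]
    simp only [mul_neg, ← sub_eq_add_neg, pow_one]
    field_simp
    ring_nf
    simp
  · have := hint.comp_neg
    exact this.integrableOn
  · exact hint.integrableOn

end Integrals

/-! ### Combinations of the kernels 1/(b - ix) and their translates -/

section KernelSpace

/-- The positive reals. -/
abbrev PosReal : Type := {b : ℝ // 0 < b}

lemma inner_linearCombination {V X Y : Type*} [NormedAddCommGroup V] [InnerProductSpace ℂ V]
    (v : X → V) (w : Y → V) (c : X →₀ ℂ) (d : Y →₀ ℂ) :
    inner ℂ (Finsupp.linearCombination ℂ v c) (Finsupp.linearCombination ℂ w d) =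
      ∑ i ∈ c.support, ∑ j ∈ d.support, conj (c i) * d j * inner ℂ (v i) (w j) := by
  simp only [Finsupp.linearCombination_apply, Finsupp.sum, sum_inner]
  refine Finset.sum_congr rfl fun i _ => ?_
  simp only [inner_sum, inner_smul_left, inner_smul_right]
  refine Finset.sum_congr rfl fun j _ => ?_
  ring

lemma coeFn_linearCombination {X : Type*} {μ : Measure ℝ} (φ : X → ℝ → ℂ)
    (hφ : ∀ b, MemLp (φ b) 2 μ) (c : X →₀ ℂ) :
    ⇑(Finsupp.linearCombination ℂ (fun b => (hφ b).toLp (φ b)) c) =ᵐ[μ]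
      fun x => Finsupp.linearCombination ℂ (fun b => φ b x) c := by
  induction c using Finsupp.induction_linear with
  | zero =>
    rw [map_zero]
    refine (Lp.coeFn_zero ℂ 2 μ).trans (Eventually.of_forall fun x => ?_)
    simp
  | add c d hc hd =>
    rw [map_add]
    filter_upwards [Lp.coeFn_add (Finsupp.linearCombination ℂ (fun b => (hφ b).toLp (φ b)) c)
      (Finsupp.linearCombination ℂ (fun b => (hφ b).toLp (φ b)) d), hc, hd] with x h1 h2 h3
    rw [h1, Pi.add_apply, h2, h3, map_add]
  | single b z =>
    simp only [Finsupp.linearCombination_single]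
    filter_upwards [Lp.coeFn_smul z ((hφ b).toLp (φ b)), (hφ b).coeFn_toLp] with x h1 h2
    rw [h1, Pi.smul_apply, h2]

lemma L2_inner_eq {μ : Measure ℝ} (f g : Lp ℂ 2 μ) :
    inner ℂ f g = ∫ x, conj (f x) * g x ∂μ := by
  rw [L2.inner_def]
  refine integral_congr_ae (Eventually.of_forall fun x => ?_)
  simp [mul_comm]

/-- The kernel `(a - i x)^{-k-1}` as an element of `L²(ℝ)`. -/
def kernelLp (a : ℂ) (ha : 0 < a.re) (k : ℕ) : L2R := (memLp_cauchyKernel ha k).toLp _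

lemma coeFn_kernelLp {a : ℂ} (ha : 0 < a.re) (k : ℕ) :
    ⇑(kernelLp a ha k) =ᵐ[volume] cauchyKernel a k := (memLp_cauchyKernel ha k).coeFn_toLp

lemma conj_re_pos {a : ℂ} (ha : 0 < a.re) : 0 < (conj a).re := by simpa

lemma inner_kernelLp {a b : ℂ} (ha : 0 < a.re) (hb : 0 < b.re) (k : ℕ) :
    inner ℂ (kernelLp a ha k) (kernelLp b hb 0) = 2 * Real.pi / (conj a + b) ^ (k + 1) := by
  rw [L2_inner_eq, ← integral_inv_pow_mul_inv (conj_re_pos ha) hb]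
  refine integral_congr_ae ?_
  filter_upwards [coeFn_kernelLp ha k, coeFn_kernelLp hb 0] with x h1 h2
  rw [h1, h2, conj_cauchyKernel]
  simp [cauchyKernel]

lemma norm_kernelLp_sq {a : ℂ} (ha : 0 < a.re) :
    ‖kernelLp a ha 0‖ ^ 2 = Real.pi / a.re := by
  have h := inner_kernelLp ha ha 0
  rw [inner_self_eq_ofReal_norm_sq] at h
  have h2 : conj a + a = ((2 * a.re : ℝ) : ℂ) := by
    rw [add_comm, Complex.add_conj]
  rw [h2] at h
  have h3 : (2 * Real.pi / ((2 * a.re : ℝ) : ℂ) ^ (0 + 1) : ℂ) = ((Real.pi / a.re : ℝ) : ℂ) := by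
    push_cast
    have : (a.re : ℂ) ≠ 0 := by exact_mod_cast ha.ne'
    field_simp
  rw [h3] at h
  exact_mod_cast h

/-- Linear combinations of the kernels `(b - i x)^{-1}`, `b > 0`. -/
def kernelComb : (PosReal →₀ ℂ) →ₗ[ℂ] L2R :=
  Finsupp.linearCombination ℂ fun b : PosReal =>
    kernelLp ((b : ℝ) : ℂ) (by simpa using b.2) 0

/-- The Taylor coefficients, up to sign, at the point `a` of the function `∑ c_b / (s + b)`. -/
def jet (a : ℂ) (k : ℕ) : (PosReal →₀ ℂ) →ₗ[ℂ] ℂ :=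
  Finsupp.linearCombination ℂ fun b : PosReal => 1 / (a + ((b : ℝ) : ℂ)) ^ (k + 1)

/-- The reproducing property. It shows that the jets are continuous in the L² norm, so that they
make sense on the whole Hardy space (`hardyJet`). -/
lemma inner_kernelLp_kernelComb {a : ℂ} (ha : 0 < a.re) (k : ℕ) (c : PosReal →₀ ℂ) :
    inner ℂ (kernelLp (conj a) (conj_re_pos ha) k) (kernelComb c) = 2 * Real.pi * jet a k c := by
  rw [kernelComb, jet, Finsupp.linearCombination_apply, Finsupp.linearCombination_apply,
    Finsupp.sum, Finsupp.sum, inner_sum, Finset.mul_sum]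
  refine Finset.sum_congr rfl fun b _ => ?_
  rw [inner_smul_right, inner_kernelLp, conj_conj, smul_eq_mul]
  ring

lemma coeFn_kernelComb (c : PosReal →₀ ℂ) :
    ⇑(kernelComb c) =ᵐ[volume] fun x : ℝ => jet (-I * x) 0 c := by
  refine (coeFn_linearCombination (fun b : PosReal => cauchyKernel ((b : ℝ) : ℂ) 0)
    (fun b => memLp_cauchyKernel (by simpa using b.2) 0) c).trans (Eventually.of_forall fun x => ?_)
  simp only [jet]
  congr 2
  funext b
  simp only [cauchyKernel]
  ring

/-- Translation of the parameters of a combination of kernels. -/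
def shiftComb (y : ℝ) (hy : 0 ≤ y) (c : PosReal →₀ ℂ) : PosReal →₀ ℂ :=
  c.mapDomain fun b : PosReal => (⟨b + y, add_pos_of_pos_of_nonneg b.2 hy⟩ : PosReal)

lemma linearCombination_shiftComb {V : Type*} [AddCommGroup V] [Module ℂ V] (v : PosReal → V)
    {y : ℝ} (hy : 0 ≤ y) (c : PosReal →₀ ℂ) :
    Finsupp.linearCombination ℂ v (shiftComb y hy c) =
      Finsupp.linearCombination ℂ
        (fun b : PosReal => v ⟨b + y, add_pos_of_pos_of_nonneg b.2 hy⟩) c :=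
  Finsupp.linearCombination_mapDomain _ _ _

/-- As -i(x + iy) = y - ix, moving to the line Im z = y amounts to adding y to every parameter b. -/
lemma coeFn_kernelComb_shiftComb {y : ℝ} (hy : 0 ≤ y) (c : PosReal →₀ ℂ) :
    ⇑(kernelComb (shiftComb y hy c)) =ᵐ[volume]
      fun x : ℝ => jet (-I * ((x : ℂ) + (y : ℂ) * I)) 0 c := by
  refine (coeFn_kernelComb _).trans (Eventually.of_forall fun x => ?_)
  simp only [jet, linearCombination_shiftComb]
  congr 2
  funext b
  congr 2
  push_cast
  ring_nf
  simp
  ring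

lemma memLp_exp_neg {b : ℝ} (hb : 0 < b) :
    MemLp (fun t : ℝ => ((Real.exp (-b * t) : ℝ) : ℂ)) 2 (volume.restrict (Set.Ioi (0 : ℝ))) := by
  rw [memLp_two_iff_integrable_sq_norm (by fun_prop)]
  refine (exp_neg_integrableOn_Ioi 0 (b := 2 * b) (by positivity)).congr
    (Eventually.of_forall fun t => ?_)
  simp only [norm_real, Real.norm_of_nonneg (Real.exp_pos _).le, ← Real.exp_nat_mul]
  congr 1
  push_cast
  ring

/-- The Laplace representation of combinations of kernels. -/
def laplaceComb : (PosReal →₀ ℂ) →ₗ[ℂ] Lp ℂ 2 (volume.restrict (Set.Ioi (0 : ℝ))) :=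
  Finsupp.linearCombination ℂ fun b : PosReal => (memLp_exp_neg b.2).toLp _

/-- Plancherel for 1/(b - ix) = ∫₀^∞ e^{-bt} e^{ixt} dt, checked directly on the Gram matrices:
2π/(b + b') against 1/(b + b'). -/
lemma inner_kernelComb_eq_laplaceComb (c d : PosReal →₀ ℂ) :
    inner ℂ (kernelComb c) (kernelComb d) =
      2 * Real.pi * inner ℂ (laplaceComb c) (laplaceComb d) := by
  rw [kernelComb, laplaceComb, inner_linearCombination, inner_linearCombination, Finset.mul_sum]
  refine Finset.sum_congr rfl fun i _ => ?_
  rw [Finset.mul_sum]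
  refine Finset.sum_congr rfl fun j _ => ?_
  rw [inner_kernelLp]
  have h1 : inner ℂ ((memLp_exp_neg i.2).toLp _) ((memLp_exp_neg j.2).toLp _) =
      ((1 / ((i : ℝ) + j) : ℝ) : ℂ) := by
    rw [L2_inner_eq]
    have h2 : ∫ t in Set.Ioi (0 : ℝ), Real.exp (-((i : ℝ) + j) * t) = 1 / ((i : ℝ) + j) := by
      have := integral_exp_mul_Ioi (a := -((i : ℝ) + j)) (by linarith [i.2, j.2]) 0
      rw [this]
      simp only [mul_zero, Real.exp_zero, neg_div_neg_eq]
    rw [← h2, ← integral_complex_ofReal]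
    refine integral_congr_ae ?_
    filter_upwards [(memLp_exp_neg i.2).coeFn_toLp, (memLp_exp_neg j.2).coeFn_toLp] with t h3 h4
    rw [h3, h4, conj_ofReal, ← ofReal_mul, ← Real.exp_add]
    congr 2
    ring
  rw [h1]
  push_cast
  simp only [conj_ofReal]
  ring

/-- On the Laplace side the shift is multiplication by e^{-yt} ≤ 1. -/
lemma norm_kernelComb_shiftComb_le {y : ℝ} (hy : 0 ≤ y) (c : PosReal →₀ ℂ) :
    ‖kernelComb (shiftComb y hy c)‖ ≤ ‖kernelComb c‖ := by
  have hsq : ∀ c, ‖kernelComb c‖ ^ 2 = 2 * Real.pi * ‖laplaceComb c‖ ^ 2 := by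
    intro c
    have h := inner_kernelComb_eq_laplaceComb c c
    rw [inner_self_eq_ofReal_norm_sq, inner_self_eq_ofReal_norm_sq] at h
    exact_mod_cast h
  have hle : ‖laplaceComb (shiftComb y hy c)‖ ≤ ‖laplaceComb c‖ := by
    have hc := coeFn_linearCombination (fun b : PosReal => fun t : ℝ =>
      ((Real.exp (-b * t) : ℝ) : ℂ)) (fun b => memLp_exp_neg b.2)
    refine Lp.norm_le_norm_of_ae_le ?_
    filter_upwards [hc c, hc (shiftComb y hy c), ae_restrict_mem measurableSet_Ioi] with t h1 h2 h3
    have h3 : 0 < t := h3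
    rw [laplaceComb, h1, h2, linearCombination_shiftComb]
    have h4 : Finsupp.linearCombination ℂ (fun b : PosReal =>
        ((Real.exp (-((b : ℝ) + y) * t) : ℝ) : ℂ)) c = ((Real.exp (-y * t) : ℝ) : ℂ) *
          Finsupp.linearCombination ℂ (fun b : PosReal => ((Real.exp (-b * t) : ℝ) : ℂ)) c := by
      rw [Finsupp.linearCombination_apply, Finsupp.linearCombination_apply, Finsupp.sum,
        Finsupp.sum, Finset.mul_sum]
      refine Finset.sum_congr rfl fun b _ => ?_
      have : -((b : ℝ) + y) * t = -y * t + -b * t := by ring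
      rw [this, Real.exp_add]
      push_cast
      simp only [smul_eq_mul]
      ring
    rw [h4, norm_mul, norm_real, Real.norm_of_nonneg (Real.exp_pos _).le]
    refine mul_le_of_le_one_left (norm_nonneg _) (Real.exp_le_one_iff.2 ?_)
    nlinarith
  rw [← sq_le_sq₀ (norm_nonneg _) (norm_nonneg _), hsq, hsq]
  have := Real.pi_pos
  gcongr

lemma tendsto_kernelComb_shiftComb (c : PosReal →₀ ℂ) {ε : ℝ} (hε : 0 < ε) :
    ∃ δ > 0, ∀ y, ∀ hy : 0 ≤ y, y < δ → ‖kernelComb (shiftComb y hy c) - kernelComb c‖ < ε := by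
  set C : ℝ := ∑ b ∈ c.support, ‖c b‖ * (1 / (b : ℝ) *
    ‖kernelLp ((b : ℝ) : ℂ) (by simpa using b.2) 0‖) with hC
  have hC0 : 0 ≤ C := Finset.sum_nonneg fun b _ => by
    have := b.2
    positivity
  refine ⟨ε / (C + 1), by positivity, fun y hy hlt => ?_⟩
  have hb : ∀ b : PosReal, ‖kernelLp (((b : ℝ) + y : ℝ) : ℂ)
      (by simpa using add_pos_of_pos_of_nonneg b.2 hy) 0 -
        kernelLp ((b : ℝ) : ℂ) (by simpa using b.2) 0‖ ≤
      (y * (1 / (b : ℝ))) * ‖kernelLp ((b : ℝ) : ℂ) (by simpa using b.2) 0‖ := by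
    intro b
    have hb1 : 0 < (((b : ℝ) : ℂ)).re := by simpa using b.2
    have hb2 : 0 < ((((b : ℝ) + y : ℝ) : ℂ)).re := by
      simpa using add_pos_of_pos_of_nonneg b.2 hy
    refine Lp.norm_le_mul_norm_of_ae_le_mul ?_
    filter_upwards [Lp.coeFn_sub (kernelLp (((b : ℝ) + y : ℝ) : ℂ) hb2 0)
      (kernelLp ((b : ℝ) : ℂ) hb1 0), coeFn_kernelLp hb1 0, coeFn_kernelLp hb2 0] with x h1 h2 h3
    rw [h1, Pi.sub_apply, h2, h3]
    have n1 := sub_I_mul_ne_zero hb1 x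
    have n2 := sub_I_mul_ne_zero hb2 x
    -- The resolvent identity; the kernel with parameter b + y is bounded by 1/b, which produces the
    -- constant C.
    have h4 : cauchyKernel (((b : ℝ) + y : ℝ) : ℂ) 0 x - cauchyKernel ((b : ℝ) : ℂ) 0 x =
        -y * cauchyKernel (((b : ℝ) + y : ℝ) : ℂ) 0 x * cauchyKernel ((b : ℝ) : ℂ) 0 x := by
      simp only [cauchyKernel, zero_add, pow_one]
      field_simp
      push_cast
      ring
    rw [h4, norm_mul, norm_mul, norm_neg, norm_real, Real.norm_of_nonneg hy]
    gcongr
    refine (norm_cauchyKernel_le hb2 0 x).trans ?_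
    simp only [zero_add, pow_one, ofReal_re]
    exact one_div_le_one_div_of_le b.2 (by linarith)
  have h1 : kernelComb (shiftComb y hy c) - kernelComb c =
      ∑ b ∈ c.support, c b • (kernelLp (((b : ℝ) + y : ℝ) : ℂ)
      (by simpa using add_pos_of_pos_of_nonneg b.2 hy) 0 -
        kernelLp ((b : ℝ) : ℂ) (by simpa using b.2) 0) := by
    rw [kernelComb, linearCombination_shiftComb, Finsupp.linearCombination_apply,
      Finsupp.linearCombination_apply, Finsupp.sum, Finsupp.sum, ← Finset.sum_sub_distrib]
    simp only [smul_sub]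
  have h2 : ‖kernelComb (shiftComb y hy c) - kernelComb c‖ ≤ y * C := by
    rw [h1, hC, Finset.mul_sum]
    refine (norm_sum_le _ _).trans (Finset.sum_le_sum fun b _ => ?_)
    rw [norm_smul]
    have := mul_le_mul_of_nonneg_left (hb b) (norm_nonneg (c b))
    linarith
  calc _ ≤ y * C := h2
    _ ≤ y * (C + 1) := by gcongr; linarith
    _ < ε := by rwa [lt_div_iff₀ (by positivity)] at hlt

end KernelSpace

/-! ### Limits of kernel combinations belong to the Hardy space -/

section HardyClosure

lemma re_neg_I_mul (z : ℂ) : (-I * z).re = z.im := by simp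

/-- The evaluation at a point of the upper half-plane of the holomorphic extension. -/
def hardyEval (f : L2R) (z : ℂ) : ℂ :=
  if hz : 0 < z.im then
    1 / (2 * Real.pi) * inner ℂ (kernelLp (conj (-I * z))
      (conj_re_pos (by rwa [re_neg_I_mul])) 0) f
  else 0

lemma hardyEval_sub (f g : L2R) (z : ℂ) : hardyEval (f - g) z = hardyEval f z - hardyEval g z := by
  unfold hardyEval
  split_ifs
  · rw [inner_sub_right, mul_sub]
  · simp

lemma hardyEval_kernelComb (c : PosReal →₀ ℂ) {z : ℂ} (hz : 0 < z.im) :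
    hardyEval (kernelComb c) z = jet (-I * z) 0 c := by
  rw [hardyEval, dif_pos hz, inner_kernelLp_kernelComb (by rwa [re_neg_I_mul])]
  have : (Real.pi : ℂ) ≠ 0 := by exact_mod_cast Real.pi_ne_zero
  field_simp

/-- Cauchy–Schwarz with the kernel norm √(π / Im z). Uniformity on Im z ≥ r turns L² convergence
into locally uniform convergence of the extensions. -/
lemma norm_hardyEval_le (f : L2R) {z : ℂ} {r : ℝ} (hr : 0 < r) (hz : r ≤ z.im) :
    ‖hardyEval f z‖ ≤ 1 / (2 * Real.pi) * √(Real.pi / r) * ‖f‖ := by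
  have hz0 : 0 < z.im := hr.trans_le hz
  have hre : 0 < (conj (-I * z)).re := conj_re_pos (by rwa [re_neg_I_mul])
  have hpi := Real.pi_pos
  rw [hardyEval, dif_pos hz0, norm_mul, mul_assoc]
  have h1 : ‖(1 / (2 * Real.pi) : ℂ)‖ = 1 / (2 * Real.pi) := by
    have : (1 / (2 * Real.pi) : ℂ) = ((1 / (2 * Real.pi) : ℝ) : ℂ) := by push_cast; rfl
    rw [this, norm_real, Real.norm_of_nonneg (by positivity)]
  rw [h1]
  gcongr
  refine (norm_inner_le_norm _ _).trans ?_
  gcongr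
  refine Real.le_sqrt_of_sq_le ?_
  rw [norm_kernelLp_sq hre, conj_re, re_neg_I_mul]
  gcongr

lemma differentiableOn_jet (c : PosReal →₀ ℂ) :
    DifferentiableOn ℂ (fun z => jet (-I * z) 0 c) {z : ℂ | 0 < z.im} := by
  simp only [jet, Finsupp.linearCombination_apply, Finsupp.sum]
  refine DifferentiableOn.fun_sum fun b _ => ?_
  have h : DifferentiableOn ℂ (fun z : ℂ => (-I * z + ((b : ℝ) : ℂ)) ^ (0 + 1))
      {z : ℂ | 0 < z.im} := by fun_prop
  refine ((differentiableOn_const (1 : ℂ)).fun_div h fun z hz => ?_).const_smul (c b)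
  refine pow_ne_zero _ (add_ne_zero_of_re_pos ?_ (by simpa using b.2))
  rwa [re_neg_I_mul]

lemma eLpNorm_kernelComb_line {y : ℝ} (hy : 0 ≤ y) (c : PosReal →₀ ℂ) :
    eLpNorm (fun x : ℝ => jet (-I * ((x : ℂ) + (y : ℂ) * I)) 0 c) 2 volume ≤
      ENNReal.ofReal ‖kernelComb c‖ := by
  rw [← eLpNorm_congr_ae (coeFn_kernelComb_shiftComb hy c), ← Lp.enorm_def, ← ofReal_norm]
  exact ENNReal.ofReal_le_ofReal (norm_kernelComb_shiftComb_le hy c)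

lemma line_im_pos {y : ℝ} (hy : 0 < y) (x : ℝ) : 0 < ((x : ℂ) + (y : ℂ) * I).im := by simpa

lemma continuous_kernelComb_line {y : ℝ} (hy : 0 < y) (c : PosReal →₀ ℂ) :
    Continuous (fun x : ℝ => jet (-I * ((x : ℂ) + (y : ℂ) * I)) 0 c) :=
  (differentiableOn_jet c).continuousOn.comp_continuous
    (f := fun x : ℝ => (x : ℂ) + (y : ℂ) * I) (by fun_prop) (line_im_pos hy)

/-- Holomorphy passes to locally uniform limits. On each line the extension of f differs from that
of the n-th combination by at most ‖f - `kernelComb (c n)`‖; this yields the uniform bound and, with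
continuity of translates of one fixed combination, the boundary convergence. -/
lemma isHardyExtension_of_tendsto {c : ℕ → PosReal →₀ ℂ} {f : L2R}
    (hf : Tendsto (fun n => kernelComb (c n)) atTop (𝓝 f)) :
    IsHardyExtension (hardyEval f) f := by
  have hnorm : Tendsto (fun n => ‖f - kernelComb (c n)‖) atTop (𝓝 0) := by
    have := (tendsto_const_nhds (x := f)).sub hf
    rw [sub_self] at this
    simpa using this.norm
  have hhol : DifferentiableOn ℂ (hardyEval f) {z : ℂ | 0 < z.im} := by
    have hopen : IsOpen {z : ℂ | 0 < z.im} := isOpen_lt continuous_const continuous_im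
    refine TendstoLocallyUniformlyOn.differentiableOn (φ := atTop)
      (F := fun n z => jet (-I * z) 0 (c n)) ?_ (Eventually.of_forall fun n =>
        differentiableOn_jet (c n)) hopen
    rw [Metric.tendstoLocallyUniformlyOn_iff]
    intro ε hε z hz
    have hz : 0 < z.im := hz
    refine ⟨{w : ℂ | z.im / 2 < w.im}, mem_nhdsWithin_of_mem_nhds
      ((isOpen_lt continuous_const continuous_im).mem_nhds (by
        change z.im / 2 < z.im; linarith)), ?_⟩
    have h1 := hnorm.const_mul (1 / (2 * Real.pi) * √(Real.pi / (z.im / 2)))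
    rw [mul_zero] at h1
    filter_upwards [h1.eventually_lt_const hε] with n hn w hw
    have hw : z.im / 2 < w.im := hw
    rw [dist_eq_norm, ← hardyEval_kernelComb (c n) (by linarith), ← hardyEval_sub]
    exact (norm_hardyEval_le _ (by linarith) hw.le).trans_lt hn
  have hline : ∀ y : ℝ, 0 < y → ∀ n, eLpNorm (fun x : ℝ => hardyEval f ((x : ℂ) + (y : ℂ) * I) -
      jet (-I * ((x : ℂ) + (y : ℂ) * I)) 0 (c n)) 2 volume ≤
        ENNReal.ofReal ‖f - kernelComb (c n)‖ := by
    intro y hy n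
    -- Fatou in m: on the line the extensions of c m - c n converge pointwise, and their norms are
    -- at most those of the boundary values.
    have h1 := Lp.eLpNorm_lim_le_liminf_eLpNorm (p := 2) (μ := (volume : Measure ℝ))
      (f := fun m (x : ℝ) => jet (-I * ((x : ℂ) + (y : ℂ) * I)) 0 (c m - c n))
      (fun m => (continuous_kernelComb_line hy _).aestronglyMeasurable)
      (fun x : ℝ => hardyEval f ((x : ℂ) + (y : ℂ) * I) -
        jet (-I * ((x : ℂ) + (y : ℂ) * I)) 0 (c n))
      (Eventually.of_forall fun x => by
        simp only [map_sub]
        refine Tendsto.sub_const ?_ _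
        have hz := line_im_pos hy x
        rw [tendsto_iff_norm_sub_tendsto_zero]
        have h1 := hnorm.const_mul (1 / (2 * Real.pi) * √(Real.pi / y))
        rw [mul_zero] at h1
        refine squeeze_zero (fun _ => norm_nonneg _) (fun m => ?_) h1
        rw [← hardyEval_kernelComb _ hz, norm_sub_rev, ← hardyEval_sub]
        exact norm_hardyEval_le _ hy (by simp))
    refine h1.trans ?_
    have h2 : Tendsto (fun m => ENNReal.ofReal ‖kernelComb (c m - c n)‖) atTop
        (𝓝 (ENNReal.ofReal ‖f - kernelComb (c n)‖)) := by
      simp only [map_sub]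
      exact ENNReal.tendsto_ofReal (hf.sub_const _).norm
    rw [← h2.liminf_eq]
    exact liminf_le_liminf (Eventually.of_forall fun m => eLpNorm_kernelComb_line hy.le _)
  have hcontF : ∀ {y : ℝ}, 0 < y →
      Continuous (fun x : ℝ => hardyEval f ((x : ℂ) + (y : ℂ) * I)) := fun {y} hy =>
    hhol.continuousOn.comp_continuous (f := fun x : ℝ => (x : ℂ) + (y : ℂ) * I) (by fun_prop)
      (line_im_pos hy)
  refine ⟨hhol, ?_, ?_⟩
  · refine ⟨Real.toNNReal (‖f - kernelComb (c 0)‖ + ‖kernelComb (c 0)‖), fun y hy => ?_⟩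
    have h1 := eLpNorm_add_le (p := 2) (μ := (volume : Measure ℝ))
      ((hcontF hy).sub (continuous_kernelComb_line hy (c 0))).aestronglyMeasurable
      (continuous_kernelComb_line hy (c 0)).aestronglyMeasurable (by norm_num)
    have h2 : (fun x : ℝ => hardyEval f ((x : ℂ) + (y : ℂ) * I)) =
        ((fun x : ℝ => hardyEval f ((x : ℂ) + (y : ℂ) * I)) -
          fun x : ℝ => jet (-I * ((x : ℂ) + (y : ℂ) * I)) 0 (c 0)) +
        fun x : ℝ => jet (-I * ((x : ℂ) + (y : ℂ) * I)) 0 (c 0) := by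
      simp
    rw [h2]
    refine h1.trans ?_
    rw [← ENNReal.ofReal, ENNReal.ofReal_add (norm_nonneg _) (norm_nonneg _)]
    exact add_le_add (hline y hy 0) (eLpNorm_kernelComb_line hy.le _)
  · rw [ENNReal.tendsto_nhds_zero]
    intro ε hε
    by_cases htop : ε = ⊤
    · exact Eventually.of_forall fun _ => htop ▸ le_top
    obtain ⟨r, hr, rfl⟩ : ∃ r : ℝ, 0 < r ∧ ENNReal.ofReal r = ε :=
      ⟨ε.toReal, ENNReal.toReal_pos hε.ne' htop, ENNReal.ofReal_toReal htop⟩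
    obtain ⟨n, hn⟩ := (hnorm.eventually_lt_const (show (0 : ℝ) < r / 3 by positivity)).exists
    obtain ⟨δ, hδ, hδ'⟩ := tendsto_kernelComb_shiftComb (c n) (show (0 : ℝ) < r / 3 by positivity)
    have hmem : Set.Ioo 0 δ ∈ 𝓝[>] (0 : ℝ) := Ioo_mem_nhdsGT hδ
    filter_upwards [hmem] with y hy
    have hy0 : 0 < y := hy.1
    have e1 : eLpNorm (fun x : ℝ => hardyEval f ((x : ℂ) + (y : ℂ) * I) -
        kernelComb (shiftComb y hy0.le (c n)) x) 2 volume ≤ ENNReal.ofReal (r / 3) := by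
      refine (eLpNorm_congr_ae ?_).trans_le
        ((hline y hy0 n).trans (ENNReal.ofReal_le_ofReal hn.le))
      filter_upwards [coeFn_kernelComb_shiftComb hy0.le (c n)] with x hx
      rw [hx]
    have e2 : eLpNorm (fun x : ℝ => (kernelComb (shiftComb y hy0.le (c n)) - f : L2R) x) 2 volume ≤
        ENNReal.ofReal (2 * (r / 3)) := by
      have : eLpNorm (fun x : ℝ => (kernelComb (shiftComb y hy0.le (c n)) - f : L2R) x) 2 volume =
        ENNReal.ofReal ‖kernelComb (shiftComb y hy0.le (c n)) - f‖ := by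
        rw [ofReal_norm, Lp.enorm_def]
      rw [this]
      refine ENNReal.ofReal_le_ofReal ?_
      have h3 := norm_sub_le_norm_sub_add_norm_sub (kernelComb (shiftComb y hy0.le (c n)))
        (kernelComb (c n)) f
      have h4 := hδ' y hy0.le hy.2
      rw [norm_sub_rev (kernelComb (c n)) f] at h3
      linarith
    have h1 := eLpNorm_add_le (p := 2) (μ := (volume : Measure ℝ))
      ((hcontF hy0).aestronglyMeasurable.sub
        (Lp.aestronglyMeasurable (kernelComb (shiftComb y hy0.le (c n)))))
      (Lp.aestronglyMeasurable (kernelComb (shiftComb y hy0.le (c n)) - f : L2R)) (by norm_num)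
    calc _ = _ := eLpNorm_congr_ae ?_
      _ ≤ _ := h1
      _ ≤ ENNReal.ofReal (r / 3) + ENNReal.ofReal (2 * (r / 3)) := add_le_add e1 e2
      _ = ENNReal.ofReal r := by
        rw [← ENNReal.ofReal_add (by positivity) (by positivity)]
        congr 1
        ring
    filter_upwards [Lp.coeFn_sub (kernelComb (shiftComb y hy0.le (c n))) f] with x hx
    rw [Pi.add_apply, hx]
    simp

lemma closure_range_kernelComb_le :
    (LinearMap.range kernelComb).topologicalClosure ≤ hardySpace := by
  intro f hf
  obtain ⟨u, hu, hlim⟩ := mem_closure_iff_seq_limit.1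
    ((Submodule.mem_toAddSubmonoid _ _).1 hf : f ∈ closure (LinearMap.range kernelComb : Set L2R))
  choose c hc using hu
  refine ⟨_, isHardyExtension_of_tendsto (c := c) ?_⟩
  simpa only [hc] using hlim

end HardyClosure

/-! ### The Cauchy formula and density of the kernels in the Hardy space -/

section CauchyFormula

/-- Integrals of a holomorphic function over two horizontal lines coincide, if the function is
integrable, uniformly in the strip, outside of a bounded set. -/
lemma integral_line_eq {Φ : ℂ → ℂ} (hΦ : DifferentiableOn ℂ Φ {z : ℂ | 0 < z.im}) {y₁ y₂ : ℝ}
    (h₁ : 0 < y₁) (h₁₂ : y₁ < y₂)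
    (hint₁ : Integrable (fun x : ℝ => Φ ((x : ℂ) + (y₁ : ℂ) * I)))
    (hint₂ : Integrable (fun x : ℝ => Φ ((x : ℂ) + (y₂ : ℂ) * I)))
    {C : ℝ≥0∞} (hC : C ≠ ⊤) (hbd : ∀ y ∈ Set.Ioc y₁ y₂, ∫⁻ x in Set.Ioi (1 : ℝ),
      (‖Φ ((x : ℂ) + (y : ℂ) * I)‖ₑ + ‖Φ (((-x : ℝ) : ℂ) + (y : ℂ) * I)‖ₑ) ≤ C) :
    ∫ x : ℝ, Φ ((x : ℂ) + (y₁ : ℂ) * I) = ∫ x : ℝ, Φ ((x : ℂ) + (y₂ : ℂ) * I) := by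
  set u : ℝ → ℝ → ℝ≥0∞ := fun x y =>
    ‖Φ ((x : ℂ) + (y : ℂ) * I)‖ₑ + ‖Φ (((-x : ℝ) : ℂ) + (y : ℂ) * I)‖ₑ with hu
  set U : ℝ → ℝ≥0∞ := fun x => ∫⁻ y in Set.Ioc y₁ y₂, u x y with hU
  have hcont : ∀ s : ℝ, ContinuousOn (fun p : ℝ × ℝ => Φ (((s * p.1 : ℝ) : ℂ) + (p.2 : ℂ) * I))
      (Set.Ioi (1 : ℝ) ×ˢ Set.Ioc y₁ y₂) := by
    intro s
    refine hΦ.continuousOn.comp (by fun_prop) ?_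
    rintro ⟨x, y⟩ ⟨_, hy⟩
    exact line_im_pos (h₁.trans hy.1) _
  have hmeas : AEMeasurable (Function.uncurry u)
      ((volume.restrict (Set.Ioi (1 : ℝ))).prod (volume.restrict (Set.Ioc y₁ y₂))) := by
    rw [Measure.prod_restrict]
    have h1 := (hcont 1).enorm.add (hcont (-1)).enorm
    refine (h1.aemeasurable (measurableSet_Ioi.prod measurableSet_Ioc)).congr
      (Eventually.of_forall fun p => ?_)
    simp [hu, Function.uncurry]
  have hfin : ∫⁻ x in Set.Ioi (1 : ℝ), U x ≠ ⊤ := by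
    rw [hU, lintegral_lintegral_swap hmeas]
    refine ne_top_of_le_ne_top ?_ (setLIntegral_mono measurable_const hbd)
    rw [setLIntegral_const]
    exact ENNReal.mul_ne_top hC (by simp)
  -- U x bounds the vertical sides at ±x. No pointwise decay is known, but U is integrable by
  -- Tonelli, hence small for arbitrarily large x, and such rectangles suffice.
  have hfreq : ∀ ε : ℝ≥0∞, 0 < ε → ∃ᶠ x in atTop, U x < ε := by
    intro ε hε hev
    simp only [not_lt, eventually_atTop] at hev
    obtain ⟨a, ha⟩ := hev
    apply hfin
    rw [eq_top_iff]
    calc ⊤ = ∫⁻ _ in Set.Ioi (max a 1), ε := by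
          rw [setLIntegral_const, Real.volume_Ioi, ENNReal.mul_top hε.ne']
      _ ≤ ∫⁻ x in Set.Ioi (max a 1), U x :=
          setLIntegral_mono' measurableSet_Ioi fun x hx =>
            ha x ((le_max_left _ _).trans (le_of_lt hx))
      _ ≤ ∫⁻ x in Set.Ioi (1 : ℝ), U x :=
          lintegral_mono_set (Set.Ioi_subset_Ioi (le_max_right _ _))
  have hrect : ∀ R : ℝ, ‖(∫ x in -R..R, Φ ((x : ℂ) + (y₁ : ℂ) * I)) -
      ∫ x in -R..R, Φ ((x : ℂ) + (y₂ : ℂ) * I)‖ₑ ≤ U R := by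
    intro R
    have h := integral_boundary_rect_eq_zero_of_differentiableOn Φ
      (((-R : ℝ) : ℂ) + (y₁ : ℂ) * I) ((R : ℂ) + (y₂ : ℂ) * I) (hΦ.mono (by
        rintro z ⟨_, hz⟩
        simp only [Set.mem_preimage, add_im, ofReal_im, mul_im, ofReal_re, I_im, mul_one, I_re,
          mul_zero, add_zero, zero_add, Set.uIcc_of_le h₁₂.le] at hz
        exact h₁.trans_le hz.1))
    simp only [add_re, ofReal_re, mul_re, I_re, mul_zero, ofReal_im, I_im, mul_one, sub_self,
      add_zero, add_im, mul_im, zero_add, smul_eq_mul] at h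
    have h2 : (∫ x in -R..R, Φ ((x : ℂ) + (y₁ : ℂ) * I)) -
      (∫ x in -R..R, Φ ((x : ℂ) + (y₂ : ℂ) * I)) =
      I * (∫ y in y₁..y₂, Φ (((-R : ℝ) : ℂ) + (y : ℂ) * I)) -
      I * ∫ y in y₁..y₂, Φ ((R : ℂ) + (y : ℂ) * I) := by
      linear_combination h
    rw [h2]
    have h3 : ∀ x : ℝ, ‖∫ y in y₁..y₂, Φ ((x : ℂ) + (y : ℂ) * I)‖ₑ ≤
        ∫⁻ y in Set.Ioc y₁ y₂, ‖Φ ((x : ℂ) + (y : ℂ) * I)‖ₑ := by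
      intro x
      rw [intervalIntegral.integral_of_le h₁₂.le]
      exact enorm_integral_le_lintegral_enorm _
    have h4 : ‖I‖ₑ = 1 := by
      rw [← ofReal_norm, norm_I, ENNReal.ofReal_one]
    have hm : ∀ x : ℝ, AEMeasurable (fun y : ℝ => ‖Φ ((x : ℂ) + (y : ℂ) * I)‖ₑ)
        (volume.restrict (Set.Ioc y₁ y₂)) := by
      intro x
      refine ContinuousOn.aemeasurable ?_ measurableSet_Ioc
      refine (hΦ.continuousOn.comp (f := fun y : ℝ => (x : ℂ) + (y : ℂ) * I) (by fun_prop)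
        fun y hy => ?_).enorm
      exact line_im_pos (h₁.trans hy.1) x
    refine (enorm_sub_le).trans ?_
    rw [enorm_mul, enorm_mul, h4, one_mul, one_mul, add_comm]
    refine (add_le_add (h3 R) (h3 (-R))).trans ?_
    rw [← lintegral_add_left' (hm R)]
  have hlim := (intervalIntegral_tendsto_integral hint₁ tendsto_neg_atTop_atBot tendsto_id).sub
    (intervalIntegral_tendsto_integral hint₂ tendsto_neg_atTop_atBot tendsto_id)
  have hlim' := hlim.enorm
  rw [← sub_eq_zero, ← enorm_eq_zero]
  by_contra hne
  have hpos := pos_iff_ne_zero.2 hne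
  obtain ⟨ε, hε, hε'⟩ := exists_between hpos
  obtain ⟨R, hR1, hR2⟩ := ((hfreq ε hε).and_eventually (hlim'.eventually_const_lt hε')).exists
  exact absurd ((hR2.trans_le (hrect R)).trans hR1) (lt_irrefl _)

lemma eLpNorm_mul_le {f g : ℝ → ℂ} (hf : AEStronglyMeasurable f volume)
    (hg : AEStronglyMeasurable g volume) :
    ∫⁻ x : ℝ, ‖f x * g x‖ₑ ≤ eLpNorm f 2 volume * eLpNorm g 2 volume := by
  have h := eLpNorm_smul_le_mul_eLpNorm (p := 2) (q := 2) (r := 1) hg hf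
  rwa [eLpNorm_one_eq_lintegral_enorm] at h

lemma eLpNorm_cauchyKernel_zero {a : ℂ} (ha : 0 < a.re) :
    eLpNorm (cauchyKernel a 0) 2 volume = ENNReal.ofReal √(Real.pi / a.re) := by
  rw [← norm_kernelLp_sq ha, Real.sqrt_sq (norm_nonneg _), ofReal_norm, Lp.enorm_def,
    eLpNorm_congr_ae (coeFn_kernelLp ha 0)]

section Zero

variable {G : ℂ → ℂ}

lemma continuous_line_of_differentiableOn (hG : DifferentiableOn ℂ G {z : ℂ | 0 < z.im}) {y : ℝ}
    (hy : 0 < y) : Continuous (fun x : ℝ => G ((x : ℂ) + (y : ℂ) * I)) :=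
  hG.continuousOn.comp_continuous (f := fun x : ℝ => (x : ℂ) + (y : ℂ) * I) (by fun_prop)
    (line_im_pos hy)

lemma memLp_line (hG : DifferentiableOn ℂ G {z : ℂ | 0 < z.im}) {C : ℝ≥0}
    (hC : ∀ y : ℝ, 0 < y → eLpNorm (fun x : ℝ => G ((x : ℂ) + (y : ℂ) * I)) 2 volume ≤ C)
    {y : ℝ} (hy : 0 < y) : MemLp (fun x : ℝ => G ((x : ℂ) + (y : ℂ) * I)) 2 volume :=
  ⟨(continuous_line_of_differentiableOn hG hy).aestronglyMeasurable,
    (hC y hy).trans_lt ENNReal.coe_lt_top⟩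

/-- The zero of G at z₀ = i(b + y) cancels the pole of 1/(z - z₀), so G/(z - z₀) is holomorphic in
the half-plane. Its integral over a horizontal line is thus unchanged when the line is raised, and
by Cauchy–Schwarz it is O((τ - b - y)^{-1/2}) at height τ. -/
lemma integral_cauchy_eq_zero (hG : DifferentiableOn ℂ G {z : ℂ | 0 < z.im}) {C : ℝ≥0}
    (hC : ∀ y : ℝ, 0 < y → eLpNorm (fun x : ℝ => G ((x : ℂ) + (y : ℂ) * I)) 2 volume ≤ C)
    {b y : ℝ} (hb : 0 < b) (hy : 0 < y) (h0 : G (((b + y : ℝ) : ℂ) * I) = 0) :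
    ∫ x : ℝ, 1 / ((b : ℂ) + I * x) ^ 1 * G ((x : ℂ) + (y : ℂ) * I) = 0 := by
  set z₀ : ℂ := ((b + y : ℝ) : ℂ) * I with hz₀
  have hz₀' : z₀ ∈ {z : ℂ | 0 < z.im} := by
    change 0 < z₀.im
    simp [hz₀]
    positivity
  have hopen : IsOpen {z : ℂ | 0 < z.im} := isOpen_lt continuous_const continuous_im
  set Φ : ℂ → ℂ := dslope G z₀ with hΦdef
  have hΦ : DifferentiableOn ℂ Φ {z : ℂ | 0 < z.im} :=
    (Complex.differentiableOn_dslope (hopen.mem_nhds hz₀')).2 hG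
  have hval : ∀ z, z ≠ z₀ → Φ z = (z - z₀)⁻¹ * G z := by
    intro z hz
    rw [hΦdef, dslope_of_ne _ hz, slope_def_module, h0, sub_zero, smul_eq_mul]
  have hline : ∀ τ : ℝ, τ ≠ b + y → ∀ x : ℝ, Φ ((x : ℂ) + (τ : ℂ) * I) =
      ((x : ℂ) + ((τ - (b + y) : ℝ) : ℂ) * I)⁻¹ * G ((x : ℂ) + (τ : ℂ) * I) := by
    intro τ hτ x
    rw [hval]
    · congr 2
      rw [hz₀]
      push_cast
      ring
    · intro h
      have := congrArg Complex.im h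
      simp [hz₀] at this
      exact hτ this
  have hhigh : ∀ τ : ℝ, b + y < τ → ∀ x : ℝ, Φ ((x : ℂ) + (τ : ℂ) * I) =
      -I * (cauchyKernel ((τ - (b + y) : ℝ) : ℂ) 0 x * G ((x : ℂ) + (τ : ℂ) * I)) := by
    intro τ hτ x
    rw [hline τ hτ.ne', cauchyKernel, ← mul_assoc]
    congr 1
    have h1 := sub_I_mul_ne_zero (a := ((τ - (b + y) : ℝ) : ℂ))
      (by rw [ofReal_re]; linarith) x
    have h2 : (x : ℂ) + ((τ - (b + y) : ℝ) : ℂ) * I =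
        I * (((τ - (b + y) : ℝ) : ℂ) - I * x) := by
      ring_nf
      simp
    rw [h2, mul_inv, inv_I]
    simp
  have hlow : ∀ x : ℝ, Φ ((x : ℂ) + (y : ℂ) * I) =
      I * (1 / ((b : ℂ) + I * x) ^ 1 * G ((x : ℂ) + (y : ℂ) * I)) := by
    intro x
    rw [hline y (by linarith), ← mul_assoc]
    congr 1
    have h2 : (x : ℂ) + ((y - (b + y) : ℝ) : ℂ) * I = -I * ((b : ℂ) + I * x) := by
      push_cast
      ring_nf
      simp
    rw [h2, mul_inv, inv_neg, inv_I]
    simp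
  have hbre : 0 < ((b : ℝ) : ℂ).re := by simpa
  have hint₁ : Integrable (fun x : ℝ => Φ ((x : ℂ) + (y : ℂ) * I)) := by
    simp only [hlow]
    exact (integrable_mul_of_memLp (memLp_cauchyKernel_neg hbre 0) (memLp_line hG hC hy)).const_mul I
  have hτre : ∀ τ : ℝ, b + y < τ → 0 < ((τ - (b + y) : ℝ) : ℂ).re := fun τ hτ => by
    rw [ofReal_re]; linarith
  have hint₂ : ∀ τ : ℝ, b + y < τ → Integrable (fun x : ℝ => Φ ((x : ℂ) + (τ : ℂ) * I)) := by
    intro τ hτ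
    simp only [hhigh τ hτ]
    exact (integrable_mul_of_memLp (memLp_cauchyKernel (hτre τ hτ) 0)
      (memLp_line hG hC (by linarith))).const_mul (-I)
  -- Away from |x| ≤ 1 one has |z - z₀| ≥ |x| ≥ |1 - ix|/2, uniformly in the height, including the
  -- height of z₀.
  have hside : ∀ τ : ℝ, ∀ x : ℝ, 1 < |x| → ‖Φ ((x : ℂ) + (τ : ℂ) * I)‖ₑ ≤
      2 * ‖cauchyKernel 1 0 x * G ((x : ℂ) + (τ : ℂ) * I)‖ₑ := by
    intro τ x hx
    have hne : (x : ℂ) + (τ : ℂ) * I ≠ z₀ := by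
      intro h
      have := congrArg Complex.re h
      simp [hz₀] at this
      rw [this] at hx
      simp at hx
      linarith
    rw [hval _ hne, enorm_mul, enorm_mul, ← mul_assoc]
    gcongr
    have h2 : (2 : ℝ≥0∞) = ENNReal.ofReal 2 := by simp
    rw [← ofReal_norm, ← ofReal_norm, h2, ← ENNReal.ofReal_mul (by norm_num)]
    refine ENNReal.ofReal_le_ofReal ?_
    rw [norm_inv, cauchyKernel, norm_div, norm_one, zero_add, pow_one]
    have h3 : |x| ≤ ‖(x : ℂ) + (τ : ℂ) * I - z₀‖ := by
      have := Complex.abs_re_le_norm ((x : ℂ) + (τ : ℂ) * I - z₀)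
      simpa [hz₀] using this
    have h4 : ‖(1 : ℂ) - I * x‖ ≤ 2 * |x| := by
      refine (norm_sub_le _ _).trans ?_
      simp only [norm_one, norm_mul, norm_I, norm_real, Real.norm_eq_abs, one_mul]
      linarith
    have h5 : 0 < ‖(1 : ℂ) - I * x‖ := norm_pos_iff.2 (sub_I_mul_ne_zero (by simp) x)
    calc ‖(x : ℂ) + (τ : ℂ) * I - z₀‖⁻¹ ≤ |x|⁻¹ := by gcongr
      _ ≤ 2 * (1 / ‖(1 : ℂ) - I * x‖) := by
        rw [inv_eq_one_div, mul_one_div, div_le_div_iff₀ (by linarith) h5]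
        linarith
  set D : ℝ≥0∞ := 2 * (ENNReal.ofReal √(Real.pi / (1 : ℂ).re) * C) with hD
  have hD' : D ≠ ⊤ := ENNReal.mul_ne_top (by simp)
    (ENNReal.mul_ne_top ENNReal.ofReal_ne_top ENNReal.coe_ne_top)
  have hbd : ∀ τ : ℝ, 0 < τ → ∫⁻ x in Set.Ioi (1 : ℝ),
      (‖Φ ((x : ℂ) + (τ : ℂ) * I)‖ₑ + ‖Φ (((-x : ℝ) : ℂ) + (τ : ℂ) * I)‖ₑ) ≤ D + D := by
    intro τ hτ
    have hcG := continuous_line_of_differentiableOn hG hτ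
    have hck : Continuous (cauchyKernel 1 0) := continuous_cauchyKernel (by simp) 0
    have h1 : ∫⁻ x : ℝ, 2 * ‖cauchyKernel 1 0 x * G ((x : ℂ) + (τ : ℂ) * I)‖ₑ ≤ D := by
      rw [lintegral_const_mul' _ _ (by simp), hD]
      gcongr
      refine (eLpNorm_mul_le hck.aestronglyMeasurable hcG.aestronglyMeasurable).trans ?_
      rw [eLpNorm_cauchyKernel_zero (by simp)]
      gcongr
      exact hC τ hτ
    have h2 : ∫⁻ x : ℝ, 2 * ‖cauchyKernel 1 0 (-x) * G (((-x : ℝ) : ℂ) + (τ : ℂ) * I)‖ₑ ≤ D := by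
      rw [lintegral_neg_eq_self
        (fun x : ℝ => 2 * ‖cauchyKernel 1 0 x * G ((x : ℂ) + (τ : ℂ) * I)‖ₑ)]
      exact h1
    calc _ ≤ ∫⁻ x in Set.Ioi (1 : ℝ), (2 * ‖cauchyKernel 1 0 x * G ((x : ℂ) + (τ : ℂ) * I)‖ₑ +
          2 * ‖cauchyKernel 1 0 (-x) * G (((-x : ℝ) : ℂ) + (τ : ℂ) * I)‖ₑ) := by
          refine setLIntegral_mono' measurableSet_Ioi fun x hx => ?_
          have hx : 1 < x := hx
          exact add_le_add (hside τ x (hx.trans_le (le_abs_self x)))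
            (hside τ (-x) (by rw [abs_neg]; exact hx.trans_le (le_abs_self x)))
      _ ≤ ∫⁻ x : ℝ, (2 * ‖cauchyKernel 1 0 x * G ((x : ℂ) + (τ : ℂ) * I)‖ₑ +
          2 * ‖cauchyKernel 1 0 (-x) * G (((-x : ℝ) : ℂ) + (τ : ℂ) * I)‖ₑ) :=
          setLIntegral_le_lintegral _ _
      _ ≤ D + D := by
          rw [lintegral_add_left]
          · exact add_le_add h1 h2
          · exact ((hck.mul hcG).enorm.measurable).const_mul 2
  have heq : ∀ τ : ℝ, b + y < τ → ‖∫ x : ℝ, Φ ((x : ℂ) + (y : ℂ) * I)‖ₑ ≤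
      ENNReal.ofReal √(Real.pi / (τ - (b + y))) * C := by
    intro τ hτ
    rw [integral_line_eq hΦ hy (by linarith) hint₁ (hint₂ τ hτ)
      (ENNReal.add_ne_top.2 ⟨hD', hD'⟩) fun t ht => hbd t (hy.trans ht.1)]
    refine (enorm_integral_le_lintegral_enorm _).trans ?_
    have h1 : ∀ x : ℝ, ‖Φ ((x : ℂ) + (τ : ℂ) * I)‖ₑ =
        ‖cauchyKernel ((τ - (b + y) : ℝ) : ℂ) 0 x * G ((x : ℂ) + (τ : ℂ) * I)‖ₑ := by
      intro x
      rw [hhigh τ hτ x, ← ofReal_norm, norm_mul, norm_neg, norm_I, one_mul, ofReal_norm]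
    simp only [h1]
    have hτ0 : 0 < τ := by linarith
    refine (eLpNorm_mul_le (continuous_cauchyKernel (hτre τ hτ) 0).aestronglyMeasurable
      (continuous_line_of_differentiableOn hG hτ0).aestronglyMeasurable).trans ?_
    rw [eLpNorm_cauchyKernel_zero (hτre τ hτ), ofReal_re]
    gcongr
    exact hC τ hτ0
  have hlim : Tendsto (fun τ : ℝ => ENNReal.ofReal √(Real.pi / (τ - (b + y))) * C) atTop
      (𝓝 (ENNReal.ofReal √0 * C)) := by
    refine ENNReal.Tendsto.mul_const (ENNReal.tendsto_ofReal ?_) (Or.inr ENNReal.coe_ne_top)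
    refine (Real.continuous_sqrt.tendsto 0).comp ?_
    exact (tendsto_atTop_add_const_right _ _ tendsto_id).const_div_atTop Real.pi
  have hzero : ‖∫ x : ℝ, Φ ((x : ℂ) + (y : ℂ) * I)‖ₑ ≤ ENNReal.ofReal √0 * C :=
    ge_of_tendsto hlim ((eventually_gt_atTop (b + y)).mono heq)
  simp only [Real.sqrt_zero, ENNReal.ofReal_zero, zero_mul, nonpos_iff_eq_zero, enorm_eq_zero,
    hlow, integral_const_mul, mul_eq_zero, I_ne_zero, false_or] at hzero
  exact hzero

end Zero

lemma IsHardyExtension.integral_cauchy_line {F : ℂ → ℂ} {f : ℝ → ℂ} (hF : IsHardyExtension F f)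
    {b y : ℝ} (hb : 0 < b) (hy : 0 < y) :
    ∫ x : ℝ, 1 / ((b : ℂ) + I * x) ^ 1 * F ((x : ℂ) + (y : ℂ) * I) =
      2 * Real.pi * F (((b + y : ℝ) : ℂ) * I) := by
  obtain ⟨C, hC⟩ := hF.bounded
  -- A is chosen so that κ(z) = A/(1 - iz) agrees with F at i(b + y). Then F - κ falls under
  -- `integral_cauchy_eq_zero`, and the integral of κ is explicit.
  set A : ℂ := F (((b + y : ℝ) : ℂ) * I) * (1 + b + y) with hA
  set κ : ℂ → ℂ := fun z => A * (1 / (1 - I * z) ^ 1) with hκ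
  have hκline : ∀ t x : ℝ, κ ((x : ℂ) + (t : ℂ) * I) = A * cauchyKernel ((1 + t : ℝ) : ℂ) 0 x := by
    intro t x
    have h : (1 : ℂ) - I * ((x : ℂ) + (t : ℂ) * I) = ((1 + t : ℝ) : ℂ) - I * x := by
      push_cast
      ring_nf
      simp
    rw [hκ, cauchyKernel]
    simp only [h]
  have hκd : DifferentiableOn ℂ κ {z : ℂ | 0 < z.im} := by
    have h : DifferentiableOn ℂ (fun z : ℂ => (1 - I * z) ^ 1) {z : ℂ | 0 < z.im} := by fun_prop
    refine ((differentiableOn_const (1 : ℂ)).fun_div h fun z hz => ?_).const_mul A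
    have hz : 0 < z.im := hz
    intro h0
    have := congrArg Complex.re h0
    simp at this
    linarith
  have hre : ∀ t : ℝ, 0 < t → 0 < ((1 + t : ℝ) : ℂ).re := fun t ht => by
    rw [ofReal_re]; linarith
  have hκC : ∀ t : ℝ, 0 < t → eLpNorm (fun x : ℝ => κ ((x : ℂ) + (t : ℂ) * I)) 2 volume ≤
      ((‖A‖₊ * Real.toNNReal √Real.pi : ℝ≥0) : ℝ≥0∞) := by
    intro t ht
    simp only [hκline]
    refine (le_of_eq (eLpNorm_const_smul (p := 2) (μ := (volume : Measure ℝ)) A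
      (cauchyKernel ((1 + t : ℝ) : ℂ) 0))).trans ?_
    rw [eLpNorm_cauchyKernel_zero (hre t ht), ENNReal.coe_mul, ofReal_re]
    refine mul_le_mul' le_rfl (ENNReal.ofReal_le_ofReal (Real.sqrt_le_sqrt ?_))
    exact div_le_self Real.pi_pos.le (by linarith)
  have hGd := hF.holomorphic.sub hκd
  have hGC : ∀ t : ℝ, 0 < t → eLpNorm (fun x : ℝ => (F - κ) ((x : ℂ) + (t : ℂ) * I)) 2 volume ≤
      ((C + ‖A‖₊ * Real.toNNReal √Real.pi : ℝ≥0) : ℝ≥0∞) := by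
    intro t ht
    refine (eLpNorm_sub_le (p := 2) (μ := (volume : Measure ℝ))
      (hF.continuous_line ht).aestronglyMeasurable
      (continuous_line_of_differentiableOn hκd ht).aestronglyMeasurable (by norm_num)).trans ?_
    rw [ENNReal.coe_add]
    exact add_le_add (hC t ht) (hκC t ht)
  have hκz : κ (((b + y : ℝ) : ℂ) * I) = F (((b + y : ℝ) : ℂ) * I) := by
    have h : (1 : ℂ) - I * (((b + y : ℝ) : ℂ) * I) = 1 + b + y := by
      push_cast
      ring_nf
      simp
    have h' : (1 : ℂ) + b + y ≠ 0 := by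
      have : (1 : ℝ) + b + y ≠ 0 := by positivity
      exact_mod_cast this
    simp only [hκ, h, hA, pow_one]
    field_simp
  have h1 := integral_cauchy_eq_zero hGd hGC hb hy (by
    rw [Pi.sub_apply, hκz, sub_self])
  have hbre : 0 < ((b : ℝ) : ℂ).re := by simpa
  have hi1 := integrable_mul_of_memLp (memLp_cauchyKernel_neg hbre 0)
    (memLp_line hF.holomorphic hC hy)
  have hi2 := integrable_mul_of_memLp (memLp_cauchyKernel_neg hbre 0) (memLp_line hκd hκC hy)
  simp only [Pi.sub_apply, mul_sub] at h1
  simp only [zero_add] at hi1 hi2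
  rw [integral_sub hi1 hi2, sub_eq_zero] at h1
  rw [h1]
  have h2 : ∀ x : ℝ, 1 / ((b : ℂ) + I * x) ^ 1 * κ ((x : ℂ) + (y : ℂ) * I) =
      A * (1 / ((b : ℂ) + I * x) ^ 1 * (1 / (((1 + y : ℝ) : ℂ) - I * x) ^ 1)) := by
    intro x
    rw [hκline, cauchyKernel]
    ring
  simp only [h2]
  rw [integral_const_mul, integral_inv_mul_inv hbre (hre y hy), hA]
  have h' : (1 : ℂ) + b + y ≠ 0 := by
    have : (1 : ℝ) + b + y ≠ 0 := by positivity
    exact_mod_cast this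
  have h3 : (b : ℂ) + ((1 + y : ℝ) : ℂ) = 1 + b + y := by push_cast; ring
  rw [h3]
  field_simp

/-- The Cauchy formula: evaluation on the imaginary half-axis in terms of the boundary values. -/
lemma IsHardyExtension.inner_kernelLp {F : ℂ → ℂ} {f : L2R} (hF : IsHardyExtension F f) {b : ℝ}
    (hb : 0 < b) :
    inner ℂ (kernelLp ((b : ℝ) : ℂ) (by simpa) 0) f = 2 * Real.pi * F ((b : ℂ) * I) := by
  have hbre : 0 < ((b : ℝ) : ℂ).re := by simpa
  obtain ⟨C, hC⟩ := hF.bounded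
  have hmem : ∀ y : ℝ, 0 < y → MemLp (fun x : ℝ => F ((x : ℂ) + (y : ℂ) * I)) 2 volume :=
    fun y hy => memLp_line hF.holomorphic hC hy
  -- The values for y ≤ 0 play no role, since only y ↓ 0 is considered: the inner product converges
  -- by L² continuity, the point value by continuity of F.
  set u : ℝ → L2R := fun y => if hy : 0 < y then (hmem y hy).toLp _ else 0 with hu
  have hu1 : Tendsto u (𝓝[>] 0) (𝓝 f) := by
    rw [Lp.tendsto_Lp_iff_tendsto_eLpNorm']
    refine hF.boundary.congr' ?_
    filter_upwards [self_mem_nhdsWithin] with y hy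
    refine eLpNorm_congr_ae ?_
    simp only [hu, dif_pos (show 0 < y from hy)]
    filter_upwards [(hmem y hy).coeFn_toLp] with x hx
    rw [Pi.sub_apply, hx]
  have h1 : Tendsto (fun y => inner ℂ (kernelLp ((b : ℝ) : ℂ) hbre 0) (u y)) (𝓝[>] 0)
      (𝓝 (inner ℂ (kernelLp ((b : ℝ) : ℂ) hbre 0) f)) := tendsto_const_nhds.inner hu1
  have h2 : Tendsto (fun y : ℝ => 2 * Real.pi * F (((b + y : ℝ) : ℂ) * I)) (𝓝[>] 0)
      (𝓝 (2 * Real.pi * F ((b : ℂ) * I))) := by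
    have hopen : IsOpen {z : ℂ | 0 < z.im} := isOpen_lt continuous_const continuous_im
    have hb' : (b : ℂ) * I ∈ {z : ℂ | 0 < z.im} := by
      change 0 < ((b : ℂ) * I).im
      simpa
    have hc := (hF.holomorphic.differentiableAt (hopen.mem_nhds hb')).continuousAt
    have hc2 : Tendsto (fun y : ℝ => ((b + y : ℝ) : ℂ) * I) (𝓝 0) (𝓝 ((b : ℂ) * I)) := by
      have : Continuous (fun y : ℝ => ((b + y : ℝ) : ℂ) * I) := by fun_prop
      simpa using this.tendsto 0
    exact ((hc.tendsto.comp hc2).const_mul _).mono_left nhdsWithin_le_nhds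
  refine tendsto_nhds_unique (h1.congr' ?_) h2
  filter_upwards [self_mem_nhdsWithin] with y hy
  have hy : 0 < y := hy
  rw [← hF.integral_cauchy_line hb hy, L2_inner_eq]
  refine integral_congr_ae ?_
  simp only [hu, dif_pos hy]
  filter_upwards [(hmem y hy).coeFn_toLp, coeFn_kernelLp hbre 0] with x h3 h4
  rw [h3, h4, conj_cauchyKernel, conj_ofReal]

/-- The identity theorem gives F = 0 in the half-plane, and the boundary value vanishes with it. -/
lemma IsHardyExtension.eq_zero_of_imaginary_axis {F : ℂ → ℂ} {f : L2R}
    (hF : IsHardyExtension F f) (h : ∀ b : ℝ, 0 < b → F ((b : ℂ) * I) = 0) : f = 0 := by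
  have hopen : IsOpen {z : ℂ | 0 < z.im} := isOpen_lt continuous_const continuous_im
  have hconn : IsPreconnected {z : ℂ | 0 < z.im} := (convex_halfSpace_im_gt 0).isPreconnected
  have hI : I ∈ {z : ℂ | 0 < z.im} := by
    change 0 < I.im
    simp
  have hzero : Set.EqOn F 0 {z : ℂ | 0 < z.im} := by
    refine (hF.holomorphic.analyticOnNhd hopen).eqOn_zero_of_preconnected_of_frequently_eq_zero
      hconn hI ?_
    have h1 : Tendsto (fun b : ℝ => (b : ℂ) * I) (𝓝[≠] 1) (𝓝[≠] I) := by
      refine tendsto_nhdsWithin_of_tendsto_nhds_of_eventually_within _ ?_ ?_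
      · have : Continuous (fun y : ℝ => (y : ℂ) * I) := by fun_prop
        have h2 := this.tendsto 1
        simp only [ofReal_one, one_mul] at h2
        exact h2.mono_left nhdsWithin_le_nhds
      · filter_upwards [self_mem_nhdsWithin] with b hb h2
        have := congrArg Complex.im h2
        simp at this
        exact hb this
    refine h1.frequently (Eventually.frequently ?_)
    have h3 : ∀ᶠ b : ℝ in 𝓝[≠] 1, 0 < b :=
      nhdsWithin_le_nhds (lt_mem_nhds (by norm_num))
    exact h3.mono h
  have h2 : Tendsto (fun _ : ℝ => eLpNorm f 2 volume) (𝓝[>] 0) (𝓝 0) := by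
    refine hF.boundary.congr' ?_
    filter_upwards [self_mem_nhdsWithin] with y hy
    have : (fun x : ℝ => F ((x : ℂ) + (y : ℂ) * I) - f x) = -f := by
      funext x
      rw [hzero (line_im_pos hy x)]
      simp
    rw [this, eLpNorm_neg]
  have h3 := tendsto_nhds_unique h2 tendsto_const_nhds
  rw [← Lp.enorm_def] at h3
  exact enorm_eq_zero.1 h3.symm

/-- By the Cauchy formula a Hardy function orthogonal to all kernels has an extension vanishing on
the imaginary half-axis, so it is zero. -/
theorem hardySpace_eq_closure :
    hardySpace = (LinearMap.range kernelComb).topologicalClosure := by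
  refine le_antisymm ?_ closure_range_kernelComb_le
  intro f hf
  set D := (LinearMap.range kernelComb).topologicalClosure with hD
  have : CompleteSpace D := (Submodule.isClosed_topologicalClosure _).completeSpace_coe
  have hp : D.starProjection f ∈ D := D.starProjection_apply_mem f
  have hq : f - D.starProjection f ∈ Dᗮ := D.sub_starProjection_mem_orthogonal f
  obtain ⟨F, hF⟩ : f - D.starProjection f ∈ hardySpace :=
    hardySpace.sub_mem hf (closure_range_kernelComb_le hp)
  have h0 := hF.eq_zero_of_imaginary_axis fun b hb => by
    have h1 := hF.inner_kernelLp hb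
    have h2 : kernelLp ((b : ℝ) : ℂ) (by simpa) 0 ∈ D := by
      refine Submodule.le_topologicalClosure _ ⟨Finsupp.single ⟨b, hb⟩ 1, ?_⟩
      simp [kernelComb]
    rw [(Submodule.mem_orthogonal _ _).1 hq _ h2] at h1
    have : (2 * Real.pi : ℂ) ≠ 0 := by
      have := Real.pi_ne_zero
      exact_mod_cast mul_ne_zero two_ne_zero this
    simpa [this] using h1.symm
  rw [sub_eq_zero] at h0
  rw [h0]
  exact hp

instance completeSpace_hardySpace : CompleteSpace hardySpace := by
  have : IsClosed (hardySpace : Set L2R) := by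
    rw [hardySpace_eq_closure]
    exact Submodule.isClosed_topologicalClosure _
  exact this.completeSpace_coe

end CauchyFormula

/-! ### Prescribing jets with small norm on the half-axis -/

section Jets

/-- The coefficients of the product of `∑ c_g / (s + g)` with `(p s + q) / (s + b)`. -/
def mulComb (p q : ℂ) (b : PosReal) : (PosReal →₀ ℂ) →ₗ[ℂ] (PosReal →₀ ℂ) :=
  Finsupp.linearCombination ℂ fun g : PosReal =>
    Finsupp.single g ((q - p * ((g : ℝ) : ℂ)) / (((b : ℝ) : ℂ) - ((g : ℝ) : ℂ))) +
      Finsupp.single b ((q - p * ((b : ℝ) : ℂ)) / (((g : ℝ) : ℂ) - ((b : ℝ) : ℂ)))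

lemma support_mulComb_subset (p q : ℂ) (b : PosReal) (c : PosReal →₀ ℂ) :
    (mulComb p q b c).support ⊆ insert b c.support := by
  classical
  rw [mulComb, Finsupp.linearCombination_apply, Finsupp.sum]
  refine (Finsupp.support_finsetSum).trans ?_
  intro g hg
  simp only [Finset.mem_biUnion] at hg
  obtain ⟨g', hg', hg⟩ := hg
  have h1 := Finsupp.support_add (Finsupp.support_smul hg)
  rw [Finset.mem_union] at h1
  rcases h1 with h | h
  · have := Finsupp.support_single_subset h
    rw [Finset.mem_singleton] at this
    rw [this]
    exact Finset.mem_insert_of_mem hg'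
  · have := Finsupp.support_single_subset h
    rw [Finset.mem_singleton] at this
    rw [this]
    exact Finset.mem_insert_self _ _

lemma jet_mulComb (p q a : ℂ) (b : PosReal) (k : ℕ) (c : PosReal →₀ ℂ) :
    jet a k (mulComb p q b c) = ∑ g ∈ c.support, c g *
      ((q - p * ((g : ℝ) : ℂ)) / (((b : ℝ) : ℂ) - ((g : ℝ) : ℂ)) *
          (1 / (a + ((g : ℝ) : ℂ)) ^ (k + 1)) +
        (q - p * ((b : ℝ) : ℂ)) / (((g : ℝ) : ℂ) - ((b : ℝ) : ℂ)) *
          (1 / (a + ((b : ℝ) : ℂ)) ^ (k + 1))) := by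
  rw [mulComb, Finsupp.linearCombination_apply, Finsupp.sum, map_sum]
  refine Finset.sum_congr rfl fun g _ => ?_
  rw [map_smul, map_add, jet, Finsupp.linearCombination_single, Finsupp.linearCombination_single]
  simp only [smul_eq_mul]

lemma jet_apply (a : ℂ) (k : ℕ) (c : PosReal →₀ ℂ) :
    jet a k c = ∑ g ∈ c.support, c g * (1 / (a + ((g : ℝ) : ℂ)) ^ (k + 1)) := by
  simp only [jet, Finsupp.linearCombination_apply, Finsupp.sum, smul_eq_mul]

lemma add_posReal_ne_zero {a : ℂ} (ha : 0 < a.re) (b : PosReal) : a + ((b : ℝ) : ℂ) ≠ 0 :=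
  add_ne_zero_of_re_pos ha (by simpa using b.2)

lemma posReal_sub_ne_zero {b : PosReal} {c : PosReal →₀ ℂ} (hb : b ∉ c.support) {g : PosReal}
    (hg : g ∈ c.support) : ((b : ℝ) : ℂ) - ((g : ℝ) : ℂ) ≠ 0 := by
  rw [sub_ne_zero]
  intro h
  have h1 : b = g := Subtype.ext (by exact_mod_cast h)
  exact hb (h1 ▸ hg)

/-- Partial fractions. The condition on b keeps all poles simple; otherwise `mulComb` divides by
zero and loses its meaning. -/
lemma jet_zero_mulComb (p q : ℂ) {a : ℂ} (ha : 0 < a.re) {b : PosReal} {c : PosReal →₀ ℂ}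
    (hb : b ∉ c.support) :
    jet a 0 (mulComb p q b c) = (p * a + q) / (a + ((b : ℝ) : ℂ)) * jet a 0 c := by
  rw [jet_mulComb, jet_apply, Finset.mul_sum]
  refine Finset.sum_congr rfl fun g hg => ?_
  have h1 := add_posReal_ne_zero ha b
  have h2 := add_posReal_ne_zero ha g
  have h3 := posReal_sub_ne_zero hb hg
  have h4 : ((g : ℝ) : ℂ) - ((b : ℝ) : ℂ) = -(((b : ℝ) : ℂ) - ((g : ℝ) : ℂ)) := by ring
  rw [h4]
  field_simp
  ring

/-- Compares the coefficients of (s - a)^{k+1} in (s + b) g(s) = (ps + q) f(s). The minus signs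
arise because jets are Taylor coefficients times (-1)^k. -/
lemma jet_succ_mulComb (p q : ℂ) {a : ℂ} (ha : 0 < a.re) {b : PosReal} {c : PosReal →₀ ℂ}
    (hb : b ∉ c.support) (k : ℕ) :
    (a + ((b : ℝ) : ℂ)) * jet a (k + 1) (mulComb p q b c) - jet a k (mulComb p q b c) =
      (p * a + q) * jet a (k + 1) c - p * jet a k c := by
  rw [jet_mulComb, jet_mulComb, jet_apply, jet_apply, Finset.mul_sum, Finset.mul_sum,
    Finset.mul_sum, ← Finset.sum_sub_distrib, ← Finset.sum_sub_distrib]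
  refine Finset.sum_congr rfl fun g hg => ?_
  have h1 := add_posReal_ne_zero ha b
  have h2 := add_posReal_ne_zero ha g
  have h3 := posReal_sub_ne_zero hb hg
  have h4 : ((g : ℝ) : ℂ) - ((b : ℝ) : ℂ) = -(((b : ℝ) : ℂ) - ((g : ℝ) : ℂ)) := by ring
  rw [h4]
  field_simp
  ring

/-- The function `∑ c_b / (s + b)` vanishes at `a` to order `n`. -/
def VanishesTo (c : PosReal →₀ ℂ) (a : ℂ) (n : ℕ) : Prop := ∀ i < n, jet a i c = 0

lemma VanishesTo.mulComb {p q a : ℂ} (ha : 0 < a.re) {b : PosReal} {c : PosReal →₀ ℂ}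
    (hb : b ∉ c.support) {n : ℕ} (h : VanishesTo c a n) :
    VanishesTo (mulComb p q b c) a n ∧
      jet a n (mulComb p q b c) = (p * a + q) / (a + ((b : ℝ) : ℂ)) * jet a n c := by
  induction n with
  | zero => exact ⟨fun i hi => absurd hi (Nat.not_lt_zero i), jet_zero_mulComb p q ha hb⟩
  | succ n ih =>
    obtain ⟨h1, h2⟩ := ih fun i hi => h i (Nat.lt_succ_of_lt hi)
    rw [h n (Nat.lt_succ_self n), mul_zero] at h2
    refine ⟨fun i hi => ?_, ?_⟩
    · rcases Nat.lt_succ_iff_lt_or_eq.1 hi with h3 | h3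
      · exact h1 i h3
      · rw [h3, h2]
    · have h3 := jet_succ_mulComb p q ha hb n
      rw [h2, h n (Nat.lt_succ_self n)] at h3
      have h4 := add_posReal_ne_zero ha b
      field_simp
      linear_combination h3

lemma VanishesTo.mulComb_root {p q a : ℂ} (ha : 0 < a.re) {b : PosReal} {c : PosReal →₀ ℂ}
    (hb : b ∉ c.support) {n : ℕ} (h : VanishesTo c a n) (hroot : p * a + q = 0) :
    VanishesTo (_root_.mulComb p q b c) a (n + 1) ∧
      jet a (n + 1) (_root_.mulComb p q b c) = -p / (a + ((b : ℝ) : ℂ)) * jet a n c := by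
  obtain ⟨h1, h2⟩ := h.mulComb (p := p) (q := q) ha hb
  rw [hroot, zero_div, zero_mul] at h2
  refine ⟨fun i hi => ?_, ?_⟩
  · rcases Nat.lt_succ_iff_lt_or_eq.1 hi with h3 | h3
    · exact h1 i h3
    · rw [h3, h2]
  · have h3 := jet_succ_mulComb p q ha hb n
    rw [h2, hroot] at h3
    have h4 := add_posReal_ne_zero ha b
    field_simp
    linear_combination h3

instance infinite_posReal : Infinite PosReal := (Set.Ioi_infinite (0 : ℝ)).to_subtype

/-- Each step multiplies by (s - a₁)/(s + b) with a fresh pole b; this factor is nonzero at every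
other point of the right half-plane. -/
lemma exists_raise_vanishing (c : PosReal →₀ ℂ) {a₁ : ℂ} (ha₁ : 0 < a₁.re) (n : ℕ) :
    ∃ c' : PosReal →₀ ℂ, (∀ a : ℂ, 0 < a.re → ∀ k, VanishesTo c a k → VanishesTo c' a k) ∧
      VanishesTo c' a₁ n ∧
      (∀ a : ℂ, 0 < a.re → a ≠ a₁ → ∀ k, VanishesTo c a k → jet a k c ≠ 0 → jet a k c' ≠ 0) ∧
      (jet a₁ 0 c ≠ 0 → jet a₁ n c' ≠ 0) := by
  induction n with
  | zero => exact ⟨c, fun _ _ _ h => h, fun i hi => absurd hi (Nat.not_lt_zero i),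
      fun _ _ _ _ _ h => h, fun h => h⟩
  | succ n ih =>
    obtain ⟨d, h1, h2, h3, h4⟩ := ih
    obtain ⟨b, hb⟩ := Infinite.exists_notMem_finset d.support
    have hroot : (1 : ℂ) * a₁ + -a₁ = 0 := by ring
    obtain ⟨h5, h6⟩ := h2.mulComb_root ha₁ hb hroot
    refine ⟨mulComb 1 (-a₁) b d, fun a ha k hk => ((h1 a ha k hk).mulComb ha hb).1, h5,
      fun a ha hne k hk hk' => ?_, fun h => ?_⟩
    · rw [((h1 a ha k hk).mulComb ha hb).2]
      refine mul_ne_zero (div_ne_zero ?_ (add_posReal_ne_zero ha b)) (h3 a ha hne k hk hk')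
      rw [one_mul, ← sub_eq_add_neg]
      exact sub_ne_zero.2 hne
    · rw [h6]
      exact mul_ne_zero (div_ne_zero (by simp) (add_posReal_ne_zero ha₁ b)) (h4 h)

/-- Start from 1/(s + 1), which has no zeros; introduce zeros of order n at the other points, then
one of order k at a₀. -/
lemma exists_leading_jet (A : Finset ℂ) (hA : ∀ a ∈ A, 0 < a.re) (n : ℕ) {a₀ : ℂ}
    (ha₀ : 0 < a₀.re) (k : ℕ) :
    ∃ c : PosReal →₀ ℂ, (∀ a ∈ A, a ≠ a₀ → VanishesTo c a n) ∧ VanishesTo c a₀ k ∧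
      jet a₀ k c ≠ 0 := by
  classical
  have key : ∃ c : PosReal →₀ ℂ, (∀ a ∈ A, a ≠ a₀ → VanishesTo c a n) ∧ jet a₀ 0 c ≠ 0 := by
    induction A using Finset.induction_on with
    | empty =>
      refine ⟨Finsupp.single ⟨1, one_pos⟩ 1, by simp, ?_⟩
      rw [jet, Finsupp.linearCombination_single, one_smul]
      exact one_div_ne_zero (pow_ne_zero _ (add_posReal_ne_zero ha₀ ⟨1, one_pos⟩))
    | insert a₁ A _ ih =>
      obtain ⟨c, h1, h2⟩ := ih fun a ha => hA a (Finset.mem_insert_of_mem ha)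
      have ha₁ := hA a₁ (Finset.mem_insert_self _ _)
      by_cases hne : a₁ = a₀
      · refine ⟨c, fun a ha hne' => ?_, h2⟩
        rcases Finset.mem_insert.1 ha with h | h
        · exact absurd (h.trans hne) hne'
        · exact h1 a h hne'
      · obtain ⟨c', h3, h4, h5, -⟩ := exists_raise_vanishing c ha₁ n
        refine ⟨c', fun a ha hne' => ?_, h5 a₀ ha₀ (Ne.symm hne) 0
          (fun i hi => absurd hi (Nat.not_lt_zero i)) h2⟩
        rcases Finset.mem_insert.1 ha with h | h
        · exact h ▸ h4
        · exact h3 a (hA a ha) n (h1 a h hne')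
  obtain ⟨c, h1, h2⟩ := key
  obtain ⟨c', h3, h4, -, h5⟩ := exists_raise_vanishing c ha₀ k
  exact ⟨c', fun a ha hne => h3 a (hA a ha) n (h1 a ha hne), h4, h5 h2⟩

/-- The majorant of the peaking factor on the positive half-axis. -/
def peakBound (r s : ℝ) : ℝ := 5 * r * s / (s ^ 2 + 3 * r * s + r ^ 2)

lemma peakBound_nonneg {r s : ℝ} (hr : 0 < r) (hs : 0 < s) : 0 ≤ peakBound r s := by
  unfold peakBound; positivity

lemma peakBound_le_one {r s : ℝ} (hr : 0 < r) (hs : 0 < s) : peakBound r s ≤ 1 := by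
  rw [peakBound, div_le_one (by positivity)]
  nlinarith [sq_nonneg (s - r)]

lemma peakBound_lt_one {r s : ℝ} (hr : 0 < r) (hs : 0 < s) (hne : s ≠ r) : peakBound r s < 1 := by
  rw [peakBound, div_lt_one (by positivity)]
  have : 0 < (s - r) ^ 2 := by
    have := sub_ne_zero.2 hne
    positivity
  nlinarith

/-- With b = t + 1/t the left side is at most (2 + b)rs/(s² + brs + r²) = 1 - (s - r)²/(s² + brs +
r²), which increases with b. The bound b ≤ 3 removes the dependence on t. -/
lemma peak_factor_le {r s t w : ℝ} (hr : 0 < r) (hs : 0 < s) (ht : 1 < t) (ht2 : t < 2)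
    (hw : w ≤ r * (2 + (t + 1 / t))) :
    w / (s + r / t) * (s / (s + r * t)) ≤ peakBound r s := by
  have ht0 : 0 < t := by linarith
  set b : ℝ := t + 1 / t with hb
  have hb2 : b ≤ 3 := by
    have : 1 / t ≤ 1 := by rw [div_le_one ht0]; exact ht.le
    linarith
  have hb0 : 0 < b := by positivity
  have hden : (s + r / t) * (s + r * t) = s ^ 2 + r * b * s + r ^ 2 := by
    rw [hb]
    field_simp
    ring
  rw [div_mul_div_comm, hden, peakBound, div_le_div_iff₀ (by positivity) (by positivity)]
  calc w * s * (s ^ 2 + 3 * r * s + r ^ 2)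
      ≤ r * (2 + b) * s * (s ^ 2 + 3 * r * s + r ^ 2) := by gcongr
    _ ≤ 5 * r * s * (s ^ 2 + r * b * s + r ^ 2) := by
      have h : 0 ≤ (3 - b) * (s - r) ^ 2 := mul_nonneg (by linarith) (sq_nonneg _)
      have h2 : 0 ≤ r * s * ((3 - b) * (s - r) ^ 2) := by positivity
      nlinarith

/-- Multiplies by ws/((s + r/t)(s + rt)), where r = |α| and w normalizes the value at α to 1. On the
half-axis this factor peaks only near s = r. -/
lemma exists_peak_factor {α : ℂ} (hα : 0 < α.re) (c : PosReal →₀ ℂ) :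
    ∃ c' : PosReal →₀ ℂ, (∀ a : ℂ, 0 < a.re → ∀ k, VanishesTo c a k → VanishesTo c' a k) ∧
      (∀ k, VanishesTo c α k → jet α k c' = jet α k c) ∧
      ∀ s : ℝ, 0 < s → ‖jet s 0 c'‖ ≤ peakBound ‖α‖ s * ‖jet s 0 c‖ := by
  classical
  set r : ℝ := ‖α‖ with hr
  have hr0 : 0 < r := norm_pos_iff.2 fun h => by simp [h] at hα
  -- The new poles rt and r/t must be distinct, hence t > 1, and must avoid the finitely many poles
  -- already present.
  obtain ⟨t, ⟨ht1, ht2⟩, ht⟩ := (Set.Ioo_infinite (show (1 : ℝ) < 2 by norm_num)).exists_notMem_finset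
    (c.support.image (fun g : PosReal => (g : ℝ) / r) ∪
      c.support.image (fun g : PosReal => r / (g : ℝ)))
  have ht0 : 0 < t := by linarith
  simp only [Finset.mem_union, Finset.mem_image, not_or, not_exists, not_and] at ht
  set b₁ : PosReal := ⟨r * t, by positivity⟩ with hb₁
  set b₂ : PosReal := ⟨r / t, by positivity⟩ with hb₂
  have hb₁c : b₁ ∉ c.support := fun h => ht.1 b₁ h (by simp only [hb₁]; field_simp)
  have hb₂c : b₂ ∉ c.support := fun h => ht.2 b₂ h (by simp only [hb₂]; field_simp)
  have hb₂d : b₂ ∉ (mulComb 1 0 b₁ c).support := by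
    intro h
    rcases Finset.mem_insert.1 (support_mulComb_subset 1 0 b₁ c h) with h | h
    · have h1 : r / t = r * t := congrArg Subtype.val h
      field_simp at h1
      nlinarith
    · exact hb₂c h
  set w : ℝ := 2 * α.re + r * (t + 1 / t) with hw
  have hw0 : 0 ≤ w := by positivity
  have hwle : w ≤ r * (2 + (t + 1 / t)) := by
    have := Complex.re_le_norm α
    rw [hw]
    linarith
  refine ⟨mulComb 0 w b₂ (mulComb 1 0 b₁ c), fun a ha k hk =>
    ((hk.mulComb ha hb₁c).1.mulComb ha hb₂d).1, fun k hk => ?_, fun s hs => ?_⟩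
  · have h1 := hk.mulComb (p := 1) (q := 0) hα hb₁c
    rw [(h1.1.mulComb hα hb₂d).2, h1.2]
    have h2 := add_posReal_ne_zero hα b₁
    have h3 := add_posReal_ne_zero hα b₂
    -- Because |α|² = α ᾱ, the product α² + r(t + 1/t)α + r² has the factor α, and the cofactor is
    -- the real number w.
    have h4 : (α + ((b₂ : ℝ) : ℂ)) * (α + ((b₁ : ℝ) : ℂ)) = α * w := by
      have h5 : α * conj α = (r : ℂ) ^ 2 := by
        rw [mul_conj, normSq_eq_norm_sq, hr]
        push_cast
        rfl
      have h6 : (2 * α.re : ℂ) = α + conj α := by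
        rw [add_conj]
        push_cast
        rfl
      have ht0' : (t : ℂ) ≠ 0 := by exact_mod_cast ht0.ne'
      rw [hw, hb₁, hb₂]
      push_cast
      have h7 : (r : ℂ) / t * (r * t) = (r : ℂ) ^ 2 := by
        field_simp
      rw [h6]
      linear_combination h7 - h5
    rw [zero_mul, zero_add, one_mul, add_zero, ← mul_assoc, div_mul_div_comm, h4, mul_comm (w : ℂ),
      div_self, one_mul]
    rw [← h4]
    exact mul_ne_zero h3 h2
  · have hs' : 0 < ((s : ℝ) : ℂ).re := by simpa
    rw [jet_zero_mulComb _ _ hs' hb₂d, jet_zero_mulComb _ _ hs' hb₁c, ← mul_assoc, norm_mul]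
    gcongr
    have h1 : (0 * (s : ℂ) + w) / ((s : ℂ) + ((b₂ : ℝ) : ℂ)) *
        ((1 * (s : ℂ) + 0) / ((s : ℂ) + ((b₁ : ℝ) : ℂ))) =
        ((w / (s + r / t) * (s / (s + r * t)) : ℝ) : ℂ) := by
      rw [hb₁, hb₂]
      push_cast
      ring
    rw [h1, norm_real, Real.norm_of_nonneg (by positivity)]
    exact peak_factor_le hr0 hs ht1 ht2 hwle

lemma exists_peak_factor_pow {α : ℂ} (hα : 0 < α.re) (c : PosReal →₀ ℂ) (n : ℕ) :
    ∃ c' : PosReal →₀ ℂ, (∀ a : ℂ, 0 < a.re → ∀ k, VanishesTo c a k → VanishesTo c' a k) ∧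
      (∀ k, VanishesTo c α k → jet α k c' = jet α k c) ∧
      ∀ s : ℝ, 0 < s → ‖jet s 0 c'‖ ≤ peakBound ‖α‖ s ^ n * ‖jet s 0 c‖ := by
  induction n with
  | zero => exact ⟨c, fun _ _ _ h => h, fun _ _ => rfl, fun s _ => by simp⟩
  | succ n ih =>
    obtain ⟨d, h1, h2, h3⟩ := ih
    obtain ⟨c', h4, h5, h6⟩ := exists_peak_factor hα d
    have hr0 : 0 < ‖α‖ := norm_pos_iff.2 fun h => by simp [h] at hα
    refine ⟨c', fun a ha k hk => h4 a ha k (h1 a ha k hk),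
      fun k hk => (h5 k (h1 α hα k hk)).trans (h2 k hk), fun s hs => ?_⟩
    calc _ ≤ peakBound ‖α‖ s * ‖jet s 0 d‖ := h6 s hs
      _ ≤ peakBound ‖α‖ s * (peakBound ‖α‖ s ^ n * ‖jet s 0 c‖) :=
        mul_le_mul_of_nonneg_left (h3 s hs) (peakBound_nonneg hr0 hs)
      _ = _ := by ring

lemma memLp_stieltjes {b : ℝ} (hb : 0 < b) :
    MemLp (fun s : ℝ => 1 / ((s : ℂ) + b) ^ (0 + 1)) 2 (volume.restrict (Set.Ioi (0 : ℝ))) := by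
  have hm : Measurable (fun s : ℝ => 1 / ((s : ℂ) + b) ^ (0 + 1)) := by fun_prop
  rw [memLp_two_iff_integrable_sq_norm hm.aestronglyMeasurable]
  refine (integral_Ioi_stieltjes hb hb).2.1.congr ?_
  filter_upwards [ae_restrict_mem measurableSet_Ioi] with s hs
  have hs : 0 < s := hs
  rw [norm_div, norm_one, zero_add, pow_one, ← ofReal_add, norm_real,
    Real.norm_of_nonneg (by positivity)]
  ring

/-- The restriction of `∑ c_b / (s + b)` to the positive half-axis. -/
def stieltjesComb : (PosReal →₀ ℂ) →ₗ[ℂ] Lp ℂ 2 (volume.restrict (Set.Ioi (0 : ℝ))) :=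
  Finsupp.linearCombination ℂ fun b : PosReal => (memLp_stieltjes b.2).toLp _

lemma coeFn_stieltjesComb (c : PosReal →₀ ℂ) :
    ⇑(stieltjesComb c) =ᵐ[volume.restrict (Set.Ioi (0 : ℝ))] fun s : ℝ => jet s 0 c :=
  coeFn_linearCombination (fun b : PosReal => fun s : ℝ => 1 / ((s : ℂ) + b) ^ (0 + 1))
    (fun b => memLp_stieltjes b.2) c

lemma norm_sq_eq_integral {μ : Measure ℝ} (f : Lp ℂ 2 μ) : ‖f‖ ^ 2 = ∫ x, ‖f x‖ ^ 2 ∂μ := by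
  have h := L2_inner_eq f f
  rw [inner_self_eq_ofReal_norm_sq] at h
  have h2 : ∫ x, conj (f x) * f x ∂μ = ((∫ x, ‖f x‖ ^ 2 ∂μ : ℝ) : ℂ) := by
    rw [← integral_complex_ofReal]
    refine integral_congr_ae (Eventually.of_forall fun x => ?_)
    simp only
    rw [mul_comm, mul_conj, normSq_eq_norm_sq]
  rw [h2] at h
  exact_mod_cast h

/-- High powers of the peaking factor tend to 0 on the half-axis except at s = |α|, a null set;
dominated convergence makes the norm small while the leading jet at α is kept. -/
lemma exists_peak {α : ℂ} (hα : 0 < α.re) (c : PosReal →₀ ℂ) {ε : ℝ} (hε : 0 < ε) :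
    ∃ c' : PosReal →₀ ℂ, (∀ a : ℂ, 0 < a.re → ∀ k, VanishesTo c a k → VanishesTo c' a k) ∧
      (∀ k, VanishesTo c α k → jet α k c' = jet α k c) ∧ ‖stieltjesComb c'‖ < ε := by
  choose d h1 h2 h3 using exists_peak_factor_pow hα c
  have hr0 : 0 < ‖α‖ := norm_pos_iff.2 fun h => by simp [h] at hα
  have hint : Integrable (fun s => ‖stieltjesComb c s‖ ^ 2)
      (volume.restrict (Set.Ioi (0 : ℝ))) :=
    (memLp_two_iff_integrable_sq_norm (Lp.aestronglyMeasurable _)).1 (Lp.memLp (stieltjesComb c))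
  have hall : ∀ n, ∀ᵐ s ∂(volume.restrict (Set.Ioi (0 : ℝ))),
      ‖stieltjesComb (d n) s‖ ≤ peakBound ‖α‖ s ^ n * ‖stieltjesComb c s‖ := by
    intro n
    filter_upwards [coeFn_stieltjesComb c, coeFn_stieltjesComb (d n),
      ae_restrict_mem measurableSet_Ioi] with s hs1 hs2 hs3
    rw [hs1, hs2]
    exact h3 n s hs3
  have hlim : Tendsto (fun n => ‖stieltjesComb (d n)‖ ^ 2) atTop (𝓝 0) := by
    simp only [norm_sq_eq_integral]
    suffices h0 : Tendsto (fun n => ∫ s in Set.Ioi (0 : ℝ), ‖stieltjesComb (d n) s‖ ^ 2) atTop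
        (𝓝 (∫ s : ℝ in Set.Ioi (0 : ℝ), (0 : ℝ))) by simpa using h0
    refine tendsto_integral_of_dominated_convergence (fun s => ‖stieltjesComb c s‖ ^ 2)
      (fun n => (Lp.aestronglyMeasurable _).norm.pow 2) hint (fun n => ?_) ?_
    · filter_upwards [hall n, ae_restrict_mem measurableSet_Ioi] with s hs1 hs2
      rw [norm_pow, norm_norm]
      refine pow_le_pow_left₀ (norm_nonneg _) (hs1.trans ?_) 2
      exact mul_le_of_le_one_left (norm_nonneg _)
        (pow_le_one₀ (peakBound_nonneg hr0 hs2) (peakBound_le_one hr0 hs2))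
    · have hne : ∀ᵐ s : ℝ ∂(volume.restrict (Set.Ioi (0 : ℝ))), s ≠ ‖α‖ :=
        ae_restrict_of_ae (Measure.ae_ne volume ‖α‖)
      filter_upwards [ae_all_iff.2 hall, ae_restrict_mem measurableSet_Ioi, hne] with s hs1 hs2 hs3
      have h4 : Tendsto (fun n => (peakBound ‖α‖ s ^ n * ‖stieltjesComb c s‖) ^ 2) atTop (𝓝 0) := by
        have := ((tendsto_pow_atTop_nhds_zero_of_lt_one (peakBound_nonneg hr0 hs2)
          (peakBound_lt_one hr0 hs2 hs3)).mul_const ‖stieltjesComb c s‖).pow 2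
        simpa using this
      exact squeeze_zero (fun n => by positivity)
        (fun n => pow_le_pow_left₀ (norm_nonneg _) (hs1 n) 2) h4
  obtain ⟨n, hn⟩ := (hlim.eventually_lt_const (show 0 < ε ^ 2 by positivity)).exists
  exact ⟨d n, h1 n, h2 n, lt_of_pow_lt_pow_left₀ 2 hε.le hn⟩

/-- Triangular elimination: a peaked function vanishing to order m at a₀ corrects the jet of order
m, and its uncontrolled higher jets are left to the next step. Here j counts the orders still to be
corrected. -/
lemma exists_comb_jet_single (A : Finset ℂ) (hA : ∀ a ∈ A, 0 < a.re) (n : ℕ) {a₀ : ℂ}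
    (ha₀ : 0 < a₀.re) (j : ℕ) :
    ∀ m, m + j = n → ∀ x : ℕ → ℂ, (∀ i < m, x i = 0) → ∀ ε : ℝ, 0 < ε →
      ∃ c : PosReal →₀ ℂ, (∀ a ∈ A, a ≠ a₀ → VanishesTo c a n) ∧
        (∀ i < n, jet a₀ i c = x i) ∧ ‖stieltjesComb c‖ < ε := by
  induction j with
  | zero =>
    intro m hm x hx ε hε
    refine ⟨0, fun a _ _ i _ => map_zero _, fun i hi => ?_, by simpa⟩
    rw [map_zero, hx i (by omega)]
  | succ j ih =>
    intro m hm x hx ε hε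
    obtain ⟨d, h1, h2, h3⟩ := exists_leading_jet A hA n ha₀ m
    obtain ⟨d', h4, h5, h6⟩ := exists_peak ha₀ ((x m / jet a₀ m d) • d) (half_pos hε)
    have hd : ∀ a k, VanishesTo d a k → VanishesTo ((x m / jet a₀ m d) • d) a k :=
      fun a k h i hi => by rw [map_smul, h i hi, smul_zero]
    obtain ⟨e, h7, h8, h9⟩ := ih (m + 1) (by omega) (fun i => x i - jet a₀ i d') (fun i hi => by
      rcases Nat.lt_succ_iff_lt_or_eq.1 hi with h | h
      · rw [hx i h, h4 a₀ ha₀ m (hd _ _ h2) i h, sub_zero]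
      · rw [h, h5 m (hd _ _ h2), map_smul, smul_eq_mul, div_mul_cancel₀ _ h3, sub_self])
      (ε / 2) (half_pos hε)
    refine ⟨d' + e, fun a ha hne i hi => ?_, fun i hi => ?_, ?_⟩
    · rw [map_add, h7 a ha hne i hi, h4 a (hA a ha) n (hd _ _ (h1 a ha hne)) i hi, add_zero]
    · rw [map_add, h8 i hi]
      ring
    · rw [map_add]
      refine (norm_add_le _ _).trans_lt ?_
      linarith

/-- Jets at finitely many points of the right half-plane can be prescribed by a combination of
kernels which is small in `L²` of the positive half-axis. -/
theorem exists_comb_jet (A : Finset ℂ) (hA : ∀ a ∈ A, 0 < a.re) (n : ℕ) (x : ℂ → ℕ → ℂ) {ε : ℝ}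
    (hε : 0 < ε) :
    ∃ c : PosReal →₀ ℂ, (∀ a ∈ A, ∀ i < n, jet a i c = x a i) ∧ ‖stieltjesComb c‖ < ε := by
  classical
  -- The + 1 keeps the denominator positive and the total strictly below ε, also when A is empty.
  have h : ∀ a₀ : A, ∃ c : PosReal →₀ ℂ, (∀ a ∈ A, a ≠ a₀ → VanishesTo c a n) ∧
      (∀ i < n, jet a₀ i c = x a₀ i) ∧ ‖stieltjesComb c‖ < ε / (A.card + 1) := fun a₀ =>
    exists_comb_jet_single A hA n (hA a₀ a₀.2) n 0 (by simp) (x a₀)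
      (fun i hi => absurd hi (Nat.not_lt_zero i)) _ (by positivity)
  choose c h1 h2 h3 using h
  refine ⟨∑ a : A, c a, fun a ha i hi => ?_, ?_⟩
  · rw [map_sum, Finset.sum_eq_single (⟨a, ha⟩ : A)]
    · exact h2 ⟨a, ha⟩ i hi
    · intro b _ hb
      exact h1 b a ha (fun h => hb (Subtype.ext h.symm)) i hi
    · simp
  · rw [map_sum]
    calc _ ≤ ∑ a : A, ‖stieltjesComb (c a)‖ := norm_sum_le _ _
      _ ≤ ∑ _a : A, ε / (A.card + 1) := Finset.sum_le_sum fun a _ => (h3 a).le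
      _ = A.card * (ε / (A.card + 1)) := by simp
      _ < ε := by
        rw [mul_div_assoc', div_lt_iff₀ (by positivity)]
        linarith

end Jets

/-! ### The Hankel form as Carleman form plus jet form -/

section Forms

/-- The operator `w ↦ σ(x) w(-x)` in `L²(ℝ)`. -/
def hankelLp (σ : ℝ → ℂ) (hσ : MemLp σ ⊤ (volume : Measure ℝ)) : L2R →L[ℂ] L2R :=
  ((ContinuousLinearMap.mul ℂ ℂ).holderL (volume : Measure ℝ) ⊤ 2 2 hσ.toLp) ∘L
    (Lp.compMeasurePreservingₗᵢ ℂ Neg.neg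
      (Measure.measurePreserving_neg (volume : Measure ℝ))).toContinuousLinearMap

lemma inner_hankelLp {σ : ℝ → ℂ} (hσ : MemLp σ ⊤ (volume : Measure ℝ)) (v w : L2R) :
    inner ℂ v (hankelLp σ hσ w) = ∫ x : ℝ, σ x * w (-x) * conj (v x) := by
  rw [L2_inner_eq]
  refine integral_congr_ae ?_
  have h1 := (ContinuousLinearMap.mul ℂ ℂ).coeFn_holder (r := 2) hσ.toLp
    (Lp.compMeasurePreserving Neg.neg (Measure.measurePreserving_neg (volume : Measure ℝ)) w)
  have h2 := Lp.coeFn_compMeasurePreserving w (Measure.measurePreserving_neg (volume : Measure ℝ))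
  filter_upwards [h1, h2, hσ.coeFn_toLp] with x h1 h2 h3
  have h4 : (hankelLp σ hσ w) x = σ x * w (-x) := by
    refine h1.trans ?_
    rw [h2, h3]
    rfl
  rw [h4]
  ring

lemma exists_isHankelOperator {σ : ℝ → ℂ} (hσ : MemLp σ ⊤ (volume : Measure ℝ)) :
    ∃ H : hardySpace →L[ℂ] hardySpace, IsHankelOperator σ H := by
  refine ⟨hardySpace.orthogonalProjectionOnto ∘L hankelLp σ hσ ∘L hardySpace.subtypeL,
    hσ, fun w => ?_⟩
  rw [← inner_hankelLp hσ]
  exact Submodule.inner_orthogonalProjectionOnto_eq_of_mem_left w _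

/-- By complex polarization the quadratic form determines the operator, so H is the compression of
`hankelLp` to the Hardy space. -/
lemma IsHankelOperator.inner_eq {σ : ℝ → ℂ} {H : hardySpace →L[ℂ] hardySpace}
    (hH : IsHankelOperator σ H) (v w : hardySpace) :
    inner ℂ v (H w) = inner ℂ (v : L2R) (hankelLp σ hH.memLp_symbol w) := by
  set T : hardySpace →ₗ[ℂ] hardySpace := (H : hardySpace →ₗ[ℂ] hardySpace) -
    ((hardySpace.orthogonalProjectionOnto ∘L hankelLp σ hH.memLp_symbol ∘L hardySpace.subtypeL :
      hardySpace →L[ℂ] hardySpace) : hardySpace →ₗ[ℂ] hardySpace) with hT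
  have hproj : ∀ u v : hardySpace, inner ℂ u (hardySpace.orthogonalProjectionOnto
      (hankelLp σ hH.memLp_symbol v)) = inner ℂ (u : L2R) (hankelLp σ hH.memLp_symbol v) :=
    fun u v => Submodule.inner_orthogonalProjectionOnto_eq_of_mem_left u _
  have h0 : T = 0 := by
    rw [← inner_map_self_eq_zero]
    intro x
    rw [← inner_conj_symm]
    have h1 : inner ℂ x (T x) = inner ℂ x (H x) - inner ℂ x (hardySpace.orthogonalProjectionOnto
      (hankelLp σ hH.memLp_symbol x)) := inner_sub_right _ _ _
    rw [h1, hproj, inner_hankelLp, hH.form_eq, sub_self, map_zero]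
  have h2 : T w = 0 := by rw [h0, LinearMap.zero_apply]
  have h3 : H w = hardySpace.orthogonalProjectionOnto (hankelLp σ hH.memLp_symbol w) :=
    sub_eq_zero.1 h2
  rw [h3, hproj]

/-- The coefficients of the expansion of `Q(x) (a - i x)^{-n-1}` in powers of `(a - i x)^{-1}`. -/
def symbolCoeff (a : ℂ) (n : ℕ) (Q : ℂ[X]) (k : ℕ) : ℂ :=
  I ^ (n - k) * (Polynomial.taylor (-I * a) Q).coeff (n - k)

lemma symbolCoeff_self (a : ℂ) (n : ℕ) (Q : ℂ[X]) : symbolCoeff a n Q n = Q.eval (-I * a) := by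
  simp [symbolCoeff, Polynomial.taylor_coeff_zero]

lemma eval_div_eq_sum_cauchyKernel {a : ℂ} (ha : 0 < a.re) {n : ℕ} {Q : ℂ[X]}
    (hQ : Q.natDegree ≤ n) (x : ℝ) :
    Q.eval (x : ℂ) / (a - I * (x : ℂ)) ^ (n + 1) =
      ∑ k ∈ Finset.range (n + 1), symbolCoeff a n Q k * cauchyKernel a k x := by
  have h0 := sub_I_mul_ne_zero ha x
  -- Taylor expansion of Q at -ia, where x + ia = i(a - ix).
  have h1 : Q.eval (x : ℂ) = ∑ j ∈ Finset.range (n + 1),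
      (Polynomial.taylor (-I * a) Q).coeff j * (I * (a - I * x)) ^ j := by
    rw [← Polynomial.eval_eq_sum_range' (by rw [Polynomial.natDegree_taylor]; omega),
      Polynomial.taylor_eval]
    congr 1
    ring_nf
    simp
  rw [h1, ← Finset.sum_range_reflect, Finset.sum_div]
  refine Finset.sum_congr rfl fun k hk => ?_
  have hk : k ≤ n := by
    have := Finset.mem_range.1 hk
    omega
  have h2 : n + 1 - 1 - k = n - k := by omega
  have h3 : n + 1 = (n - k) + (k + 1) := by omega
  rw [h2, symbolCoeff, cauchyKernel, mul_pow]
  conv_lhs => rw [h3, pow_add]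
  field_simp

variable {M : ℕ}

lemma rationalSymbol_eq {α : Fin M → ℂ} {K : Fin M → ℕ} {Q : Fin M → ℂ[X]}
    (hα : ∀ m, 0 < (α m).re) (hdeg : ∀ m, (Q m).natDegree ≤ K m) (x : ℝ) :
    rationalSymbol α K Q x = ∑ m, ∑ k ∈ Finset.range (K m + 1),
      symbolCoeff (α m) (K m) (Q m) k * cauchyKernel (α m) k x :=
  Finset.sum_congr rfl fun m _ => eval_div_eq_sum_cauchyKernel (hα m) (hdeg m) x

lemma memLp_top_carlemanSymbol : MemLp carlemanSymbol ⊤ (volume : Measure ℝ) :=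
  memLp_top_of_bound measurable_carlemanSymbol.aestronglyMeasurable Real.pi
    (Eventually.of_forall norm_carlemanSymbol_le)

lemma memLp_top_cauchyKernel {a : ℂ} (ha : 0 < a.re) (k : ℕ) :
    MemLp (cauchyKernel a k) ⊤ (volume : Measure ℝ) :=
  memLp_top_of_bound (continuous_cauchyKernel ha k).aestronglyMeasurable _
    (Eventually.of_forall (norm_cauchyKernel_le ha k))

lemma memLp_top_symbol {α : Fin M → ℂ} {K : Fin M → ℕ} {Q : Fin M → ℂ[X]}
    (hα : ∀ m, 0 < (α m).re) (hdeg : ∀ m, (Q m).natDegree ≤ K m) :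
    MemLp (fun x => carlemanSymbol x + rationalSymbol α K Q x) ⊤ (volume : Measure ℝ) := by
  have h : rationalSymbol α K Q = fun x => ∑ m, ∑ k ∈ Finset.range (K m + 1),
      symbolCoeff (α m) (K m) (Q m) k * cauchyKernel (α m) k x :=
    funext (rationalSymbol_eq hα hdeg)
  rw [h]
  refine memLp_top_carlemanSymbol.add ?_
  exact memLp_finsetSum _ fun m _ => memLp_finsetSum _ fun k _ =>
    (memLp_top_cauchyKernel (hα m) k).const_mul _

/-- The Hermitian form in the jets at the points `α m` that corresponds to the rational symbol with
coefficients `κ`. -/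
def jetForm (α : Fin M → ℂ) (K : Fin M → ℕ) (κ : Fin M → ℕ → ℂ) (x y : ℂ → ℕ → ℂ) : ℂ :=
  ∑ m, ∑ k ∈ Finset.range (K m + 1), κ m k *
    ∑ p ∈ Finset.HasAntidiagonal.antidiagonal k, x (α m) p.1 * conj (y (conj (α m)) p.2)

lemma jetForm_add_left (α : Fin M → ℂ) (K : Fin M → ℕ) (κ : Fin M → ℕ → ℂ) (x x' y : ℂ → ℕ → ℂ) :
    jetForm α K κ (x + x') y = jetForm α K κ x y + jetForm α K κ x' y := by
  simp only [jetForm, Pi.add_apply, add_mul, Finset.sum_add_distrib, mul_add]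

lemma jetForm_add_right (α : Fin M → ℂ) (K : Fin M → ℕ) (κ : Fin M → ℕ → ℂ) (x y y' : ℂ → ℕ → ℂ) :
    jetForm α K κ x (y + y') = jetForm α K κ x y + jetForm α K κ x y' := by
  simp only [jetForm, Pi.add_apply, map_add, Finset.sum_add_distrib, mul_add]

lemma jetForm_smul_left (α : Fin M → ℂ) (K : Fin M → ℕ) (κ : Fin M → ℕ → ℂ) (z : ℂ)
    (x y : ℂ → ℕ → ℂ) : jetForm α K κ (z • x) y = z * jetForm α K κ x y := by
  simp only [jetForm, Pi.smul_apply, smul_eq_mul, Finset.mul_sum]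
  refine Finset.sum_congr rfl fun m _ => Finset.sum_congr rfl fun k _ =>
    Finset.sum_congr rfl fun p _ => ?_
  ring

lemma jetForm_smul_right (α : Fin M → ℂ) (K : Fin M → ℕ) (κ : Fin M → ℕ → ℂ) (z : ℂ)
    (x y : ℂ → ℕ → ℂ) : jetForm α K κ x (z • y) = conj z * jetForm α K κ x y := by
  simp only [jetForm, Pi.smul_apply, smul_eq_mul, Finset.mul_sum, map_mul]
  refine Finset.sum_congr rfl fun m _ => Finset.sum_congr rfl fun k _ =>
    Finset.sum_congr rfl fun p _ => ?_
  ring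

/-- All jets of a combination of kernels. -/
def jets (c : PosReal →₀ ℂ) : ℂ → ℕ → ℂ := fun a k => jet a k c

lemma jets_add (c d : PosReal →₀ ℂ) : jets (c + d) = jets c + jets d := by
  funext a k
  exact map_add _ _ _

lemma jets_smul (z : ℂ) (c : PosReal →₀ ℂ) : jets (z • c) = z • jets c := by
  funext a k
  exact map_smul _ _ _

lemma single_eq_smul_one (b : PosReal) (z : ℂ) :
    Finsupp.single b z = z • Finsupp.single b 1 := by simp

/-- The Hankel form on combinations of kernels. -/
theorem inner_kernelComb_hankelLp {α : Fin M → ℂ} {K : Fin M → ℕ} {Q : Fin M → ℂ[X]}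
    (hα : ∀ m, 0 < (α m).re) (hdeg : ∀ m, (Q m).natDegree ≤ K m)
    (hσ : MemLp (fun x => carlemanSymbol x + rationalSymbol α K Q x) ⊤ (volume : Measure ℝ))
    (c d : PosReal →₀ ℂ) :
    inner ℂ (kernelComb d) (hankelLp _ hσ (kernelComb c)) =
      2 * Real.pi * (inner ℂ (stieltjesComb d) (stieltjesComb c) +
        jetForm α K (fun m => symbolCoeff (α m) (K m) (Q m)) (jets c) (jets d)) := by
  induction c using Finsupp.induction_linear with
  | zero =>
    have : jets (0 : PosReal →₀ ℂ) = 0 := by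
      funext a k
      exact map_zero _
    simp [this, jetForm]
  | add c c' h1 h2 =>
    rw [map_add, map_add, inner_add_right, h1, h2, map_add, inner_add_right, jets_add,
      jetForm_add_left]
    ring
  | single b z =>
    induction d using Finsupp.induction_linear with
    | zero =>
      have : jets (0 : PosReal →₀ ℂ) = 0 := by
        funext a k
        exact map_zero _
      simp [this, jetForm]
    | add d d' h1 h2 =>
      rw [map_add, inner_add_left, h1, h2, map_add, inner_add_left, jets_add, jetForm_add_right]
      ring
    | single g u =>
      rw [single_eq_smul_one b, single_eq_smul_one g]
      simp only [map_smul, inner_smul_left, inner_smul_right, jets_smul, jetForm_smul_left,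
        jetForm_smul_right]
      -- Both sides are sesquilinear, so a pair of single kernels is enough; there the integrals are
      -- explicit.
      suffices h : inner ℂ (kernelComb (Finsupp.single g 1))
          (hankelLp _ hσ (kernelComb (Finsupp.single b 1))) =
          2 * Real.pi * (inner ℂ (stieltjesComb (Finsupp.single g 1))
            (stieltjesComb (Finsupp.single b 1)) +
            jetForm α K (fun m => symbolCoeff (α m) (K m) (Q m)) (jets (Finsupp.single b 1))
              (jets (Finsupp.single g 1))) by
        rw [h]
        ring
      have hb : 0 < ((b : ℝ) : ℂ).re := by simpa using b.2
      have hg : 0 < ((g : ℝ) : ℂ).re := by simpa using g.2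
      set k₀ : ℝ → ℂ := fun x => 1 / (((b : ℝ) : ℂ) + I * x) ^ 1 *
        (1 / (((g : ℝ) : ℂ) + I * x) ^ 1) with hk₀
      have e1 : inner ℂ (kernelComb (Finsupp.single g 1))
          (hankelLp _ hσ (kernelComb (Finsupp.single b 1))) =
          ∫ x : ℝ, (carlemanSymbol x + rationalSymbol α K Q x) * k₀ x := by
        rw [inner_hankelLp]
        refine integral_congr_ae ?_
        have hneg := (Measure.measurePreserving_neg (volume : Measure ℝ)).quasiMeasurePreserving.ae
          (coeFn_kernelLp hb 0)
        filter_upwards [coeFn_kernelLp hg 0, hneg] with x h1 h2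
        simp only [kernelComb, Finsupp.linearCombination_single, one_smul]
        rw [h1, h2, conj_cauchyKernel, cauchyKernel_neg, conj_ofReal, hk₀]
        ring
      have hk₀i : Integrable k₀ := integrable_mul_of_memLp (memLp_cauchyKernel_neg hb 0)
        (memLp_cauchyKernel_neg hg 0)
      have i1 : Integrable (fun x => carlemanSymbol x * k₀ x) :=
        hk₀i.bdd_mul measurable_carlemanSymbol.aestronglyMeasurable
          (Eventually.of_forall norm_carlemanSymbol_le)
      have i2 : ∀ m k, Integrable (fun x => cauchyKernel (α m) k x * k₀ x) := fun m k =>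
        integrable_cauchyKernel_mul (hα m) hb hg k
      have e2 : ∀ x : ℝ, (carlemanSymbol x + rationalSymbol α K Q x) * k₀ x =
          carlemanSymbol x * k₀ x + ∑ m, ∑ k ∈ Finset.range (K m + 1),
            symbolCoeff (α m) (K m) (Q m) k * (cauchyKernel (α m) k x * k₀ x) := by
        intro x
        rw [rationalSymbol_eq hα hdeg, add_mul, Finset.sum_mul]
        simp only [Finset.sum_mul, mul_assoc]
      have e3 : inner ℂ (stieltjesComb (Finsupp.single g 1)) (stieltjesComb (Finsupp.single b 1)) =
          ∫ s in Set.Ioi (0 : ℝ), 1 / ((s : ℂ) + (b : ℝ)) * (1 / ((s : ℂ) + (g : ℝ))) := by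
        simp only [stieltjesComb, Finsupp.linearCombination_single, one_smul]
        rw [L2_inner_eq]
        refine integral_congr_ae ?_
        filter_upwards [(memLp_stieltjes b.2).coeFn_toLp, (memLp_stieltjes g.2).coeFn_toLp] with
          s h1 h2
        rw [h1, h2]
        simp
        ring
      rw [e1]
      simp only [e2]
      rw [integral_add i1 (integrable_finsetSum _ fun m _ => integrable_finsetSum _ fun k _ =>
        (i2 m k).const_mul _), integral_carlemanSymbol_mul b.2 g.2, e3, mul_add]
      congr 1
      rw [integral_finsetSum _ fun m _ => integrable_finsetSum _ fun k _ => (i2 m k).const_mul _,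
        jetForm, Finset.mul_sum]
      refine Finset.sum_congr rfl fun m _ => ?_
      rw [integral_finsetSum _ fun k _ => (i2 m k).const_mul _, Finset.mul_sum]
      refine Finset.sum_congr rfl fun k _ => ?_
      rw [integral_const_mul, integral_cauchyKernel_mul (hα m) hb hg]
      simp only [jets, jet, Finsupp.linearCombination_single, one_smul]
      rw [mul_left_comm]
      congr 2
      refine Finset.sum_congr rfl fun p _ => ?_
      simp

/-- The continuous extension of the jets from combinations of kernels. -/
def hardyJet (a : ℂ) (k : ℕ) : L2R →L[ℂ] ℂ :=
  if ha : 0 < a.re then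
    (1 / (2 * Real.pi) : ℂ) • innerSL ℂ (kernelLp (conj a) (conj_re_pos ha) k)
  else 0

lemma hardyJet_kernelComb {a : ℂ} (ha : 0 < a.re) (k : ℕ) (c : PosReal →₀ ℂ) :
    hardyJet a k (kernelComb c) = jet a k c := by
  have hpi : (Real.pi : ℂ) ≠ 0 := by exact_mod_cast Real.pi_ne_zero
  rw [hardyJet, dif_pos ha, smul_apply, innerSL_apply_apply,
    inner_kernelLp_kernelComb ha, smul_eq_mul]
  field_simp

/-- The Hankel form on the Hardy space is bounded below by the form in the jets. -/
theorem jetForm_le_hankelLp {α : Fin M → ℂ} {K : Fin M → ℕ} {Q : Fin M → ℂ[X]}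
    (hα : ∀ m, 0 < (α m).re) (hdeg : ∀ m, (Q m).natDegree ≤ K m)
    (hσ : MemLp (fun x => carlemanSymbol x + rationalSymbol α K Q x) ⊤ (volume : Measure ℝ))
    (w : hardySpace) :
    (2 * Real.pi * jetForm α K (fun m => symbolCoeff (α m) (K m) (Q m))
      (fun a k => hardyJet a k w) (fun a k => hardyJet a k w)).re ≤
      (inner ℂ (w : L2R) (hankelLp _ hσ w)).re := by
  -- Both sides are continuous in w, so the inequality may be checked on kernel combinations, where
  -- the difference is 2π times the squared norm on the half-axis.
  have hclosed : IsClosed {w : L2R | (2 * Real.pi * jetForm α K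
      (fun m => symbolCoeff (α m) (K m) (Q m))
      (fun a k => hardyJet a k w) (fun a k => hardyJet a k w)).re ≤
      (inner ℂ w (hankelLp _ hσ w)).re} := by
    refine isClosed_le ?_ ?_
    · unfold jetForm
      have : Continuous (conj : ℂ → ℂ) := Complex.continuous_conj
      fun_prop
    · fun_prop
  have hw : (w : L2R) ∈ (LinearMap.range kernelComb).topologicalClosure :=
    hardySpace_eq_closure ▸ w.2
  refine closure_minimal ?_ hclosed hw
  rintro _ ⟨c, rfl⟩
  have h1 : jetForm α K (fun m => symbolCoeff (α m) (K m) (Q m))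
      (fun a k => hardyJet a k (kernelComb c)) (fun a k => hardyJet a k (kernelComb c)) =
      jetForm α K (fun m => symbolCoeff (α m) (K m) (Q m)) (jets c) (jets c) := by
    unfold jetForm jets
    refine Finset.sum_congr rfl fun m _ => Finset.sum_congr rfl fun k _ => ?_
    congr 1
    refine Finset.sum_congr rfl fun p _ => ?_
    beta_reduce
    rw [hardyJet_kernelComb (hα m), hardyJet_kernelComb (conj_re_pos (hα m))]
  rw [Set.mem_ofPred_eq]
  rw [h1, inner_kernelComb_hankelLp hα hdeg hσ, mul_add, add_re, inner_self_eq_ofReal_norm_sq]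
  have h2 : (2 * Real.pi * ((‖stieltjesComb c‖ ^ 2 : ℝ) : ℂ)).re =
      2 * Real.pi * ‖stieltjesComb c‖ ^ 2 := by
    norm_cast
  rw [h2]
  have := Real.pi_pos
  have : 0 ≤ 2 * Real.pi * ‖stieltjesComb c‖ ^ 2 := by positivity
  linarith

end Forms

/-! ### Negative index of a nondegenerate Hermitian matrix -/

section DiagonalForms

variable {S : Type} [Fintype S]

lemma dotProduct_mulVec_sum_smul {ι : Type} [Fintype ι] [DecidableEq ι] {G : Matrix S S ℂ}
    {u : ι → S → ℂ} {l : ι → ℝ}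
    (h : ∀ i j, star (u i) ⬝ᵥ G.mulVec (u j) = if i = j then (l i : ℂ) else 0) (z : ι → ℂ) :
    star (∑ i, z i • u i) ⬝ᵥ G.mulVec (∑ i, z i • u i) = ((∑ i, l i * ‖z i‖ ^ 2 : ℝ) : ℂ) := by
  have h1 : G.mulVec (∑ i, z i • u i) = ∑ i, z i • G.mulVec (u i) := by
    rw [← Matrix.mulVecLin_apply, map_sum]
    simp
  rw [h1, star_sum, sum_dotProduct]
  simp only [dotProduct_sum, star_smul, smul_dotProduct, dotProduct_smul, h, smul_eq_mul]
  push_cast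
  refine Finset.sum_congr rfl fun i _ => ?_
  simp only [mul_ite, mul_zero, Finset.sum_ite_eq, Finset.mem_univ, if_true]
  rw [← Complex.mul_conj']
  simp only [RCLike.star_def]
  ring

/-- A nondegenerate Hermitian form that is nonpositive on the kernel of `R` has a diagonal negative
part of dimension at least the nullity of `R`. -/
theorem exists_negative_diagonal [DecidableEq S] {G : Matrix S S ℂ} (hG : G.IsHermitian)
    (hnd : ∀ ξ, G.mulVec ξ = 0 → ξ = 0) {T : Type} [Fintype T] (R : (S → ℂ) →ₗ[ℂ] (T → ℂ))
    (hR : ∀ ξ, R ξ = 0 → (star ξ ⬝ᵥ G.mulVec ξ).re ≤ 0) :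
    ∃ (ι : Finset S) (u : ι → S → ℂ) (l : ι → ℝ), (∀ i, l i < 0) ∧
      (∀ i j, star (u i) ⬝ᵥ G.mulVec (u j) = if i = j then (l i : ℂ) else 0) ∧
      Fintype.card S ≤ Fintype.card T + Fintype.card ι := by
  classical
  set v : S → S → ℂ := fun i => (hG.eigenvectorBasis i).ofLp with hv
  have horth : ∀ i j, star (v i) ⬝ᵥ v j = if i = j then 1 else 0 := fun i j => by
    have := orthonormal_iff_ite.1 hG.eigenvectorBasis.orthonormal i j
    rw [EuclideanSpace.inner_eq_star_dotProduct] at this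
    rw [dotProduct_comm]
    exact this
  have hform : ∀ i j, star (v i) ⬝ᵥ G.mulVec (v j) =
      if i = j then (hG.eigenvalues i : ℂ) else 0 := fun i j => by
    rw [hv, hG.mulVec_eigenvectorBasis j]
    have : star (hG.eigenvectorBasis i).ofLp ⬝ᵥ (hG.eigenvectorBasis j).ofLp = _ := horth i j
    rw [dotProduct_smul, this]
    split_ifs with hij
    · subst hij
      simp
    · simp
  have hne : ∀ i, hG.eigenvalues i ≠ 0 := fun i hi => by
    have h1 : G.mulVec (v i) = 0 := by
      rw [hv, hG.mulVec_eigenvectorBasis i, hi, zero_smul]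
    have h2 := horth i i
    rw [hnd _ h1] at h2
    simp at h2
  -- R is injective on the span of the eigenvectors with positive eigenvalue, since the form is
  -- positive there and nonpositive on ker R. As 0 is not an eigenvalue, all the others are
  -- negative.
  have hpos : Fintype.card {i // 0 < hG.eigenvalues i} ≤ Fintype.card T := by
    have hinj : Function.Injective (R ∘ₗ Fintype.linearCombination ℂ
        (fun i : {i // 0 < hG.eigenvalues i} => v i)) := by
      rw [injective_iff_map_eq_zero]
      intro z hz
      have h1 := hR _ hz
      have h0 := dotProduct_mulVec_sum_smul (G := G)
        (u := fun i : {i // 0 < hG.eigenvalues i} => v i) (l := fun i => hG.eigenvalues i)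
        (fun i j => ?_) z
      · rw [Fintype.linearCombination_apply, h0, ofReal_re] at h1
        have h2 : ∀ i ∈ Finset.univ, 0 ≤
            (fun i : {i // 0 < hG.eigenvalues i} => hG.eigenvalues i * ‖z i‖ ^ 2) i :=
          fun i _ => mul_nonneg i.2.le (sq_nonneg _)
        have h3 := (Finset.sum_eq_zero_iff_of_nonneg h2).1 (le_antisymm h1 (Finset.sum_nonneg h2))
        funext i
        have h4 := h3 i (Finset.mem_univ _)
        simpa [i.2.ne'] using h4
      · rw [hform]
        simp only [Subtype.ext_iff]
    simpa using LinearMap.finrank_le_finrank_of_injective hinj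
  refine ⟨Finset.univ.filter fun i => hG.eigenvalues i < 0, fun i => v i,
    fun i => hG.eigenvalues i, fun i => (Finset.mem_filter.1 i.2).2, fun i j => ?_, ?_⟩
  · rw [hform]
    simp only [Subtype.ext_iff]
  · have h1 : Fintype.card {i // 0 < hG.eigenvalues i} =
        (Finset.univ.filter fun i => ¬ hG.eigenvalues i < 0).card := by
      rw [Fintype.card_subtype]
      congr 1
      ext i
      simp only [Finset.mem_filter, Finset.mem_univ, true_and, not_lt]
      exact ⟨le_of_lt, fun h => lt_of_le_of_ne h (hne i).symm⟩
    rw [Fintype.card_coe]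
    have h2 := Finset.card_filter_add_card_filter_not (s := (Finset.univ : Finset S))
      (fun i => hG.eigenvalues i < 0)
    rw [Finset.card_univ] at h2
    omega

end DiagonalForms

/-! ### The block Hankel matrix of the jet form -/

section HankelMatrix

variable {M : ℕ}

/-- The block matrix with upper left triangular Hankel blocks in the positions `(τ m, m)`. -/
def hankelMatrix (K : Fin M → ℕ) (τ : Fin M → Fin M) (κ : Fin M → ℕ → ℂ) :
    Matrix (Σ m, Fin (K m + 1)) (Σ m, Fin (K m + 1)) ℂ := Matrix.of fun t s =>
  if t.1 = τ s.1 ∧ (s.2 + t.2 : ℕ) ≤ K s.1 then κ s.1 (s.2 + t.2) else 0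

/-- The symmetry of the coefficients `κ` under the conjugation `τ` of the points with imaginary
parts `e`. -/
structure ConjSymmetric (K : Fin M → ℕ) (τ : Fin M → Fin M) (κ : Fin M → ℕ → ℂ)
    (e : Fin M → ℝ) : Prop where
  invol : ∀ m, τ (τ m) = m
  order_eq : ∀ m, K (τ m) = K m
  coeff_eq : ∀ m k, k ≤ K m → κ (τ m) k = conj (κ m k)
  im_eq : ∀ m, e (τ m) = -e m
  fixed : ∀ m, e m = 0 → τ m = m
  lead_ne : ∀ m, κ m (K m) ≠ 0

variable {K : Fin M → ℕ} {τ : Fin M → Fin M} {κ : Fin M → ℕ → ℂ} {e : Fin M → ℝ}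

lemma ConjSymmetric.neg (h : ConjSymmetric K τ κ e) : ConjSymmetric K τ (-κ) (-e) where
  invol := h.invol
  order_eq := h.order_eq
  coeff_eq m k hk := by simp [h.coeff_eq m k hk]
  im_eq m := by simp [h.im_eq]
  fixed m hm := h.fixed m (by simpa using hm)
  lead_ne m := by simpa using h.lead_ne m

lemma hankelMatrix_neg : hankelMatrix K τ (-κ) = -hankelMatrix K τ κ := by
  ext t s
  simp only [hankelMatrix, Matrix.of_apply, Matrix.neg_apply, Pi.neg_apply]
  split_ifs <;> simp

lemma ConjSymmetric.isHermitian (h : ConjSymmetric K τ κ e) : (hankelMatrix K τ κ).IsHermitian := by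
  ext t s
  simp only [hankelMatrix, Matrix.conjTranspose_apply, Matrix.of_apply]
  have h1 : (s.1 = τ t.1 ∧ (t.2 + s.2 : ℕ) ≤ K t.1) ↔ (t.1 = τ s.1 ∧ (s.2 + t.2 : ℕ) ≤ K s.1) := by
    constructor
    · rintro ⟨h1, h2⟩
      have h3 : K s.1 = K t.1 := by rw [h1, h.order_eq]
      exact ⟨by rw [h1, h.invol], by omega⟩
    · rintro ⟨h1, h2⟩
      have h3 : K t.1 = K s.1 := by rw [h1, h.order_eq]
      exact ⟨by rw [h1, h.invol], by omega⟩
  by_cases h2 : t.1 = τ s.1 ∧ (s.2 + t.2 : ℕ) ≤ K s.1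
  · have h3 := h.coeff_eq s.1 _ h2.2
    rw [← h2.1] at h3
    rw [if_pos h2, if_pos (h1.2 h2), add_comm, h3]
    simp
  · rw [if_neg h2, if_neg (mt h1.1 h2), star_zero]

lemma ConjSymmetric.hankelMatrix_mulVec (ξ : (Σ m, Fin (K m + 1)) → ℂ) {m : Fin M}
    (h : ConjSymmetric K τ κ e) (j : Fin (K (τ m) + 1)) :
    (hankelMatrix K τ κ).mulVec ξ ⟨τ m, j⟩ =
      ∑ i : Fin (K m + 1), if (i + j : ℕ) ≤ K m then κ m (i + j) * ξ ⟨m, i⟩ else 0 := by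
  have hinj : Function.Injective τ := Function.LeftInverse.injective h.invol
  rw [Matrix.mulVec, dotProduct, Fintype.sum_sigma, Finset.sum_eq_single m]
  · refine Finset.sum_congr rfl fun i _ => ?_
    simp [hankelMatrix, ite_mul]
  · intro b _ hb
    refine Finset.sum_eq_zero fun i _ => ?_
    simp only [hankelMatrix, Matrix.of_apply]
    rw [if_neg (fun h => hb (hinj h.1).symm), zero_mul]
  · simp

/-- Row K m - n of block τ m involves only the entries ξ ⟨m, i⟩ with i ≤ n, and the entry i = n has
the nonzero leading coefficient; the system is triangular. -/
lemma ConjSymmetric.eq_zero_of_mulVec (h : ConjSymmetric K τ κ e)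
    (ξ : (Σ m, Fin (K m + 1)) → ℂ) (hξ : (hankelMatrix K τ κ).mulVec ξ = 0) : ξ = 0 := by
  have key : ∀ m, ∀ n, ∀ hn : n < K m + 1, ξ ⟨m, ⟨n, hn⟩⟩ = 0 := by
    intro m n
    induction n using Nat.strong_induction_on with
    | _ n ih =>
      intro hn
      have h1 := h.hankelMatrix_mulVec ξ (m := m) ⟨K m - n, by rw [h.order_eq]; omega⟩
      rw [hξ, Pi.zero_apply, Finset.sum_eq_single (⟨n, hn⟩ : Fin (K m + 1))] at h1
      · have h2 : n + (K m - n) = K m := by omega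
        simp only [h2, le_refl, if_true] at h1
        exact (mul_eq_zero.1 h1.symm).resolve_left (h.lead_ne m)
      · intro i _ hi
        have hi' : (i : ℕ) ≠ n := fun h => hi (Fin.ext h)
        split_ifs with h3
        · rw [ih i (by simp only at h3; omega) i.2, mul_zero]
        · rfl
      · simp
  funext s
  exact key s.1 s.2 s.2.2

/-- The contribution of the point with imaginary part `e m` to the negative index. -/
def negJetCount (K : Fin M → ℕ) (κ : Fin M → ℕ → ℂ) (e : Fin M → ℝ) (m : Fin M) : ℕ :=
  if e m = 0 then negIndex (K m) (κ m (K m)).re else if 0 < e m then K m + 1 else 0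

lemma negIndex_le (k : ℕ) (p : ℝ) : negIndex k p ≤ k + 1 := by
  unfold negIndex
  split_ifs <;> omega

lemma negIndex_add_negIndex_neg (k : ℕ) {p : ℝ} (hp : p ≠ 0) :
    negIndex k p + negIndex k (-p) = k + 1 := by
  unfold negIndex
  by_cases hk : Odd k
  · obtain ⟨r, rfl⟩ := hk
    simp only [odd_two_mul_add_one, if_true]
    omega
  · obtain ⟨r, rfl⟩ := Nat.not_odd_iff_even.1 hk
    rw [if_neg hk, if_neg hk]
    rcases lt_or_gt_of_ne hp with h | h
    · rw [if_neg h.not_gt, if_pos (by linarith)]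
      omega
    · rw [if_pos h, if_neg (by linarith)]
      omega

lemma negJetCount_le (m : Fin M) : negJetCount K κ e m ≤ K m + 1 := by
  unfold negJetCount
  split_ifs
  · exact negIndex_le _ _
  · exact le_rfl
  · exact Nat.zero_le _

lemma ConjSymmetric.lead_im (h : ConjSymmetric K τ κ e) {m : Fin M} (hm : e m = 0) :
    (κ m (K m)).im = 0 := by
  have h1 := h.coeff_eq m (K m) le_rfl
  rw [h.fixed m hm] at h1
  exact conj_eq_iff_im.1 h1.symm

/-- Complementarity of the counts for the form and for its negative; it makes the two one-sided
bounds on the index match. -/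
lemma ConjSymmetric.negJetCount_add (h : ConjSymmetric K τ κ e) (m : Fin M) :
    negJetCount K κ e m + negJetCount K (-κ) (-e) m = K m + 1 := by
  unfold negJetCount
  by_cases hm : e m = 0
  · have h2 : (κ m (K m)).re ≠ 0 := fun h0 => h.lead_ne m (Complex.ext h0 (h.lead_im hm))
    simp only [Pi.neg_apply, hm, neg_zero, if_true, neg_re]
    exact negIndex_add_negIndex_neg _ h2
  · simp only [Pi.neg_apply, hm, neg_eq_zero, if_false]
    rcases lt_or_gt_of_ne hm with h1 | h1
    · rw [if_neg h1.not_gt, if_pos (by linarith)]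
      omega
    · rw [if_pos h1, if_neg (by linarith)]

/-- Only entries with i + j ≤ K m survive in the blocks. For nonreal points one of m, τ m has
positive imaginary part and all its coordinates are zero. For a real point i and j are at least
`negJetCount`, which forces i + j > K m, except when K m is even and the leading coefficient
positive; then i = j = K m / 2 remains and contributes that coefficient times |ξ|². -/
lemma ConjSymmetric.form_nonneg (h : ConjSymmetric K τ κ e) (ξ : (Σ m, Fin (K m + 1)) → ℂ)
    (hξ : ∀ s, (s.2 : ℕ) < negJetCount K κ e s.1 → ξ s = 0) :
    0 ≤ (star ξ ⬝ᵥ (hankelMatrix K τ κ).mulVec ξ).re := by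
  simp only [dotProduct, Matrix.mulVec, Finset.mul_sum, re_sum]
  refine Finset.sum_nonneg fun t _ => Finset.sum_nonneg fun s _ => ?_
  by_cases hs : ξ s = 0
  · simp [hs]
  by_cases ht : ξ t = 0
  · simp [ht]
  simp only [hankelMatrix, Matrix.of_apply]
  split_ifs with hts
  swap
  · simp
  obtain ⟨hts, hle⟩ := hts
  have hs' := mt (hξ s) hs
  have ht' := mt (hξ t) ht
  obtain ⟨m, i⟩ := s
  obtain ⟨m', j⟩ := t
  simp only at hts hle hs' ht'
  have hi := i.2
  have hj := j.2
  rcases lt_trichotomy (e m) 0 with hm | hm | hm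
  · have hm' : 0 < e m' := by rw [hts, h.im_eq]; linarith
    rw [negJetCount, if_neg hm'.ne', if_pos hm'] at ht'
    exact absurd hj ht'
  · have hmm : m' = m := by rw [hts, h.fixed m hm]
    subst hmm
    rw [negJetCount, if_pos hm, negIndex] at hs' ht'
    split_ifs at hs' ht' with h1 h2
    · obtain ⟨r, hr⟩ := h1
      omega
    · obtain ⟨r, hr⟩ := Nat.not_odd_iff_even.1 h1
      have hij : i = j := Fin.ext (by omega)
      subst hij
      have hk : (i + i : ℕ) = K m' := by omega
      rw [hk]
      have h3 : κ m' (K m') = ((κ m' (K m')).re : ℂ) :=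
        (Complex.ext rfl (by simpa using h.lead_im hm))
      have h4 : star ξ ⟨m', i⟩ * (κ m' (K m') * ξ ⟨m', i⟩) =
          (((κ m' (K m')).re * ‖ξ ⟨m', i⟩‖ ^ 2 : ℝ) : ℂ) := by
        push_cast
        rw [← h3, ← Complex.mul_conj']
        simp only [Pi.star_apply, RCLike.star_def]
        ring
      rw [h4, ofReal_re]
      positivity
    · obtain ⟨r, hr⟩ := Nat.not_odd_iff_even.1 h1
      omega
  · rw [negJetCount, if_neg hm.ne', if_pos hm] at hs'
    exact absurd hi hs'

end HankelMatrix

/-! ### Conjugation symmetry of the jet form and its matrix -/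

section NegativeIndex

variable {M : ℕ} {α : Fin M → ℂ} {K : Fin M → ℕ} {κ : Fin M → ℕ → ℂ}

lemma sum_antidiagonal_eq_sum_range_range {k n : ℕ} (hk : k < n) (f : ℕ → ℕ → ℂ) :
    ∑ p ∈ Finset.HasAntidiagonal.antidiagonal k, f p.1 p.2 =
      ∑ i ∈ Finset.range n, ∑ j ∈ Finset.range n, if i + j = k then f i j else 0 := by
  rw [← Finset.sum_product', ← Finset.sum_filter]
  refine Finset.sum_congr ?_ fun _ _ => rfl
  ext p
  simp only [Finset.HasAntidiagonal.mem_antidiagonal, Finset.mem_filter, Finset.mem_product, Finset.mem_range]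
  omega

lemma jetForm_eq_dotProduct {τ : Fin M → Fin M} {e : Fin M → ℝ} (h : ConjSymmetric K τ κ e)
    (hτ : ∀ m, α (τ m) = conj (α m)) (x y : ℂ → ℕ → ℂ) :
    jetForm α K κ x y =
      star (fun t : Σ m, Fin (K m + 1) => y (α t.1) t.2) ⬝ᵥ
        (hankelMatrix K τ κ).mulVec fun s => x (α s.1) s.2 := by
  have hinv : Function.Involutive τ := h.invol
  have h0 : ∀ F : Fin M → ℂ, ∑ m, F m = ∑ m, F (τ m) := fun F =>
    (Equiv.sum_comp hinv.toPerm F).symm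
  -- The second argument of the form is taken at conj (α m) = α (τ m). So the outer sum is reindexed
  -- by τ, and then k is replaced by i + j.
  rw [dotProduct, Fintype.sum_sigma, h0, jetForm]
  refine Finset.sum_congr rfl fun m _ => ?_
  rw [Finset.sum_congr rfl fun j _ => congrArg _
    (h.hankelMatrix_mulVec (fun s => x (α s.1) s.2) j)]
  simp only [Pi.star_apply]
  have h1 : ∀ j : ℕ, ∑ i : Fin (K m + 1),
      (if (i + j : ℕ) ≤ K m then κ m (i + j) * x (α m) i else 0) =
      ∑ i ∈ Finset.range (K m + 1), if i + j ≤ K m then κ m (i + j) * x (α m) i else 0 := fun j =>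
    Fin.sum_univ_eq_sum_range
      (fun i => if i + j ≤ K m then κ m (i + j) * x (α m) i else 0) (K m + 1)
  simp only [h1]
  rw [Fin.sum_univ_eq_sum_range (fun j => star (y (α (τ m)) j) *
    ∑ i ∈ Finset.range (K m + 1), if i + j ≤ K m then κ m (i + j) * x (α m) i else 0), h.order_eq,
    hτ]
  have h2 : ∀ k ∈ Finset.range (K m + 1), κ m k * ∑ p ∈ Finset.HasAntidiagonal.antidiagonal k,
      x (α m) p.1 * conj (y (conj (α m)) p.2) =
      ∑ i ∈ Finset.range (K m + 1), ∑ j ∈ Finset.range (K m + 1),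
        if i + j = k then κ m k * (x (α m) i * conj (y (conj (α m)) j)) else 0 := fun k hk => by
    rw [sum_antidiagonal_eq_sum_range_range (Finset.mem_range.1 hk)
      (fun i j => x (α m) i * conj (y (conj (α m)) j))]
    simp only [Finset.mul_sum, mul_ite, mul_zero]
  rw [Finset.sum_congr rfl h2, Finset.sum_comm]
  simp only [Finset.mul_sum]
  conv_rhs => rw [Finset.sum_comm]
  refine Finset.sum_congr rfl fun i _ => ?_
  rw [Finset.sum_comm]
  refine Finset.sum_congr rfl fun j _ => ?_
  rw [Finset.sum_ite_eq]
  by_cases hij : i + j ≤ K m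
  · rw [if_pos (by rw [Finset.mem_range]; omega), if_pos hij]
    simp only [RCLike.star_def]
    ring
  · rw [if_neg (by rw [Finset.mem_range]; omega), if_neg hij, mul_zero]

/-- The total coefficient of order `k` at the point `a`. -/
def pointCoeff (α : Fin M → ℂ) (K : Fin M → ℕ) (κ : Fin M → ℕ → ℂ) (a : ℂ) (k : ℕ) : ℂ :=
  ∑ m, if α m = a ∧ k ≤ K m then κ m k else 0

/-- The jets that vanish except for the one of order `k` at `a`. -/
def singleJet (a : ℂ) (k : ℕ) : ℂ → ℕ → ℂ := fun b j => if b = a ∧ j = k then 1 else 0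

lemma jetForm_singleJet (α : Fin M → ℂ) (K : Fin M → ℕ) (κ : Fin M → ℕ → ℂ) (a : ℂ) (i j : ℕ) :
    jetForm α K κ (singleJet a i) (singleJet (conj a) j) = pointCoeff α K κ a (i + j) := by
  unfold jetForm pointCoeff
  refine Finset.sum_congr rfl fun m _ => ?_
  have h1 : ∀ k, ∑ p ∈ Finset.HasAntidiagonal.antidiagonal k,
      singleJet a i (α m) p.1 * conj (singleJet (conj a) j (conj (α m)) p.2) =
      if k = i + j then (if α m = a then 1 else 0) else 0 := fun k => by
    by_cases hm : α m = a
    · by_cases hk : k = i + j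
      · rw [Finset.sum_eq_single (i, j)]
        · simp [singleJet, hm, hk]
        · rintro ⟨p, q⟩ hp hne
          simp only [Finset.HasAntidiagonal.mem_antidiagonal] at hp
          have : p ≠ i := fun hpi => hne (Prod.ext hpi (by simp only; omega))
          simp [singleJet, this]
        · simp [hk]
      · rw [if_neg hk]
        refine Finset.sum_eq_zero fun p hp => ?_
        rw [Finset.HasAntidiagonal.mem_antidiagonal] at hp
        by_cases hpi : p.1 = i
        · have : p.2 ≠ j := fun h => hk (by omega)
          simp [singleJet, this]
        · simp [singleJet, hpi]
    · simp [singleJet, hm]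
  simp only [h1]
  simp only [mul_ite, mul_one, mul_zero, Finset.sum_ite_eq', Finset.mem_range]
  by_cases hm : α m = a <;> simp [hm, Order.lt_add_one_iff]

lemma pointCoeff_apply (hinj : Function.Injective α) {m : Fin M} {k : ℕ} (hk : k ≤ K m) :
    pointCoeff α K κ (α m) k = κ m k := by
  rw [pointCoeff, Finset.sum_eq_single m]
  · simp [hk]
  · intro b _ hb
    rw [if_neg fun h => hb (hinj h.1)]
  · simp

/-- A Hermitian form in the jets comes from conjugation symmetric coefficients. -/
lemma exists_conjSymmetric (hinj : Function.Injective α) (hlead : ∀ m, κ m (K m) ≠ 0)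
    (hherm : ∀ x y, jetForm α K κ x y = conj (jetForm α K κ y x)) :
    ∃ τ : Fin M → Fin M, (∀ m, α (τ m) = conj (α m)) ∧
      ConjSymmetric K τ κ fun m => (α m).im := by
  -- Testing the Hermitian form on single jets isolates the coefficients. `pointCoeff` makes sense
  -- before the conjugate point is known to occur among the α m.
  have hc : ∀ a k, pointCoeff α K κ (conj a) k = conj (pointCoeff α K κ a k) := fun a k => by
    have h1 := jetForm_singleJet α K κ (conj a) 0 k
    have h2 := jetForm_singleJet α K κ a k 0
    rw [Complex.conj_conj, zero_add] at h1
    rw [add_zero] at h2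
    rw [← h1, ← h2, hherm]
  -- The leading coefficient is nonzero, so its conjugate must come from a term at the conjugate
  -- point of at least the same order; conjugating twice gives equal orders.
  have hex : ∀ m, ∃ m', α m' = conj (α m) ∧ K m ≤ K m' := fun m => by
    have h1 : pointCoeff α K κ (conj (α m)) (K m) ≠ 0 := by
      rw [hc, pointCoeff_apply hinj le_rfl]
      simpa using hlead m
    obtain ⟨m', -, h2⟩ := Finset.exists_ne_zero_of_sum_ne_zero h1
    exact ⟨m', of_not_not fun h => h2 (if_neg h)⟩
  choose τ hτ hK using hex
  have hinv : ∀ m, τ (τ m) = m := fun m => hinj (by rw [hτ, hτ, Complex.conj_conj])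
  have hKeq : ∀ m, K (τ m) = K m := fun m => by
    have h1 := hK m
    have h2 := hK (τ m)
    rw [hinv] at h2
    omega
  refine ⟨τ, hτ, hinv, hKeq, fun m k hk => ?_, fun m => by simp [hτ], fun m hm => ?_, hlead⟩
  · have hk' : k ≤ K (τ m) := by rwa [hKeq]
    rw [← pointCoeff_apply (κ := κ) hinj hk', hτ, hc, pointCoeff_apply hinj hk]
  · exact hinj (by rw [hτ, conj_eq_iff_im.2 hm])

lemma sum_negJetCount (e : Fin M → ℝ) :
    ∑ m, negJetCount K κ e m = (∑ m with e m = 0, negIndex (K m) (κ m (K m)).re)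
      + (∑ m with 0 < e m, K m) + (Finset.univ.filter fun m => 0 < e m).card := by
  rw [add_assoc, Finset.card_eq_sum_ones, ← Finset.sum_add_distrib, Finset.sum_filter,
    Finset.sum_filter, ← Finset.sum_add_distrib]
  refine Finset.sum_congr rfl fun m _ => ?_
  unfold negJetCount
  by_cases h1 : e m = 0
  · simp [h1]
  · simp [h1]

/-- The restriction of jets to the first `n m` entries. -/
def restrictJets (K n : Fin M → ℕ) (hn : ∀ m, n m ≤ K m + 1) :
    ((Σ m, Fin (K m + 1)) → ℂ) →ₗ[ℂ] ((Σ m, Fin (n m)) → ℂ) :=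
  LinearMap.funLeft ℂ ℂ fun s => ⟨s.1, Fin.castLE (hn s.1) s.2⟩

lemma apply_eq_zero_of_restrictJets {K n : Fin M → ℕ} {hn : ∀ m, n m ≤ K m + 1}
    {ξ : (Σ m, Fin (K m + 1)) → ℂ} (hξ : restrictJets K n hn ξ = 0) (s : Σ m, Fin (K m + 1))
    (hs : (s.2 : ℕ) < n s.1) : ξ s = 0 :=
  congrFun hξ ⟨s.1, ⟨s.2, hs⟩⟩

lemma kernelComb_mem_hardySpace (c : PosReal →₀ ℂ) : kernelComb c ∈ hardySpace := by
  rw [hardySpace_eq_closure]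
  exact Submodule.le_topologicalClosure _ (LinearMap.mem_range_self _ c)

/-- The combinations of kernels as elements of the Hardy space. -/
def hardyComb : (PosReal →₀ ℂ) →ₗ[ℂ] hardySpace :=
  kernelComb.codRestrict hardySpace kernelComb_mem_hardySpace

variable {Q : Fin M → ℂ[X]} {H : hardySpace →L[ℂ] hardySpace}

lemma inner_hardyComb (hα : ∀ m, 0 < (α m).re) (hdeg : ∀ m, (Q m).natDegree ≤ K m)
    (hH : IsHankelOperator (fun x => carlemanSymbol x + rationalSymbol α K Q x) H)
    (c d : PosReal →₀ ℂ) :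
    inner ℂ (hardyComb d) (H (hardyComb c)) =
      2 * Real.pi * (inner ℂ (stieltjesComb d) (stieltjesComb c) +
        jetForm α K (fun m => symbolCoeff (α m) (K m) (Q m)) (jets c) (jets d)) := by
  rw [hH.inner_eq]
  exact inner_kernelComb_hankelLp hα hdeg hH.memLp_symbol c d

lemma jetForm_congr {x x' y y' : ℂ → ℕ → ℂ}
    (hx : ∀ m, ∀ k ≤ K m, x (α m) k = x' (α m) k)
    (hy : ∀ m, ∀ k ≤ K m, y (conj (α m)) k = y' (conj (α m)) k) :
    jetForm α K κ x y = jetForm α K κ x' y' := by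
  refine Finset.sum_congr rfl fun m _ => Finset.sum_congr rfl fun k hk => ?_
  congr 1
  refine Finset.sum_congr rfl fun p hp => ?_
  rw [Finset.mem_range] at hk
  rw [Finset.HasAntidiagonal.mem_antidiagonal] at hp
  rw [hx m p.1 (by omega), hy m p.2 (by omega)]

lemma exists_comb_jet_of_points (hα : ∀ m, 0 < (α m).re) (K : Fin M → ℕ) (x : ℂ → ℕ → ℂ) {ε : ℝ}
    (hε : 0 < ε) :
    ∃ c, (∀ m, ∀ k ≤ K m, jets c (α m) k = x (α m) k) ∧
      (∀ m, ∀ k ≤ K m, jets c (conj (α m)) k = x (conj (α m)) k) ∧ ‖stieltjesComb c‖ < ε := by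
  classical
  obtain ⟨c, h1, h2⟩ := exists_comb_jet
    (Finset.univ.image α ∪ Finset.univ.image fun m => conj (α m)) (by
      intro a ha
      simp only [Finset.mem_union, Finset.mem_image, Finset.mem_univ, true_and] at ha
      rcases ha with ⟨m, rfl⟩ | ⟨m, rfl⟩
      · exact hα m
      · exact conj_re_pos (hα m)) (∑ m, K m + 1) x hε
  have hK : ∀ m, ∀ k ≤ K m, k < ∑ m, K m + 1 := fun m k hk => by
    have := Finset.single_le_sum (f := K) (fun _ _ => Nat.zero_le _) (Finset.mem_univ m)
    omega
  exact ⟨c, fun m k hk => h1 _ (by simp) k (hK m k hk), fun m k hk => h1 _ (by simp) k (hK m k hk),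
    h2⟩

/-- Self-adjointness concerns jets of functions only, but every jet at the finitely many relevant
points is attained by a kernel combination. The Carleman part is Hermitian and cancels. -/
lemma jetForm_hermitian (hα : ∀ m, 0 < (α m).re) (hdeg : ∀ m, (Q m).natDegree ≤ K m)
    (hH : IsHankelOperator (fun x => carlemanSymbol x + rationalSymbol α K Q x) H)
    (hsymm : (H : hardySpace →ₗ[ℂ] hardySpace).IsSymmetric) (x y : ℂ → ℕ → ℂ) :
    jetForm α K (fun m => symbolCoeff (α m) (K m) (Q m)) x y =
      conj (jetForm α K (fun m => symbolCoeff (α m) (K m) (Q m)) y x) := by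
  obtain ⟨c, hc1, hc2, -⟩ := exists_comb_jet_of_points hα K x one_pos
  obtain ⟨d, hd1, hd2, -⟩ := exists_comb_jet_of_points hα K y one_pos
  rw [← jetForm_congr hc1 hd2, ← jetForm_congr hd1 hc2]
  have hpi : (2 * Real.pi : ℂ) ≠ 0 := by
    exact_mod_cast (mul_pos two_pos Real.pi_pos).ne'
  have h1 : inner ℂ (hardyComb d) (H (hardyComb c)) =
      conj (inner ℂ (hardyComb c) (H (hardyComb d))) :=
    (hsymm (hardyComb d) (hardyComb c)).symm.trans (inner_conj_symm _ _).symm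
  rw [inner_hardyComb hα hdeg hH, inner_hardyComb hα hdeg hH, map_mul, map_add, inner_conj_symm,
    map_mul, conj_ofReal, map_ofNat] at h1
  exact add_left_cancel (mul_left_cancel₀ hpi h1)

end NegativeIndex

/-! ### Comparison of the Hankel operator with the jet form -/

section Main

variable {M : ℕ} {α : Fin M → ℂ} {K : Fin M → ℕ} {Q : Fin M → ℂ[X]}
  {H : hardySpace →L[ℂ] hardySpace}

/-- The jets, up to the orders `n`, of a function in the Hardy space. -/
def hardyJets (α : Fin M → ℂ) (n : Fin M → ℕ) : hardySpace →L[ℂ] ((Σ m, Fin (n m)) → ℂ) :=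
  ContinuousLinearMap.pi fun s => hardyJet (α s.1) s.2 ∘L hardySpace.subtypeL

lemma form_nonneg_of_hardyJets_eq_zero (hα : ∀ m, 0 < (α m).re)
    (hdeg : ∀ m, (Q m).natDegree ≤ K m)
    (hH : IsHankelOperator (fun x => carlemanSymbol x + rationalSymbol α K Q x) H)
    {τ : Fin M → Fin M} (hτ : ∀ m, α (τ m) = conj (α m))
    (hsym : ConjSymmetric K τ (fun m => symbolCoeff (α m) (K m) (Q m)) fun m => (α m).im)
    (w : hardySpace) (hw : hardyJets α (negJetCount K (fun m => symbolCoeff (α m) (K m) (Q m))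
      fun m => (α m).im) w = 0) :
    0 ≤ (inner ℂ w (H w)).re := by
  rw [hH.inner_eq]
  refine le_trans ?_ (jetForm_le_hankelLp hα hdeg hH.memLp_symbol w)
  rw [jetForm_eq_dotProduct hsym hτ]
  have h1 := hsym.form_nonneg (fun s => hardyJet (α s.1) s.2 w)
    fun s hs => congrFun hw ⟨s.1, ⟨s.2, hs⟩⟩
  have h2 : ∀ z : ℂ, (2 * Real.pi * z).re = 2 * Real.pi * z.re := fun z => by
    rw [← ofReal_ofNat, ← ofReal_mul, re_ofReal_mul]
  rw [h2]
  have := Real.pi_pos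
  positivity

lemma norm_sum_smul_sq_le {V ι : Type*} [NormedAddCommGroup V] [NormedSpace ℂ V] [Fintype ι]
    (v : ι → V) {ε : ℝ} (hv : ∀ i, ‖v i‖ ≤ ε) (z : ι → ℂ) :
    ‖∑ i, z i • v i‖ ^ 2 ≤ Fintype.card ι * ε ^ 2 * ∑ i, ‖z i‖ ^ 2 := by
  have h1 : ‖∑ i, z i • v i‖ ≤ ∑ i, ‖z i‖ * ε := (norm_sum_le _ _).trans
    (Finset.sum_le_sum fun i _ => by
      rw [norm_smul]
      exact mul_le_mul_of_nonneg_left (hv i) (norm_nonneg _))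
  calc ‖∑ i, z i • v i‖ ^ 2 ≤ (∑ i, ‖z i‖ * ε) ^ 2 := pow_le_pow_left₀ (norm_nonneg _) h1 2
    _ ≤ Fintype.card ι * ∑ i, (‖z i‖ * ε) ^ 2 := sq_sum_le_card_mul_sum_sq
    _ = _ := by
      simp only [mul_pow, ← Finset.sum_mul]
      ring

/-- A diagonal negative part of the form in the jets lifts to a negative subspace. -/
lemma exists_negative_subspace (hα : ∀ m, 0 < (α m).re)
    (hdeg : ∀ m, (Q m).natDegree ≤ K m)
    (hH : IsHankelOperator (fun x => carlemanSymbol x + rationalSymbol α K Q x) H)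
    (hinj : Function.Injective α)
    {τ : Fin M → Fin M} (hτ : ∀ m, α (τ m) = conj (α m))
    (hsym : ConjSymmetric K τ (fun m => symbolCoeff (α m) (K m) (Q m)) fun m => (α m).im)
    {ι : Type} [Fintype ι] [DecidableEq ι] {u : ι → (Σ m, Fin (K m + 1)) → ℂ} {l : ι → ℝ}
    (hl : ∀ i, l i < 0)
    (hu : ∀ i j, star (u i) ⬝ᵥ (hankelMatrix K τ fun m => symbolCoeff (α m) (K m) (Q m)).mulVec
      (u j) = if i = j then (l i : ℂ) else 0) :
    ∃ J : (ι → ℂ) →ₗ[ℂ] hardySpace, ∀ z, z ≠ 0 → (inner ℂ (J z) (H (J z))).re < 0 := by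
  -- The jet form is at most -δ∑|z_i|² on the span of the u i. With lifts of half-axis norm below ε,
  -- the Carleman part is at most card ι · ε² ∑|z_i|², which is too small to compensate.
  obtain ⟨δ, hδ, hlδ⟩ : ∃ δ : ℝ, 0 < δ ∧ ∀ i, l i ≤ -δ := by
    rcases isEmpty_or_nonempty ι with h | h
    · exact ⟨1, one_pos, fun i => isEmptyElim i⟩
    · obtain ⟨i, hi⟩ := Finite.exists_max l
      exact ⟨-l i, neg_pos.2 (hl i), fun j => by simpa using hi j⟩
  obtain ⟨ε, hε, hεδ⟩ : ∃ ε : ℝ, 0 < ε ∧ Fintype.card ι * ε ^ 2 < δ := by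
    have h1 : Tendsto (fun ε : ℝ => Fintype.card ι * ε ^ 2) (𝓝[>] 0) (𝓝 0) := by
      have h2 : Continuous fun ε : ℝ => (Fintype.card ι : ℝ) * ε ^ 2 := by fun_prop
      simpa using (h2.tendsto 0).mono_left nhdsWithin_le_nhds
    obtain ⟨ε, h2, h3⟩ := ((h1.eventually_lt_const hδ).and self_mem_nhdsWithin).exists
    exact ⟨ε, h3, h2⟩
  have hc : ∀ i, ∃ c : PosReal →₀ ℂ, (∀ s : Σ m, Fin (K m + 1), jet (α s.1) s.2 c = u i s) ∧
      ‖stieltjesComb c‖ < ε := fun i => by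
    -- The sum turns the vector u i, indexed by m, into data indexed by points; as the α m are
    -- distinct, only one term is nonzero at each α m.
    obtain ⟨c, h1, -, h2⟩ := exists_comb_jet_of_points hα K (fun a k => ∑ s : Σ m, Fin (K m + 1),
      if α s.1 = a ∧ (s.2 : ℕ) = k then u i s else 0) hε
    refine ⟨c, fun s => (h1 s.1 s.2 (Nat.lt_succ_iff.1 s.2.2)).trans ?_, h2⟩
    rw [Finset.sum_eq_single s]
    · simp
    · rintro ⟨m, b⟩ _ hts
      refine if_neg fun h => hts ?_
      obtain ⟨m', b'⟩ := s
      have hm : m = m' := hinj h.1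
      subst hm
      exact congrArg _ (Fin.ext h.2)
    · simp
  choose c hcu hcε using hc
  refine ⟨hardyComb ∘ₗ Fintype.linearCombination ℂ c, fun z hz => ?_⟩
  rw [LinearMap.comp_apply, inner_hardyComb hα hdeg hH, jetForm_eq_dotProduct hsym hτ]
  have h1 : (fun s : Σ m, Fin (K m + 1) => jets (Fintype.linearCombination ℂ c z) (α s.1) s.2) =
      ∑ i, z i • u i := by
    funext s
    rw [Fintype.linearCombination_apply, jets, map_sum, Finset.sum_apply]
    refine Finset.sum_congr rfl fun i _ => ?_
    rw [map_smul, hcu, Pi.smul_apply]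
  rw [h1, dotProduct_mulVec_sum_smul hu, inner_self_eq_ofReal_norm_sq]
  have h2 : stieltjesComb (Fintype.linearCombination ℂ c z) = ∑ i, z i • stieltjesComb (c i) := by
    rw [Fintype.linearCombination_apply, map_sum]
    simp only [map_smul]
  have h3 := norm_sum_smul_sq_le (fun i => stieltjesComb (c i)) (fun i => (hcε i).le) z
  rw [← h2] at h3
  have h4 : ∑ i, l i * ‖z i‖ ^ 2 ≤ -δ * ∑ i, ‖z i‖ ^ 2 := by
    rw [Finset.mul_sum]
    exact Finset.sum_le_sum fun i _ => mul_le_mul_of_nonneg_right (hlδ i) (sq_nonneg _)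
  have h5 : 0 < ∑ i, ‖z i‖ ^ 2 := by
    obtain ⟨i, hi⟩ := Function.ne_iff.1 hz
    exact Finset.sum_pos' (fun i _ => sq_nonneg _)
      ⟨i, Finset.mem_univ i, pow_pos (norm_pos_iff.2 hi) 2⟩
  have h6 : (2 * Real.pi * (((‖stieltjesComb (Fintype.linearCombination ℂ c z)‖ ^ 2 : ℝ) : ℂ) +
      ((∑ i, l i * ‖z i‖ ^ 2 : ℝ) : ℂ))).re =
      2 * Real.pi * (‖stieltjesComb (Fintype.linearCombination ℂ c z)‖ ^ 2 +
        ∑ i, l i * ‖z i‖ ^ 2) := by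
    norm_cast
  rw [h6]
  refine mul_neg_of_pos_of_neg (mul_pos two_pos Real.pi_pos) ?_
  have h7 := mul_lt_mul_of_pos_right hεδ h5
  linarith

end Main

end

theorem theorem5p2 (M : ℕ) (α : Fin M → ℂ) (K : Fin M → ℕ) (Q : Fin M → ℂ[X])
    (hα : ∀ m, 0 < (α m).re) (hαinj : Function.Injective α)
    (hdeg : ∀ m, (Q m).natDegree ≤ K m) (hQ : ∀ m, (Q m).eval (-I * α m) ≠ 0) :
    -- the Hankel operator with symbol `π i sgn x + φ(x)` exists as a bounded operator
    (∃ H : hardySpace →L[ℂ] hardySpace,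
      IsHankelOperator (fun x => carlemanSymbol x + rationalSymbol α K Q x) H) ∧
    ∀ H : hardySpace →L[ℂ] hardySpace,
      IsHankelOperator (fun x => carlemanSymbol x + rationalSymbol α K Q x) H →
      -- `H` is self-adjoint
      (H : hardySpace →ₗ[ℂ] hardySpace).IsSymmetric →
        -- the strictly negative spectrum consists of eigenvalues
        (∀ μ : ℝ, μ < 0 → (μ : ℂ) ∈ spectrum ℂ H →
          Module.End.HasEigenvalue (H : hardySpace →ₗ[ℂ] hardySpace) (μ : ℂ)) ∧
        -- and its total multiplicity is
        negEigenvalueCount H =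
          (((∑ m with (α m).im = 0, negIndex (K m) ((Q m).eval (-I * α m)).re)
            + (∑ m with 0 < (α m).im, K m)
            + (Finset.univ.filter fun m => 0 < (α m).im).card : ℕ) : Cardinal) := by
  classical
  refine ⟨exists_isHankelOperator (memLp_top_symbol hα hdeg), fun H hH hsymm => ?_⟩
  set κ : Fin M → ℕ → ℂ := fun m => symbolCoeff (α m) (K m) (Q m) with hκ
  have hlead : ∀ m, κ m (K m) = (Q m).eval (-I * α m) := fun m => symbolCoeff_self _ _ _
  obtain ⟨τ, hτ, hsym⟩ := exists_conjSymmetric (κ := κ) hαinj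
    (fun m => by rw [hlead]; exact hQ m) (jetForm_hermitian hα hdeg hH hsymm)
  -- n counts for the jet form and n' for its negative. Vanishing of the first n m jets makes the
  -- form of H nonnegative: codimension at most ∑ n m.
  set n := negJetCount K κ fun m => (α m).im with hn
  set n' := negJetCount K (-κ) (-fun m => (α m).im) with hn'
  have hnn : ∀ m, n m + n' m = K m + 1 := hsym.negJetCount_add
  have hker := form_nonneg_of_hardyJets_eq_zero hα hdeg hH hτ hsym
  refine ⟨fun μ hμ hs => hasEigenvalue_of_mem_spectrum_of_neg hsymm _ hker hμ hs, ?_⟩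
  -- The matrix form is nonpositive where the first n' m coordinates vanish, so its negative part
  -- has dimension at least ∑ (K m + 1) - ∑ n' m = ∑ n m.
  obtain ⟨ι, u, l, hl, hu, hcard⟩ := exists_negative_diagonal hsym.isHermitian
    hsym.eq_zero_of_mulVec (restrictJets K n' fun m => negJetCount_le m) fun ξ hξ => by
      have h1 := hsym.neg.form_nonneg ξ (apply_eq_zero_of_restrictJets hξ)
      rw [hankelMatrix_neg, Matrix.neg_mulVec, dotProduct_neg, neg_re] at h1
      linarith
  obtain ⟨J, hJ⟩ := exists_negative_subspace hα hdeg hH hαinj hτ hsym hl hu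
  have hcount : ∑ m, n m = _ := sum_negJetCount fun m => (α m).im
  simp only [hlead] at hcount
  rw [negEigenvalueCount_eq hsymm _ hker J hJ ?_]
  · rw [← hcount]
    simp [hn, hκ]
  · simp only [Fintype.card_sigma, Fintype.card_fin, Module.finrank_fintype_fun_eq_card]
      at hcard ⊢
    simp only [← hnn, Finset.sum_add_distrib] at hcard
    exact Nat.le_of_add_le_add_left (by rw [add_comm]; exact hcard)
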